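/- Let $\Omega\subset\mathbb C^n$ be a bounded domain and $2\le p<\infty$. Let $A^p(\Omega)$ be the space of holomorphic functions $f$ on $\Omega$ with $\|f\|_p^p:=\int_\Omega|f|^p<\infty$ (Lebesgue measure), and for $z\in\Omega$, $X\in\mathbb C^n$ put $$m_p(z)=\inf\{\|f\|_p: f\in A^p(\Omega),\ f(z)=1\},\qquad K_p(z)=m_p(z)^{-p},$$ $$B_p(z;X)=K_p(z)^{-1/p}\,\sup\{|Xf(z)|: f\in A^p(\Omega),\ f(z)=0,\ \|f\|_p=1\},\qquad Xf=\sum_{j=1}^n X_j\frac{\partial f}{\partial z_j}.$$ For a real-valued function $u$, defined and continuous near a point $t\in\mathbb C$, let $$\Box u(t)=\liminf_{r\to0+}\frac1{r^2}\Big\{\frac1{2\pi}\int_0^{2\pi}u(t+re^{i\theta})\,d\theta-u(t)\Big\}\in[-\infty,\infty],$$ and define the generalized Levi form of $\log K_p$ by $i\partial\bar\partial\log K_p(z;X)=\Box\big(t\mapsto\log K_p(z+tX)\big)(0)$. Define the holomorphic sectional curvature of $B_p$ at $z\in\Omega$, $X\in\mathbb C^n\setminus\{0\}$, by $$\mathrm{HSC}_p(z;X)=\sup_\sigma\frac{\Box\big(t\mapsto\log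 B_p(\sigma(t);\sigma'(t))^2\big)(0)}{-B_p(z;X)^2},$$ where $\sigma$ runs over all holomorphic maps from some disc $\{t\in\mathbb C:|t|<r\}$, $r>0$, into $\Omega$ with $\sigma(0)=z$ and $\sigma'(0)=X$. Then for all $z\in\Omega$ and all $X\in\mathbb C^n\setminus\{0\}$, $$\mathrm{HSC}_p(z;X)\le\frac2p\cdot\frac{i\partial\bar\partial\log K_p(z;X)}{B_p(z;X)^2}+\frac p2 .$$ -/

import Mathlib

open Filter Topology MeasureTheory

noncomputable section

/-- The `p`-Bergman space `A^p(Ω)` of a set `Ω ⊆ ℂⁿ`: functions that are holomorphic on `Ω` and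
whose `p`-th power is Lebesgue integrable over `Ω`. (`Fin n → ℂ` carries the product Lebesgue
measure; its norm enters only through its topology and its bounded sets.) -/
def pBergmanSpace {n : ℕ} (Ω : Set (Fin n → ℂ)) (p : ℝ) : Set ((Fin n → ℂ) → ℂ) :=
  {f | DifferentiableOn ℂ f Ω ∧ IntegrableOn (fun ζ => ‖f ζ‖ ^ p) Ω}

/-- `‖f‖_p = (∫_Ω |f|^p)^(1/p)`. -/
def pBergmanNorm {n : ℕ} (Ω : Set (Fin n → ℂ)) (p : ℝ) (f : (Fin n → ℂ) → ℂ) : ℝ :=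
  (∫ ζ in Ω, ‖f ζ‖ ^ p) ^ (1 / p)

/-- `m_p(z) = inf {‖f‖_p : f ∈ A^p(Ω), f(z) = 1}`. -/
def pBergmanMin {n : ℕ} (Ω : Set (Fin n → ℂ)) (p : ℝ) (z : Fin n → ℂ) : ℝ :=
  sInf {s | ∃ f ∈ pBergmanSpace Ω p, f z = 1 ∧ s = pBergmanNorm Ω p f}

/-- The `p`-Bergman kernel on the diagonal, `K_p(z) = m_p(z)^(-p)`. -/
def pBergmanKernel {n : ℕ} (Ω : Set (Fin n → ℂ)) (p : ℝ) (z : Fin n → ℂ) : ℝ :=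
  pBergmanMin Ω p z ^ (-p)

/-- The `p`-Bergman metric `B_p(z;X) = K_p(z)^(-1/p) sup |Xf(z)|`, the supremum being over
`f ∈ A^p(Ω)` with `f(z) = 0` and `‖f‖_p = 1`; here `Xf(z) = ∑ⱼ Xⱼ ∂f/∂zⱼ(z)` is the complex
derivative of `f` at `z` in the direction `X`. -/
def pBergmanMetric {n : ℕ} (Ω : Set (Fin n → ℂ)) (p : ℝ) (z X : Fin n → ℂ) : ℝ :=
  pBergmanKernel Ω p z ^ (-1 / p) *
    sSup {s | ∃ f ∈ pBergmanSpace Ω p, f z = 0 ∧ pBergmanNorm Ω p f = 1 ∧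
      s = ‖fderiv ℂ f z X‖}

/-- The generalized complex Laplacian
`□u(t) = liminf_{r → 0+} r⁻² ((1/2π) ∫₀^{2π} u(t + r e^{iθ}) dθ - u(t))`,
as an extended real number. -/
def genLaplacian (u : ℂ → ℝ) (t : ℂ) : EReal :=
  liminf (fun r : ℝ => (((Real.circleAverage u t r - u t) / r ^ 2 : ℝ) : EReal)) (𝓝[>] 0)

/-- The generalized Levi form `i∂∂̄u(z;X)`: the generalized complex Laplacian at `t = 0` of
`t ↦ u(z + tX)`. -/
def genLeviForm {n : ℕ} (u : (Fin n → ℂ) → ℝ) (z X : Fin n → ℂ) : EReal :=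
  genLaplacian (fun t => u (z + t • X)) 0

/-- `σ` is (on some disc `|t| < r`) a holomorphic map into `Ω` with `σ(0) = z`, `σ'(0) = X`. -/
def IsHolDisc {n : ℕ} (Ω : Set (Fin n → ℂ)) (z X : Fin n → ℂ) (σ : ℂ → (Fin n → ℂ)) : Prop :=
  ∃ r : ℝ, 0 < r ∧ DifferentiableOn ℂ σ (Metric.ball 0 r) ∧
    Set.MapsTo σ (Metric.ball 0 r) Ω ∧ σ 0 = z ∧ deriv σ 0 = X

/-- The holomorphic sectional curvature of the Finsler metric `B_p`:
`HSC_p(z;X) = sup_σ □ log B_p²(σ;σ')(0) / (-B_p(z;X)²)`, the supremum being over all holomorphic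
discs `σ` in `Ω` with `σ(0) = z`, `σ'(0) = X`. -/
def pBergmanHSC {n : ℕ} (Ω : Set (Fin n → ℂ)) (p : ℝ) (z X : Fin n → ℂ) : EReal :=
  ⨆ (σ : ℂ → (Fin n → ℂ)) (_ : IsHolDisc Ω z X σ),
    genLaplacian (fun t => Real.log (pBergmanMetric Ω p (σ t) (deriv σ t) ^ 2)) 0 /
      ((-(pBergmanMetric Ω p z X ^ 2) : ℝ) : EReal)

end

/-!
Fix `z ∈ Ω` and `X ≠ 0`. Since `B_p = m_p · M_p`, where `M_p(w; Y)` is the supremum of `|Yf(w)|` over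
`f ∈ A^p(Ω)` with `f(w) = 0` and `‖f‖_p = 1`, it is enough to control the circle averages of
`log m_p(σ)` and of `log M_p(σ; σ')` up to `o(r²)` along every holomorphic disc `σ` through `z` with
`σ'(0) = X`. Subtracting logarithms of moduli of zero-free holomorphic functions changes nothing,
because these are harmonic.

*The kernel.* Let `g` be the minimizer for `m_p(z)` (`exists_isMinimizer`) and `π` the probability
measure with density `|g|^p / ‖g‖_p^p`. The Euler-Lagrange equation says `∫ F/g dπ = F(z)` for every
`F ∈ A^p(Ω)` (`IsMinimizer.integral_quot`). The defect
`D(w) = log m_p(z) - log m_p(w) - log |g(w)|` is nonnegative, and on each ray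
`p D(σ(r e)) / r²` has a limit that depends on `e` and `X` only. The second-order term of
`∫ |1 + x|^p dπ` is the square of a Hilbert norm, namely `(p/2) ∫ |S x|²` for a real-linear map `S`
of `ℂ` (`stretch`), and the limit is `(p/2) ∫ |ξ_e|²` for the Riesz representer `ξ_e` of
`F ↦ Re (e (F/g)'(z; X))` on the closure of the functions `S (F/g)`. The lower bound
(`IsMinimizer.logMinDefect_lower`) comes from test functions `g + r h` with `S (h/g)` close to `ξ_e`,
the upper bound (`IsMinimizer.logMinDefect_upper`) from Hölder's inequality with the conjugate
exponent applied to an approximate dual extremal `1 + r S ξ_e + O(r²)`. Dominated convergence over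
the circle shows that the averaged defect has one second-order limit `L / p`, common to all discs
(`IsMinimizer.exists_tendsto_circleAverage_defect`); applied to the affine disc this identifies `L`
with the generalized Levi form of `log K_p` (`IsMinimizer.genLeviForm_eq`).

*The derivative.* Let `f` be extremal for `M_p(z; X)` (`exists_derivExtremal`) and `φ = f(σ)/g(σ)`.
The competitor `f - φ(t) g` at `σ(t)` gives
`log M_p(σ; σ') ≥ log |φ'(t)| + log |g(σ(t))| - log ‖f - φ(t) g‖_p`
(`log_norm_le_log_pBergmanDerivSup`). In the expansion of `‖f - φ g‖_p^p` the linear term and the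
term in `φ²` are harmonic, so that on average only `(p²/4) |φ|² ∫ |g/f|²` survives
(`tendsto_circleAverage_integral_powRem`), and the last integral is at most `m_p(z)²`
(`integral_norm_quot_sq_le`).

Adding up, the generalized Laplacian of `log B_p(σ; σ')²` at `0` is at least
`-(2/p) L - (p/2) B_p(z; X)²` (`IsMinimizer.le_genLaplacian_log_metric`), and division by
`-B_p(z; X)²` gives the bound. Circle averages of nonintegrable functions are zero by convention;
integrability comes from the semicontinuity of `m_p` and `M_p` together with local bounds.
-/

noncomputable section

/-! ### Rotation averages on polydiscs -/

lemma measurePreserving_unit_smul {n : ℕ} (c : ℂ) (hc : ‖c‖ = 1) :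
    MeasurePreserving (fun x : Fin n → ℂ => c • x) := by
  have h1 : MeasurePreserving (fun x : ℂ => c • x) := by
    have := (rotation ⟨c, by simp [Submonoid.unitSphere, hc]⟩).measurePreserving
    convert this using 2
    rfl
  exact volume_preserving_pi (fun _ : Fin n => h1)

/-- Polydiscs centred at the origin are invariant under the circle action, so an integral over one
is unchanged when the integrand is averaged over circles. -/
lemma lintegral_ball_rotation {n : ℕ} (δ : ℝ) (g : (Fin n → ℂ) → ENNReal) (hg : Measurable g) :
    ENNReal.ofReal (2 * Real.pi) * ∫⁻ η in Metric.ball (0 : Fin n → ℂ) δ, g η =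
      ∫⁻ η in Metric.ball (0 : Fin n → ℂ) δ,
        ∫⁻ θ in Set.Ioc 0 (2 * Real.pi), g (circleMap 0 1 θ • η) := by
  have hm : Measurable (fun q : (Fin n → ℂ) × ℝ => g (circleMap 0 1 q.2 • q.1)) := by
    apply hg.comp
    apply Continuous.measurable
    fun_prop
  rw [lintegral_lintegral_swap hm.aemeasurable]
  have h1 : ∀ θ : ℝ, ∫⁻ η in Metric.ball (0 : Fin n → ℂ) δ, g (circleMap 0 1 θ • η) =
      ∫⁻ η in Metric.ball (0 : Fin n → ℂ) δ, g η := by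
    intro θ
    have hc : ‖circleMap 0 1 θ‖ = 1 := by simp
    have := (measurePreserving_unit_smul (n := n) _ hc).setLIntegral_comp_preimage
      (s := Metric.ball 0 δ) Metric.isOpen_ball.measurableSet hg
    rw [← this]
    congr 2
    ext x
    simp [norm_smul]
  simp_rw [h1]
  rw [setLIntegral_const, Real.volume_Ioc, mul_comm]
  simp

lemma differentiableOn_slice {n : ℕ} {F : (Fin n → ℂ) → ℂ} {ζ : Fin n → ℂ} {δ : ℝ}
    (hF : DifferentiableOn ℂ F (Metric.ball ζ δ)) {η : Fin n → ℂ} (hη : ‖η‖ < δ) :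
    ∃ R > 1, DifferentiableOn ℂ (fun l : ℂ => F (ζ + l • η)) (Metric.ball 0 R) := by
  obtain ⟨R, hR1, hR⟩ : ∃ R > 1, R * ‖η‖ < δ := by
    have : Tendsto (fun R : ℝ => R * ‖η‖) (𝓝[>] 1) (𝓝 (1 * ‖η‖)) :=
      ((continuous_id.mul continuous_const).tendsto 1).mono_left nhdsWithin_le_nhds
    rw [one_mul] at this
    obtain ⟨R, h1, h2⟩ := ((this.eventually_lt_const hη).and self_mem_nhdsWithin).exists
    exact ⟨R, h2, h1⟩
  refine ⟨R, hR1, hF.comp (by fun_prop) ?_⟩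
  intro l hl
  simp only [Metric.mem_ball, dist_self_add_left, norm_smul, dist_zero_right] at hl ⊢
  exact lt_of_le_of_lt (mul_le_mul_of_nonneg_right hl.le (norm_nonneg _)) hR

/-- Mean value inequality on polydiscs. -/
lemma enorm_mul_volume_le_lintegral {n : ℕ} {F : (Fin n → ℂ) → ℂ} {ζ : Fin n → ℂ} {δ : ℝ}
    (hF : DifferentiableOn ℂ F (Metric.ball ζ δ)) :
    ‖F ζ‖ₑ * volume (Metric.ball (0 : Fin n → ℂ) δ) ≤ ∫⁻ η in Metric.ball ζ δ, ‖F η‖ₑ := by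
  classical
  set B := Metric.ball (0 : Fin n → ℂ) δ with hB
  have hBm : MeasurableSet B := Metric.isOpen_ball.measurableSet
  set g : (Fin n → ℂ) → ENNReal := B.piecewise (fun η => ‖F (ζ + η)‖ₑ) 0 with hg
  have hmaps : Set.MapsTo (fun η => ζ + η) B (Metric.ball ζ δ) := by
    intro η hη
    simpa [hB] using hη
  have hgm : Measurable g := by
    refine ContinuousOn.measurable_piecewise ?_ continuousOn_const hBm
    exact (hF.continuousOn.comp (by fun_prop) hmaps).enorm
  have hshift : ∫⁻ η in Metric.ball ζ δ, ‖F η‖ₑ = ∫⁻ η in B, g η := by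
    rw [setLIntegral_congr_fun hBm (g := fun η => ‖F (ζ + η)‖ₑ)
      (fun η hη => by
        rw [hg]; exact Set.piecewise_eq_of_mem B (fun η => ‖F (ζ + η)‖ₑ) 0 hη)]
    have := (measurePreserving_add_left volume ζ).setLIntegral_comp_preimage_emb
      (measurableEmbedding_addLeft ζ) (fun η => ‖F η‖ₑ) (Metric.ball ζ δ)
    rw [← this]
    congr 2
    ext η
    simp [hB]
  have hpi : (0 : ℝ) < 2 * Real.pi := by positivity
  have key : ENNReal.ofReal (2 * Real.pi) * (‖F ζ‖ₑ * volume B) ≤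
      ENNReal.ofReal (2 * Real.pi) * ∫⁻ η in B, g η := by
    rw [lintegral_ball_rotation δ g hgm, ← mul_assoc, ← setLIntegral_const]
    apply setLIntegral_mono' hBm
    intro η hη
    have hη' : ‖η‖ < δ := by simpa [hB] using hη
    obtain ⟨R, hR, hd⟩ := differentiableOn_slice hF hη'
    have h1 : Real.circleAverage (fun l : ℂ => F (ζ + l • η)) 0 1 = F ζ := by
      have := DiffContOnCl.circleAverage (c := (0 : ℂ)) (R := 1) (f := fun l : ℂ => F (ζ + l • η))
        (DifferentiableOn.diffContOnCl (hd.mono ?_))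
      · simpa using this
      · rw [abs_one, closure_ball _ one_ne_zero]
        exact Metric.closedBall_subset_ball hR
    rw [Real.circleAverage_def] at h1
    have h2 : ∫ θ in (0 : ℝ)..2 * Real.pi, F (ζ + circleMap 0 1 θ • η) =
        (2 * Real.pi : ℝ) • F ζ := by
      rw [← h1, smul_inv_smul₀ hpi.ne']
    have h3 : ENNReal.ofReal (2 * Real.pi) * ‖F ζ‖ₑ = ‖(2 * Real.pi : ℝ) • F ζ‖ₑ := by
      rw [enorm_smul, Real.enorm_eq_ofReal hpi.le]
    rw [h3, ← h2, intervalIntegral.integral_of_le hpi.le]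
    refine (enorm_integral_le_lintegral_enorm _).trans (le_of_eq ?_)
    apply lintegral_congr
    intro θ
    have : circleMap 0 1 θ • η ∈ B := by simpa [hB, norm_smul] using hη'
    rw [hg, Set.piecewise_eq_of_mem _ _ _ this]
  rw [hshift]
  exact (ENNReal.mul_le_mul_iff_right (by simpa using hpi) ENNReal.ofReal_ne_top).1 key

/-- A holomorphic function on a polydisc that does not vanish at the centre vanishes almost
nowhere: on almost every circle about the centre it has isolated zeros. -/
lemma volume_zero_set_ball {n : ℕ} {F : (Fin n → ℂ) → ℂ} {ζ : Fin n → ℂ} {δ : ℝ}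
    (hF : DifferentiableOn ℂ F (Metric.ball ζ δ)) (h0 : F ζ ≠ 0) :
    volume {x ∈ Metric.ball ζ δ | F x = 0} = 0 := by
  classical
  set B := Metric.ball (0 : Fin n → ℂ) δ with hB
  have hBm : MeasurableSet B := Metric.isOpen_ball.measurableSet
  have hmaps : Set.MapsTo (fun η => ζ + η) B (Metric.ball ζ δ) := by
    intro η hη
    simpa [hB] using hη
  set Z : Set (Fin n → ℂ) := {η ∈ B | F (ζ + η) = 0} with hZ
  have hZm : MeasurableSet Z := by
    have hc : ContinuousOn (fun η => F (ζ + η)) B :=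
      hF.continuousOn.comp (by fun_prop) hmaps
    have ho : IsOpen (B ∩ (fun η => F (ζ + η)) ⁻¹' {0}ᶜ) :=
      hc.isOpen_inter_preimage Metric.isOpen_ball isOpen_compl_singleton
    have : Z = B \ (B ∩ (fun η => F (ζ + η)) ⁻¹' {0}ᶜ) := by
      ext η
      simp [hZ]
    rw [this]
    exact hBm.diff ho.measurableSet
  have hshift : volume {x ∈ Metric.ball ζ δ | F x = 0} = volume Z := by
    rw [← measure_preimage_add volume ζ]
    congr 1
    ext η
    simp [hZ, hB]
  rw [hshift]
  have hpi : (0 : ℝ) < 2 * Real.pi := by positivity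
  have hrot := lintegral_ball_rotation δ (Z.indicator 1) (measurable_one.indicator hZm)
  have hzero : ∫⁻ η in B, ∫⁻ θ in Set.Ioc 0 (2 * Real.pi),
      Z.indicator (1 : (Fin n → ℂ) → ENNReal) (circleMap 0 1 θ • η) = 0 := by
    rw [← lintegral_zero (μ := volume.restrict B)]
    apply setLIntegral_congr_fun hBm
    intro η hη
    have hη' : ‖η‖ < δ := by simpa [hB] using hη
    obtain ⟨R, hR, hd⟩ := differentiableOn_slice hF hη'
    have han := hd.analyticOnNhd Metric.isOpen_ball
    have hcod := han.preimage_zero_mem_codiscreteWithin (x := 0) (by simpa using h0)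
      (Metric.mem_ball_self (by linarith)) (Metric.isConnected_ball (by linarith))
    have hsub : Metric.sphere (0 : ℂ) |1| ⊆ Metric.ball 0 R := by
      rw [abs_one]
      exact Metric.sphere_subset_closedBall.trans (Metric.closedBall_subset_ball hR)
    have hcod2 := circleMap_preimage_codiscrete (c := 0) (R := 1) one_ne_zero
      (codiscreteWithin_mono hsub hcod)
    have hae := ae_restrict_le_codiscreteWithin (μ := volume) (measurableSet_Ioc (a := (0:ℝ)) (b := 2 * Real.pi))
      (codiscreteWithin_mono (Set.subset_univ _) hcod2)
    simp only
    rw [lintegral_eq_zero_iff']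
    · filter_upwards [hae] with θ hθ
      have : circleMap 0 1 θ • η ∉ Z := fun h => hθ (by simpa using h.2)
      simp [this]
    · apply Measurable.aemeasurable
      exact (measurable_one.indicator hZm).comp (Continuous.measurable (by fun_prop))
  rw [hzero, lintegral_indicator_one hZm, mul_eq_zero] at hrot
  rcases hrot with h | h
  · simp at h; linarith [Real.pi_pos]
  · rwa [Measure.restrict_apply hZm, Set.inter_eq_left.2 (fun x hx => hx.1)] at h

/-- The zero set of a holomorphic function on a connected open set is a null set, unless the
function vanishes identically. -/
lemma volume_zero_set {n : ℕ} {Ω : Set (Fin n → ℂ)} (hΩo : IsOpen Ω) (hΩc : IsPreconnected Ω)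
    {F : (Fin n → ℂ) → ℂ} (hF : DifferentiableOn ℂ F Ω) {z : Fin n → ℂ} (hz : z ∈ Ω)
    (h0 : F z ≠ 0) : volume {x ∈ Ω | F x = 0} = 0 := by
  -- the set of points near which `F` vanishes identically is open and closed in `Ω`
  have hnz : ∀ x ∈ Ω, ∃ᶠ y in 𝓝 x, F y ≠ 0 := by
    set U : Set (Fin n → ℂ) := {x | ∀ᶠ y in 𝓝 x, F y = 0} with hU
    have hUo : IsOpen U := isOpen_setOfPred_eventually_nhds
    have hcl : closure U ∩ Ω ⊆ U := by
      rintro x ⟨hx, hxΩ⟩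
      obtain ⟨ε, hε, hb⟩ := Metric.isOpen_iff.1 hΩo x hxΩ
      obtain ⟨y, hyb, hyU⟩ := mem_closure_iff_nhds.1 hx _ (Metric.ball_mem_nhds x hε)
      have : ∀ w ∈ Metric.ball x ε, F w = 0 := by
        intro w hw
        set L : ℂ → (Fin n → ℂ) := fun l => y + l • (w - y) with hL
        have hLc : Continuous L := by fun_prop
        set V : Set ℂ := L ⁻¹' Metric.ball x ε with hV
        have hVo : IsOpen V := Metric.isOpen_ball.preimage hLc
        have hVc : IsPreconnected V := by
          apply Convex.isPreconnected
          intro a ha b hb s t hs ht hst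
          have : L (s • a + t • b) = s • L a + t • L b := by
            simp only [hL]
            have h1 : y = s • y + t • y := by rw [← add_smul, hst, one_smul]
            ext i
            have h1i := congrFun h1 i
            simp only [Pi.add_apply, Pi.smul_apply, Complex.real_smul, smul_eq_mul,
              Pi.sub_apply] at h1i ⊢
            linear_combination h1i
          simp only [hV, Set.mem_preimage, this]
          exact convex_ball x ε ha hb hs ht hst
        have hd : DifferentiableOn ℂ (fun l => F (L l)) V :=
          (hF.mono hb).comp (by fun_prop) (fun l hl => hl)
        have han := hd.analyticOnNhd hVo
        have h0V : (0 : ℂ) ∈ V := by simpa [hV, hL] using hyb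
        have h1V : (1 : ℂ) ∈ V := by simpa [hV, hL] using hw
        have hev : (fun l => F (L l)) =ᶠ[𝓝 0] 0 := by
          have ht : Tendsto L (𝓝 0) (𝓝 y) := by
            have := hLc.tendsto 0
            simpa [hL] using this
          exact ht.eventually hyU
        have := han.eqOn_zero_of_preconnected_of_eventuallyEq_zero hVc h0V hev h1V
        simpa [hL] using this
      exact Filter.mem_of_superset (Metric.ball_mem_nhds x hε) this
    intro x hx
    by_contra hcon
    have hxU : x ∈ U := by simpa [hU, Filter.not_frequently] using hcon
    have hsub := hΩc.subset_of_closure_inter_subset hUo ⟨x, hx, hxU⟩ hcl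
    have h1 : ∀ᶠ y in 𝓝 z, F y = 0 := hsub hz
    exact h0 h1.self_of_nhds
  apply measure_null_of_locally_null
  rintro x ⟨hx, -⟩
  obtain ⟨ε, hε, hb⟩ := Metric.isOpen_iff.1 hΩo x hx
  obtain ⟨y, hy0, hyb⟩ := ((hnz x hx).and_eventually
    (Metric.ball_mem_nhds x (half_pos hε))).exists
  have hyx : dist y x < ε / 2 := hyb
  have hsub : Metric.ball y (ε / 2) ⊆ Metric.ball x ε :=
    Metric.ball_subset_ball' (by linarith)
  have hnull := volume_zero_set_ball (hF.mono (hsub.trans hb)) hy0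
  refine ⟨{x ∈ Ω | F x = 0} ∩ Metric.ball y (ε / 2), ?_, ?_⟩
  · refine inter_mem_nhdsWithin _ (Metric.isOpen_ball.mem_nhds ?_)
    rw [Metric.mem_ball, dist_comm]
    exact hyx
  · refine measure_mono_null ?_ hnull
    exact fun w hw => ⟨hw.2, hw.1.2⟩

/-! ### The space `A^p(Ω)`: linear structure, evaluation bounds, completeness -/

section Basic

variable {n : ℕ} {Ω : Set (Fin n → ℂ)} {p : ℝ}

lemma mem_pBergmanSpace_iff (hΩo : IsOpen Ω) (hp : 0 < p) {f : (Fin n → ℂ) → ℂ} :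
    f ∈ pBergmanSpace Ω p ↔
      DifferentiableOn ℂ f Ω ∧ MemLp f (ENNReal.ofReal p) (volume.restrict Ω) := by
  unfold pBergmanSpace
  simp only [Set.mem_ofPred_eq]
  refine and_congr_right fun hd => ?_
  have hm : AEStronglyMeasurable f (volume.restrict Ω) :=
    hd.continuousOn.aestronglyMeasurable hΩo.measurableSet
  have := integrable_norm_rpow_iff hm (p := ENNReal.ofReal p) (by simpa using hp)
    ENNReal.ofReal_ne_top
  rw [ENNReal.toReal_ofReal hp.le] at this
  exact this

lemma eLpNorm_eq_ofReal_pBergmanNorm (hΩo : IsOpen Ω) (hp : 0 < p) {f : (Fin n → ℂ) → ℂ}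
    (hf : f ∈ pBergmanSpace Ω p) :
    eLpNorm f (ENNReal.ofReal p) (volume.restrict Ω) = ENNReal.ofReal (pBergmanNorm Ω p f) := by
  have := ((mem_pBergmanSpace_iff hΩo hp).1 hf).2.eLpNorm_eq_integral_rpow_norm
    (by simpa using hp) ENNReal.ofReal_ne_top
  rw [ENNReal.toReal_ofReal hp.le] at this
  rw [this, pBergmanNorm, one_div]

lemma pBergman_add (hΩo : IsOpen Ω) (hp : 0 < p) {f g : (Fin n → ℂ) → ℂ}
    (hf : f ∈ pBergmanSpace Ω p) (hg : g ∈ pBergmanSpace Ω p) :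
    f + g ∈ pBergmanSpace Ω p := by
  rw [mem_pBergmanSpace_iff hΩo hp] at *
  exact ⟨hf.1.add hg.1, hf.2.add hg.2⟩

lemma pBergman_smul (hΩo : IsOpen Ω) (hp : 0 < p) {f : (Fin n → ℂ) → ℂ} (c : ℂ)
    (hf : f ∈ pBergmanSpace Ω p) : c • f ∈ pBergmanSpace Ω p := by
  rw [mem_pBergmanSpace_iff hΩo hp] at *
  exact ⟨hf.1.const_smul c, hf.2.const_smul c⟩

lemma pBergman_sub (hΩo : IsOpen Ω) (hp : 0 < p) {f g : (Fin n → ℂ) → ℂ}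
    (hf : f ∈ pBergmanSpace Ω p) (hg : g ∈ pBergmanSpace Ω p) :
    f - g ∈ pBergmanSpace Ω p := by
  rw [mem_pBergmanSpace_iff hΩo hp] at *
  exact ⟨hf.1.sub hg.1, hf.2.sub hg.2⟩

lemma pBergman_of_bounded (hΩo : IsOpen Ω) (hΩb : Bornology.IsBounded Ω) (hp : 0 < p)
    {f : (Fin n → ℂ) → ℂ} (hd : DifferentiableOn ℂ f Ω) {C : ℝ} (hC : ∀ ζ ∈ Ω, ‖f ζ‖ ≤ C) :
    f ∈ pBergmanSpace Ω p := by
  rw [mem_pBergmanSpace_iff hΩo hp]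
  have : IsFiniteMeasure (volume.restrict Ω) := ⟨by simpa using hΩb.measure_lt_top⟩
  refine ⟨hd, MemLp.of_bound (hd.continuousOn.aestronglyMeasurable hΩo.measurableSet) C ?_⟩
  exact (ae_restrict_iff' hΩo.measurableSet).2 (Eventually.of_forall hC)

lemma pBergmanNorm_nonneg (f : (Fin n → ℂ) → ℂ) : 0 ≤ pBergmanNorm Ω p f :=
  Real.rpow_nonneg (integral_nonneg fun _ => Real.rpow_nonneg (norm_nonneg _) _) _

lemma pBergmanNorm_rpow (hp : 0 < p) (f : (Fin n → ℂ) → ℂ) :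
    pBergmanNorm Ω p f ^ p = ∫ ζ in Ω, ‖f ζ‖ ^ p := by
  rw [pBergmanNorm, ← Real.rpow_mul, one_div_mul_cancel hp.ne', Real.rpow_one]
  exact integral_nonneg fun _ => Real.rpow_nonneg (norm_nonneg _) _

lemma pBergmanNorm_smul (hp : 0 < p) (c : ℂ) (f : (Fin n → ℂ) → ℂ) :
    pBergmanNorm Ω p (c • f) = ‖c‖ * pBergmanNorm Ω p f := by
  unfold pBergmanNorm
  have : ∀ ζ, ‖(c • f) ζ‖ ^ p = ‖c‖ ^ p * ‖f ζ‖ ^ p := fun ζ => by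
    rw [Pi.smul_apply, norm_smul, Real.mul_rpow (norm_nonneg _) (norm_nonneg _)]
  simp_rw [this]
  rw [integral_const_mul, Real.mul_rpow (Real.rpow_nonneg (norm_nonneg _) _)
    (integral_nonneg fun _ => Real.rpow_nonneg (norm_nonneg _) _), ← Real.rpow_mul (norm_nonneg _),
    mul_one_div_cancel hp.ne', Real.rpow_one]

/-- Point evaluations are bounded on `A^p(Ω)`, uniformly over the points at distance at least `δ`
from the complement of `Ω`. -/
lemma exists_eval_bound (hΩo : IsOpen Ω) (hΩb : Bornology.IsBounded Ω) (hp : 1 ≤ p)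
    {δ : ℝ} (hδ : 0 < δ) : ∃ C : ℝ, 0 < C ∧ ∀ f ∈ pBergmanSpace Ω p, ∀ ζ,
      Metric.ball ζ δ ⊆ Ω → ‖f ζ‖ ≤ C * pBergmanNorm Ω p f := by
  have hp0 : 0 < p := by linarith
  set V := volume (Metric.ball (0 : Fin n → ℂ) δ) with hV
  have hV0 : V ≠ 0 := (Metric.measure_ball_pos _ _ hδ).ne'
  have hVt : V ≠ ⊤ := Metric.isBounded_ball.measure_lt_top.ne
  set W := volume Ω ^ (1 - 1 / p) with hW
  have hWt : W ≠ ⊤ := by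
    refine (ENNReal.rpow_lt_top_of_nonneg ?_ hΩb.measure_lt_top.ne).ne
    rw [sub_nonneg, div_le_one hp0]
    exact hp
  refine ⟨W.toReal / V.toReal + 1, by positivity, fun f hf ζ hζ => ?_⟩
  have hf' := (mem_pBergmanSpace_iff hΩo hp0).1 hf
  have h1 := enorm_mul_volume_le_lintegral (hf'.1.mono hζ)
  have h2 : ∫⁻ η in Metric.ball ζ δ, ‖f η‖ₑ ≤ ENNReal.ofReal (pBergmanNorm Ω p f) * W := by
    calc ∫⁻ η in Metric.ball ζ δ, ‖f η‖ₑ ≤ ∫⁻ η in Ω, ‖f η‖ₑ := lintegral_mono_set hζ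
      _ = eLpNorm f 1 (volume.restrict Ω) := (eLpNorm_one_eq_lintegral_enorm).symm
      _ ≤ eLpNorm f (ENNReal.ofReal p) (volume.restrict Ω) * W := by
        have := eLpNorm_le_eLpNorm_mul_rpow_measure_univ (p := 1) (q := ENNReal.ofReal p)
          (by simpa using hp) hf'.2.1
        simpa [ENNReal.toReal_ofReal hp0.le, hW] using this
      _ = _ := by rw [eLpNorm_eq_ofReal_pBergmanNorm hΩo hp0 hf]
  have h3 := ENNReal.toReal_mono (ENNReal.mul_ne_top ENNReal.ofReal_ne_top hWt) (h1.trans h2)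
  rw [ENNReal.toReal_mul, ENNReal.toReal_mul, ENNReal.toReal_ofReal (pBergmanNorm_nonneg f),
    toReal_enorm] at h3
  have hVr : 0 < V.toReal := ENNReal.toReal_pos hV0 hVt
  have h4 : ‖f ζ‖ ≤ W.toReal / V.toReal * pBergmanNorm Ω p f := by
    rw [div_mul_eq_mul_div, le_div_iff₀ hVr]
    linarith
  nlinarith [pBergmanNorm_nonneg (Ω := Ω) (p := p) f]

/-- Cauchy's estimate in several variables. -/
lemma norm_fderiv_le_of_bound {f : (Fin n → ℂ) → ℂ} {ζ : Fin n → ℂ} {δ C : ℝ} (hδ : 0 < δ)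
    (hd : DifferentiableOn ℂ f (Metric.ball ζ δ)) (hC : ∀ x ∈ Metric.ball ζ δ, ‖f x‖ ≤ C) :
    ‖fderiv ℂ f ζ‖ ≤ 2 * C / δ := by
  refine Complex.norm_fderiv_le_div_of_mapsTo_ball hd (fun x hx => ?_) hδ
  rw [Metric.mem_closedBall, dist_eq_norm]
  linarith [norm_sub_le (f x) (f ζ), hC x hx, hC ζ (Metric.mem_ball_self hδ)]

lemma exists_fderiv_bound (hΩo : IsOpen Ω) (hΩb : Bornology.IsBounded Ω) (hp : 1 ≤ p)
    {δ : ℝ} (hδ : 0 < δ) : ∃ C : ℝ, 0 < C ∧ ∀ f ∈ pBergmanSpace Ω p, ∀ ζ,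
      Metric.ball ζ δ ⊆ Ω → ‖fderiv ℂ f ζ‖ ≤ C * pBergmanNorm Ω p f := by
  obtain ⟨C, hC, h⟩ := exists_eval_bound hΩo hΩb hp (half_pos hδ)
  refine ⟨2 * C / (δ / 2), by positivity, fun f hf ζ hζ => ?_⟩
  have hd : DifferentiableOn ℂ f (Metric.ball ζ (δ / 2)) :=
    hf.1.mono ((Metric.ball_subset_ball (by linarith)).trans hζ)
  have := norm_fderiv_le_of_bound (half_pos hδ) hd (C := C * pBergmanNorm Ω p f) fun x hx =>
    h f hf x (Set.Subset.trans (Metric.ball_subset_ball' (by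
      rw [Metric.mem_ball] at hx; linarith)) hζ)
  refine this.trans (le_of_eq ?_)
  ring

lemma pBergman_differentiableAt (hΩo : IsOpen Ω) {f : (Fin n → ℂ) → ℂ}
    (hf : f ∈ pBergmanSpace Ω p) {ζ : Fin n → ℂ} (hζ : ζ ∈ Ω) : DifferentiableAt ℂ f ζ :=
  hf.1.differentiableAt (hΩo.mem_nhds hζ)

/-- Completeness of `A^p(Ω)`, with the lower semicontinuity of the norm and the convergence of
values and first derivatives. -/
lemma pBergman_complete (hΩo : IsOpen Ω) (hΩb : Bornology.IsBounded Ω) (hp : 1 ≤ p)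
    (F : ℕ → (Fin n → ℂ) → ℂ) (hF : ∀ j, F j ∈ pBergmanSpace Ω p)
    (hc : ∀ ε > 0, ∃ N, ∀ i ≥ N, ∀ j ≥ N, pBergmanNorm Ω p (F i - F j) < ε)
    {c : ℝ} (hb : Tendsto (fun j => pBergmanNorm Ω p (F j)) atTop (𝓝 c)) :
    ∃ f ∈ pBergmanSpace Ω p, pBergmanNorm Ω p f ≤ c ∧ ∀ ζ ∈ Ω,
      Tendsto (fun j => F j ζ) atTop (𝓝 (f ζ)) ∧
      Tendsto (fun j => fderiv ℂ (F j) ζ) atTop (𝓝 (fderiv ℂ f ζ)) := by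
  have hp0 : 0 < p := by linarith
  have hval : ∀ ζ ∈ Ω, CauchySeq (fun j => F j ζ) := by
    intro ζ hζ
    obtain ⟨δ, hδ, hball⟩ := Metric.isOpen_iff.1 hΩo ζ hζ
    obtain ⟨C, hC, hev⟩ := exists_eval_bound hΩo hΩb hp hδ
    rw [Metric.cauchySeq_iff]
    intro ε hε
    obtain ⟨N, hN⟩ := hc (ε / C) (by positivity)
    refine ⟨N, fun i hi j hj => ?_⟩
    rw [dist_eq_norm]
    have := hev _ (pBergman_sub hΩo hp0 (hF i) (hF j)) ζ hball
    rw [Pi.sub_apply] at this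
    have h2 := hN i hi j hj
    rw [lt_div_iff₀ hC] at h2
    linarith
  have hlim : ∀ ζ ∈ Ω, ∃ a, Tendsto (fun j => F j ζ) atTop (𝓝 a) :=
    fun ζ hζ => cauchySeq_tendsto_of_complete (hval ζ hζ)
  choose! f hf using hlim
  have hderiv : ∀ ζ ∈ Ω, ∃ L, HasFDerivAt f L ζ ∧
      Tendsto (fun j => fderiv ℂ (F j) ζ) atTop (𝓝 L) := by
    intro ζ hζ
    obtain ⟨δ, hδ, hball⟩ := Metric.isOpen_iff.1 hΩo ζ hζ
    obtain ⟨C, hC, hev⟩ := exists_fderiv_bound hΩo hΩb hp (half_pos hδ)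
    set s := Metric.ball ζ (δ / 2) with hs
    have hsub : ∀ x ∈ s, Metric.ball x (δ / 2) ⊆ Ω := fun x hx =>
      (Metric.ball_subset_ball' (by rw [hs, Metric.mem_ball] at hx; linarith)).trans hball
    have hsΩ : s ⊆ Ω := (Metric.ball_subset_ball (by linarith)).trans hball
    have hcs : UniformCauchySeqOn (fun j x => fderiv ℂ (F j) x) atTop s := by
      rw [Metric.uniformCauchySeqOn_iff]
      intro ε hε
      obtain ⟨N, hN⟩ := hc (ε / C) (by positivity)
      refine ⟨N, fun i hi j hj x hx => ?_⟩
      rw [dist_eq_norm]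
      have := hev _ (pBergman_sub hΩo hp0 (hF i) (hF j)) x (hsub x hx)
      rw [fderiv_sub (pBergman_differentiableAt hΩo (hF i) (hsΩ hx))
        (pBergman_differentiableAt hΩo (hF j) (hsΩ hx))] at this
      have h2 := hN i hi j hj
      rw [lt_div_iff₀ hC] at h2
      linarith
    have hl : ∀ x ∈ s, ∃ L, Tendsto (fun j => fderiv ℂ (F j) x) atTop (𝓝 L) :=
      fun x hx => cauchySeq_tendsto_of_complete (hcs.cauchySeq hx)
    choose! g' hg' using hl
    have hu := hcs.tendstoUniformlyOn_of_tendsto hg'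
    have hζs : ζ ∈ s := Metric.mem_ball_self (half_pos hδ)
    refine ⟨g' ζ, ?_, hg' ζ hζs⟩
    exact hasFDerivAt_of_tendstoUniformlyOn Metric.isOpen_ball hu
      (fun j x hx => (pBergman_differentiableAt hΩo (hF j) (hsΩ hx)).hasFDerivAt)
      (fun x hx => hf x (hsΩ hx)) hζs
  have hfd : DifferentiableOn ℂ f Ω := fun ζ hζ => by
    obtain ⟨L, hL, -⟩ := hderiv ζ hζ
    exact hL.differentiableAt.differentiableWithinAt
  have hle : eLpNorm f (ENNReal.ofReal p) (volume.restrict Ω) ≤ ENNReal.ofReal c := by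
    have h1 := Lp.eLpNorm_lim_le_liminf_eLpNorm (p := ENNReal.ofReal p) (μ := volume.restrict Ω)
      (fun j => ((mem_pBergmanSpace_iff hΩo hp0).1 (hF j)).2.1) f
      ((ae_restrict_iff' hΩo.measurableSet).2 (Eventually.of_forall hf))
    refine h1.trans (le_of_eq ?_)
    simp_rw [eLpNorm_eq_ofReal_pBergmanNorm hΩo hp0 (hF _)]
    exact (ENNReal.tendsto_ofReal hb).liminf_eq
  have hmem : f ∈ pBergmanSpace Ω p := (mem_pBergmanSpace_iff hΩo hp0).2 ⟨hfd,
    hfd.continuousOn.aestronglyMeasurable hΩo.measurableSet, hle.trans_lt ENNReal.ofReal_lt_top⟩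
  refine ⟨f, hmem, ?_, fun ζ hζ => ⟨hf ζ hζ, ?_⟩⟩
  · rw [eLpNorm_eq_ofReal_pBergmanNorm hΩo hp0 hmem] at hle
    have hc0 : 0 ≤ c := ge_of_tendsto' hb fun j => pBergmanNorm_nonneg _
    exact (ENNReal.ofReal_le_ofReal_iff hc0).1 hle
  · obtain ⟨L, hL, hL2⟩ := hderiv ζ hζ
    rwa [hL.fderiv]

/-- Clarkson's inequality for `p ≥ 2`. -/
lemma clarkson (hp : 2 ≤ p) (a b : ℂ) :
    ‖(a + b) / 2‖ ^ p + ‖(a - b) / 2‖ ^ p ≤ (‖a‖ ^ p + ‖b‖ ^ p) / 2 := by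
  have hsq : ∀ x : ℂ, ‖x‖ ^ p = (‖x‖ ^ 2) ^ (p / 2) := fun x => by
    rw [← Real.rpow_natCast, ← Real.rpow_mul (norm_nonneg _)]
    congr 1
    push_cast
    ring
  have hq : 1 ≤ p / 2 := by linarith
  have hpar : ‖(a + b) / 2‖ ^ 2 + ‖(a - b) / 2‖ ^ 2 = 2⁻¹ * ‖a‖ ^ 2 + 2⁻¹ * ‖b‖ ^ 2 := by
    have := parallelogram_law_with_norm ℝ a b
    simp only [norm_div, Complex.norm_ofNat]
    nlinarith
  rw [hsq, hsq, hsq a, hsq b]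
  calc _ ≤ (‖(a + b) / 2‖ ^ 2 + ‖(a - b) / 2‖ ^ 2) ^ (p / 2) :=
        Real.add_rpow_le_rpow_add (by positivity) (by positivity) hq
    _ = (2⁻¹ * ‖a‖ ^ 2 + 2⁻¹ * ‖b‖ ^ 2) ^ (p / 2) := by rw [hpar]
    _ ≤ 2⁻¹ * (‖a‖ ^ 2) ^ (p / 2) + 2⁻¹ * (‖b‖ ^ 2) ^ (p / 2) :=
        (convexOn_rpow hq).2 (Set.mem_Ici.2 (sq_nonneg ‖a‖)) (Set.mem_Ici.2 (sq_nonneg ‖b‖))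
          (by norm_num) (by norm_num) (by norm_num)
    _ = _ := by ring

/-- A nonempty midpoint-convex subset of `A^p(Ω)`, `p ≥ 2`, that is closed under convergence of
values and first derivatives has an element of least norm: by Clarkson's inequality every
minimizing sequence is a Cauchy sequence. -/
lemma exists_pBergmanNorm_min (hΩo : IsOpen Ω) (hΩb : Bornology.IsBounded Ω) (hp : 2 ≤ p)
    (S : Set ((Fin n → ℂ) → ℂ)) (hS : S ⊆ pBergmanSpace Ω p) (hne : S.Nonempty)
    (hmid : ∀ f ∈ S, ∀ g ∈ S, (2⁻¹ : ℂ) • (f + g) ∈ S)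
    (hcl : ∀ (F : ℕ → (Fin n → ℂ) → ℂ), (∀ j, F j ∈ S) → ∀ f ∈ pBergmanSpace Ω p,
      (∀ ζ ∈ Ω, Tendsto (fun j => F j ζ) atTop (𝓝 (f ζ)) ∧
        Tendsto (fun j => fderiv ℂ (F j) ζ) atTop (𝓝 (fderiv ℂ f ζ))) → f ∈ S) :
    ∃ f ∈ S, ∀ g ∈ S, pBergmanNorm Ω p f ≤ pBergmanNorm Ω p g := by
  have hp0 : 0 < p := by linarith
  set N : ((Fin n → ℂ) → ℂ) → ℝ := pBergmanNorm Ω p with hN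
  set d := sInf (N '' S) with hd
  have hbdd : BddBelow (N '' S) := ⟨0, by rintro _ ⟨f, -, rfl⟩; exact pBergmanNorm_nonneg f⟩
  have hdle : ∀ f ∈ S, d ≤ N f := fun f hf => csInf_le hbdd ⟨f, hf, rfl⟩
  have hd0 : 0 ≤ d := le_csInf (hne.image _) (by
    rintro _ ⟨f, -, rfl⟩; exact pBergmanNorm_nonneg f)
  obtain ⟨u, -, hu, huS⟩ := exists_seq_tendsto_sInf (hne.image N) hbdd
  choose F hFS hFu using huS
  have hFd : Tendsto (fun j => N (F j)) atTop (𝓝 d) := by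
    simp_rw [hFu]; exact hu
  have hint : ∀ f ∈ pBergmanSpace Ω p, IntegrableOn (fun ζ => ‖f ζ‖ ^ p) Ω := fun f hf => hf.2
  have hclark : ∀ f ∈ S, ∀ g ∈ S,
      N ((2⁻¹ : ℂ) • (f - g)) ^ p ≤ (N f ^ p + N g ^ p) / 2 - d ^ p := by
    intro f hf g hg
    have h1 := hmid f hf g hg
    have h2 : d ^ p ≤ N ((2⁻¹ : ℂ) • (f + g)) ^ p := Real.rpow_le_rpow hd0 (hdle _ h1) hp0.le
    have h3 : N ((2⁻¹ : ℂ) • (f + g)) ^ p + N ((2⁻¹ : ℂ) • (f - g)) ^ p ≤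
        (N f ^ p + N g ^ p) / 2 := by
      have hs := pBergman_smul hΩo hp0 (2⁻¹ : ℂ) (pBergman_sub hΩo hp0 (hS hf) (hS hg))
      simp only [hN, pBergmanNorm_rpow hp0]
      rw [← integral_add (hint _ (hS h1)) (hint _ hs),
        ← integral_add (hint _ (hS hf)) (hint _ (hS hg)), ← integral_div]
      refine integral_mono ((hint _ (hS h1)).add (hint _ hs))
        (((hint _ (hS hf)).add (hint _ (hS hg))).div_const 2) fun ζ => ?_
      have := clarkson hp (f ζ) (g ζ)
      simpa [div_eq_inv_mul] using this
    linarith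
  have hpow : Tendsto (fun j => N (F j) ^ p) atTop (𝓝 (d ^ p)) :=
    hFd.rpow_const (Or.inr hp0.le)
  have hcauchy : ∀ ε > 0, ∃ M, ∀ i ≥ M, ∀ j ≥ M, N (F i - F j) < ε := by
    intro ε hε
    have hη : 0 < (ε / 2) ^ p := by positivity
    obtain ⟨M, hM⟩ := (hpow.eventually_lt_const (lt_add_of_pos_right (d ^ p) hη)).exists_forall_of_atTop
    refine ⟨M, fun i hi j hj => ?_⟩
    have h1 := hclark _ (hFS i) _ (hFS j)
    have h2 : N ((2⁻¹ : ℂ) • (F i - F j)) ^ p < (ε / 2) ^ p := by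
      linarith [hM i hi, hM j hj]
    have h3 := (Real.rpow_lt_rpow_iff (pBergmanNorm_nonneg _) (by positivity) hp0).1 h2
    simp only [hN] at h3 ⊢
    rw [pBergmanNorm_smul hp0] at h3
    norm_num at h3
    linarith
  obtain ⟨f, hf, hfn, hfl⟩ := pBergman_complete hΩo hΩb (by linarith) F (fun j => hS (hFS j))
    hcauchy hFd
  exact ⟨f, hcl F hFS f hf hfl, fun g hg => hfn.trans (hdle g hg)⟩

end Basic

/-! ### Second-order expansion of `‖1 + w‖ ^ s` -/

/-- The remainder of `‖1 + w‖ ^ s` after its first-order (real) Taylor polynomial at `w = 0`. -/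
def powRem (s : ℝ) (w : ℂ) : ℝ := ‖1 + w‖ ^ s - 1 - s * w.re

/-- The second-order term of `‖1 + w‖ ^ s` at `w = 0`. -/
def powQuad (s : ℝ) (w : ℂ) : ℝ := s / 2 * ‖w‖ ^ 2 + s * (s - 2) / 2 * w.re ^ 2

lemma rpow_one_add_isLittleO (q : ℝ) :
    (fun e : ℝ => (1 + e) ^ q - 1 - q * e - q * (q - 1) / 2 * e ^ 2) =o[𝓝 0]
      (fun e : ℝ => e ^ 2) := by
  have hpos : ∀ e : ℝ, |e| < 1 → 1 + e ≠ 0 := fun e he => by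
    have := (abs_lt.1 he).1
    linarith
  have hd1 : (fun e : ℝ => q * ((1 + e) ^ (q - 1) - 1 - (q - 1) * e)) =o[𝓝 0]
      (fun e : ℝ => e) := by
    apply Asymptotics.IsLittleO.const_mul_left
    have h : HasDerivAt (fun e : ℝ => (1 + e) ^ (q - 1)) (q - 1) 0 := by
      have := ((hasDerivAt_id (0 : ℝ)).const_add 1).rpow_const (p := q - 1) (Or.inl (by simp))
      simpa using this
    have := h.isLittleO
    simpa [mul_comm] using this
  rw [Asymptotics.isLittleO_iff] at hd1 ⊢
  intro c hc
  obtain ⟨δ, hδ, hb⟩ := Metric.eventually_nhds_iff.1 (hd1 hc)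
  refine Metric.eventually_nhds_iff.2 ⟨min δ 1, by positivity, fun {e} he => ?_⟩
  rw [dist_zero_right, Real.norm_eq_abs, lt_min_iff] at he
  have hderiv : ∀ y ∈ Metric.closedBall (0 : ℝ) |e|,
      HasDerivWithinAt (fun e : ℝ => (1 + e) ^ q - 1 - q * e - q * (q - 1) / 2 * e ^ 2)
        (q * ((1 + y) ^ (q - 1) - 1 - (q - 1) * y)) (Metric.closedBall (0 : ℝ) |e|) y := by
    intro y hy
    have hy1 : |y| ≤ |e| := by simpa using hy
    have h1 := ((hasDerivAt_id y).const_add 1).rpow_const (p := q)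
      (Or.inl (hpos y (hy1.trans_lt he.2)))
    have h2 := ((h1.sub_const 1).sub ((hasDerivAt_id y).const_mul q)).sub
      (((hasDerivAt_id y).pow 2).const_mul (q * (q - 1) / 2))
    refine HasDerivAt.hasDerivWithinAt (h2.congr_deriv ?_)
    simp
    ring
  have hbound : ∀ y ∈ Metric.closedBall (0 : ℝ) |e|,
      ‖q * ((1 + y) ^ (q - 1) - 1 - (q - 1) * y)‖ ≤ c * |e| := by
    intro y hy
    have hy1 : |y| ≤ |e| := by simpa using hy
    refine (hb (by rw [dist_zero_right]; exact hy1.trans_lt he.1)).trans ?_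
    rw [Real.norm_eq_abs]
    gcongr
  have := (convex_closedBall (0 : ℝ) |e|).norm_image_sub_le_of_norm_hasDerivWithin_le hderiv hbound
    (Metric.mem_closedBall_self (abs_nonneg e)) (show e ∈ _ by simp)
  simp only [add_zero, Real.one_rpow, sub_self, mul_zero, ne_eq, OfNat.ofNat_ne_zero,
    not_false_eq_true, zero_pow, sub_zero] at this
  refine this.trans (le_of_eq ?_)
  rw [Real.norm_eq_abs, norm_pow, Real.norm_eq_abs]
  ring

lemma normSq_one_add (w : ℂ) : ‖1 + w‖ ^ 2 = 1 + (2 * w.re + ‖w‖ ^ 2) := by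
  rw [← Complex.normSq_eq_norm_sq, ← Complex.normSq_eq_norm_sq, Complex.normSq_apply,
    Complex.normSq_apply]
  simp
  ring

lemma norm_rpow_eq_sq_rpow (s : ℝ) (w : ℂ) : ‖w‖ ^ s = (‖w‖ ^ 2) ^ (s / 2) := by
  rw [← Real.rpow_natCast, ← Real.rpow_mul (norm_nonneg _)]
  congr 1
  push_cast
  ring

lemma powRem_sub_powQuad_isLittleO (s : ℝ) :
    (fun w : ℂ => powRem s w - powQuad s w) =o[𝓝 0] (fun w : ℂ => ‖w‖ ^ 2) := by
  set e : ℂ → ℝ := fun w => 2 * w.re + ‖w‖ ^ 2 with he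
  have hcont : Tendsto e (𝓝 0) (𝓝 0) := by
    have : Continuous e := by fun_prop
    simpa [he] using this.tendsto 0
  have hO : e =O[𝓝 0] (fun w : ℂ => ‖w‖) := by
    refine Asymptotics.IsBigO.of_bound 3 ?_
    filter_upwards [Metric.ball_mem_nhds (0 : ℂ) one_pos] with w hw
    have h1 : ‖w‖ < 1 := by simpa using hw
    have h2 := Complex.abs_re_le_norm w
    rw [Real.norm_eq_abs, norm_norm]
    calc |e w| ≤ |2 * w.re| + |‖w‖ ^ 2| := abs_add_le _ _
      _ = 2 * |w.re| + ‖w‖ ^ 2 := by rw [abs_mul, abs_of_pos two_pos, abs_of_nonneg (sq_nonneg ‖w‖)]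
      _ ≤ _ := by nlinarith [norm_nonneg w]
  have h1 : (fun w : ℂ => (1 + e w) ^ (s / 2) - 1 - s / 2 * e w
      - s / 2 * (s / 2 - 1) / 2 * e w ^ 2) =o[𝓝 0] (fun w : ℂ => ‖w‖ ^ 2) :=
    ((rpow_one_add_isLittleO (s / 2)).comp_tendsto hcont).trans_isBigO (hO.pow 2)
  have h2 : (fun w : ℂ => s / 2 * (s / 2 - 1) / 2 * (4 * w.re * ‖w‖ ^ 2 + ‖w‖ ^ 4)) =o[𝓝 0]
      (fun w : ℂ => ‖w‖ ^ 2) := by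
    apply Asymptotics.IsLittleO.const_mul_left
    have h3 : (fun w : ℂ => (4 * w.re + ‖w‖ ^ 2) * ‖w‖ ^ 2) =o[𝓝 0]
        (fun w : ℂ => 1 * ‖w‖ ^ 2) := by
      refine Asymptotics.IsLittleO.mul_isBigO ?_ (Asymptotics.isBigO_refl _ _)
      rw [Asymptotics.isLittleO_one_iff]
      have : Continuous (fun w : ℂ => 4 * w.re + ‖w‖ ^ 2) := by fun_prop
      simpa using this.tendsto 0
    refine (h3.congr_left fun w => ?_).congr_right fun w => one_mul _
    ring
  refine (h1.add h2).congr_left fun w => ?_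
  simp only [powRem, powQuad, he]
  rw [norm_rpow_eq_sq_rpow s (1 + w), normSq_one_add]
  ring

lemma powRem_zero (s : ℝ) : powRem s 0 = 0 := by simp [powRem]

lemma continuous_powRem {s : ℝ} (hs : 0 ≤ s) : Continuous (powRem s) := by
  unfold powRem
  have : Continuous fun w : ℂ => ‖1 + w‖ ^ s :=
    (by fun_prop : Continuous fun w : ℂ => ‖1 + w‖).rpow_const fun _ => Or.inr hs
  fun_prop

lemma continuous_powQuad (s : ℝ) : Continuous (powQuad s) := by
  unfold powQuad
  fun_prop

lemma abs_powQuad_le (s : ℝ) (w : ℂ) :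
    |powQuad s w| ≤ (|s / 2| + |s * (s - 2) / 2|) * ‖w‖ ^ 2 := by
  unfold powQuad
  have h : w.re ^ 2 ≤ ‖w‖ ^ 2 := by
    rw [← sq_abs]
    have := Complex.abs_re_le_norm w
    gcongr
  calc _ ≤ |s / 2 * ‖w‖ ^ 2| + |s * (s - 2) / 2 * w.re ^ 2| := abs_add_le _ _
    _ = |s / 2| * ‖w‖ ^ 2 + |s * (s - 2) / 2| * w.re ^ 2 := by
      rw [abs_mul, abs_mul, abs_of_nonneg (sq_nonneg ‖w‖), abs_of_nonneg (sq_nonneg w.re)]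
    _ ≤ |s / 2| * ‖w‖ ^ 2 + |s * (s - 2) / 2| * ‖w‖ ^ 2 := by gcongr
    _ = _ := by ring

/-- A global bound for the remainder: quadratic near `0`, of order `s` (or `2`, if larger) at infinity. -/
lemma exists_powRem_bound {s : ℝ} (hs : 1 ≤ s) :
    ∃ C : ℝ, 0 < C ∧ ∀ w : ℂ, |powRem s w| ≤ C * (‖w‖ ^ 2 + ‖w‖ ^ max s 2) := by
  obtain ⟨δ, hδ, hb⟩ := Metric.eventually_nhds_iff.1
    ((powRem_sub_powQuad_isLittleO s).def one_pos)
  set A := |s / 2| + |s * (s - 2) / 2| + 1 with hA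
  have hApos : 0 < A := by positivity
  set m := max s 2 with hm
  -- off the ball of radius `δ` every term is bounded by a multiple of `‖w‖ ^ max s 2`
  set D := (1 + δ⁻¹) ^ s * δ ^ (s - m) + δ ^ (-m) + s * δ ^ (1 - m) with hD
  have hDpos : 0 < D := by positivity
  refine ⟨A + D, by positivity, fun w => ?_⟩
  have hwm : 0 ≤ ‖w‖ ^ m := Real.rpow_nonneg (norm_nonneg _) _
  rcases lt_or_ge ‖w‖ δ with hw | hw
  · have h1 := hb (show dist w 0 < δ by simpa using hw)
    rw [Real.norm_eq_abs, one_mul, norm_pow, norm_norm] at h1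
    have h2 := abs_powQuad_le s w
    have h3 : |powRem s w| ≤ |powRem s w - powQuad s w| + |powQuad s w| := by
      have := abs_add_le (powRem s w - powQuad s w) (powQuad s w)
      simpa using this
    have h4 : |powRem s w| ≤ A * ‖w‖ ^ 2 := by rw [hA]; linarith
    nlinarith [sq_nonneg ‖w‖, mul_nonneg hApos.le hwm, mul_nonneg hDpos.le hwm,
      mul_nonneg hDpos.le (sq_nonneg ‖w‖)]
  · have hw0 : 0 < ‖w‖ := hδ.trans_le hw
    have hpow : ∀ a ≤ m, ‖w‖ ^ a ≤ δ ^ (a - m) * ‖w‖ ^ m := by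
      intro a ha
      have h1 : ‖w‖ ^ (a - m) ≤ δ ^ (a - m) :=
        Real.rpow_le_rpow_of_nonpos hδ hw (by linarith)
      calc ‖w‖ ^ a = ‖w‖ ^ (a - m) * ‖w‖ ^ m := by rw [← Real.rpow_add hw0]; ring_nf
        _ ≤ _ := by gcongr
    have hs' : s ≤ m := le_max_left _ _
    have h1m : 1 ≤ m := hs.trans hs'
    have e1 : ‖1 + w‖ ^ s ≤ (1 + δ⁻¹) ^ s * (δ ^ (s - m) * ‖w‖ ^ m) := by
      have : ‖1 + w‖ ≤ (1 + δ⁻¹) * ‖w‖ := by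
        have h1 : 1 ≤ δ⁻¹ * ‖w‖ := by rw [inv_mul_eq_div, le_div_iff₀ hδ]; linarith
        have h2 := norm_add_le (1 : ℂ) w
        rw [norm_one] at h2
        linarith
      calc ‖1 + w‖ ^ s ≤ ((1 + δ⁻¹) * ‖w‖) ^ s := by gcongr
        _ = (1 + δ⁻¹) ^ s * ‖w‖ ^ s := Real.mul_rpow (by positivity) hw0.le
        _ ≤ _ := by gcongr; exact hpow s hs'
    have e2 : 1 ≤ δ ^ (-m) * ‖w‖ ^ m := by
      have := hpow 0 (by linarith)
      simpa using this
    have e3 : s * |w.re| ≤ s * (δ ^ (1 - m) * ‖w‖ ^ m) := by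
      have := hpow 1 h1m
      rw [Real.rpow_one] at this
      have := (Complex.abs_re_le_norm w).trans this
      gcongr
    have h5 : |powRem s w| ≤ ‖1 + w‖ ^ s + 1 + s * |w.re| := by
      unfold powRem
      have h0 : 0 ≤ ‖1 + w‖ ^ s := Real.rpow_nonneg (norm_nonneg _) _
      have hs0 : 0 ≤ s := by linarith
      have := neg_abs_le w.re
      have := le_abs_self w.re
      rw [abs_le]
      constructor <;> nlinarith
    have h6 : |powRem s w| ≤ D * ‖w‖ ^ m := by rw [hD]; linarith
    nlinarith [sq_nonneg ‖w‖, mul_nonneg hApos.le hwm, mul_nonneg hApos.le (sq_nonneg ‖w‖),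
      mul_nonneg hDpos.le (sq_nonneg ‖w‖)]

/-- Convexity of the remainder, in the form used to split off a perturbation of higher order. -/
lemma powRem_add_le {s : ℝ} (hs : 1 ≤ s) {r : ℝ} (hr0 : 0 < r) (hr1 : r < 1) (x y : ℂ) :
    powRem s (x + y) ≤
      (1 - r) * powRem s (((1 - r)⁻¹ : ℝ) * x) + r * powRem s ((r⁻¹ : ℝ) * y) := by
  have h1r : 0 < 1 - r := by linarith
  have h1c : (1 - (r : ℂ)) ≠ 0 := by exact_mod_cast h1r.ne'
  have hrc : (r : ℂ) ≠ 0 := by exact_mod_cast hr0.ne'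
  have htri : ‖1 + (x + y)‖ ≤ (1 - r) * ‖1 + ((1 - r)⁻¹ : ℝ) * x‖ + r * ‖1 + (r⁻¹ : ℝ) * y‖ := by
    have : 1 + (x + y) = ((1 - r : ℝ) : ℂ) * (1 + ((1 - r)⁻¹ : ℝ) * x)
        + (r : ℂ) * (1 + (r⁻¹ : ℝ) * y) := by
      push_cast
      field_simp
      ring
    rw [this]
    refine (norm_add_le _ _).trans (le_of_eq ?_)
    rw [norm_mul, norm_mul, Complex.norm_of_nonneg h1r.le, Complex.norm_of_nonneg hr0.le]
  have hconv : ‖1 + (x + y)‖ ^ s ≤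
      (1 - r) * ‖1 + ((1 - r)⁻¹ : ℝ) * x‖ ^ s + r * ‖1 + (r⁻¹ : ℝ) * y‖ ^ s := by
    refine (Real.rpow_le_rpow (norm_nonneg _) htri (by linarith)).trans ?_
    exact (convexOn_rpow hs).2 (Set.mem_Ici.2 (norm_nonneg _)) (Set.mem_Ici.2 (norm_nonneg _))
      h1r.le hr0.le (by ring)
  unfold powRem
  have e1 : (1 - r) * (s * (((1 - r)⁻¹ : ℝ) * x : ℂ).re) = s * x.re := by
    rw [Complex.re_ofReal_mul]; field_simp
  have e2 : r * (s * ((r⁻¹ : ℝ) * y : ℂ).re) = s * y.re := by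
    rw [Complex.re_ofReal_mul]; field_simp
  rw [Complex.add_re]
  linarith

section Integral

variable {α : Type*} [MeasurableSpace α] {π : Measure α}

lemma memLp_two_of_max [IsFiniteMeasure π] {s : ℝ} {x : α → ℂ}
    (hx : MemLp x (ENNReal.ofReal (max s 2)) π) : MemLp x 2 π :=
  hx.mono_exponent (by
    rw [show (2 : ENNReal) = ENNReal.ofReal 2 by simp]
    exact ENNReal.ofReal_le_ofReal (le_max_right _ _))

lemma integrable_norm_rpow_max {s : ℝ} {x : α → ℂ}
    (hx : MemLp x (ENNReal.ofReal (max s 2)) π) : Integrable (fun a => ‖x a‖ ^ max s 2) π := by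
  have h0 : (0 : ℝ) < max s 2 := lt_of_lt_of_le two_pos (le_max_right _ _)
  have := hx.integrable_norm_rpow (by simp) ENNReal.ofReal_ne_top
  rwa [ENNReal.toReal_ofReal h0.le] at this

lemma integrable_norm_sq {x : α → ℂ} (hx : MemLp x 2 π) :
    Integrable (fun a => ‖x a‖ ^ 2) π := by
  have := hx.integrable_norm_rpow (by simp) (by simp)
  simpa using this

lemma integrable_powRem [IsFiniteMeasure π] {s : ℝ} (hs : 1 ≤ s) {x : α → ℂ}
    (hx : MemLp x (ENNReal.ofReal (max s 2)) π) : Integrable (fun a => powRem s (x a)) π := by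
  obtain ⟨C, hC, hb⟩ := exists_powRem_bound hs
  refine Integrable.mono' (((integrable_norm_sq (memLp_two_of_max hx)).add
    (integrable_norm_rpow_max hx)).const_mul C)
    ((continuous_powRem (by linarith)).comp_aestronglyMeasurable hx.1) ?_
  exact Eventually.of_forall fun a => hb (x a)

lemma integrable_powQuad (s : ℝ) {x : α → ℂ} (hx : MemLp x 2 π) :
    Integrable (fun a => powQuad s (x a)) π := by
  refine Integrable.mono' ((integrable_norm_sq hx).const_mul (|s / 2| + |s * (s - 2) / 2|))
    ((continuous_powQuad s).comp_aestronglyMeasurable hx.1) ?_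
  exact Eventually.of_forall fun a => abs_powQuad_le s (x a)

/-- The expansion of `w ↦ ∫ ‖1 + w x‖ ^ s` at `w = 0` to second order, by dominated convergence. -/
lemma integral_powRem_isLittleO [IsFiniteMeasure π] {s : ℝ} (hs : 1 ≤ s) {x : α → ℂ}
    (hx : MemLp x (ENNReal.ofReal (max s 2)) π) :
    (fun w : ℂ => (∫ a, powRem s (w * x a) ∂π) - ∫ a, powQuad s (w * x a) ∂π) =o[𝓝 0]
      (fun w : ℂ => ‖w‖ ^ 2) := by
  obtain ⟨C, hC, hb⟩ := exists_powRem_bound hs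
  set A := |s / 2| + |s * (s - 2) / 2| with hA
  have h2 := memLp_two_of_max hx
  have hwx : ∀ w : ℂ, MemLp (fun a => w * x a) (ENNReal.ofReal (max s 2)) π :=
    fun w => hx.const_mul w
  have hsub : ∀ w : ℂ, (∫ a, powRem s (w * x a) ∂π) - ∫ a, powQuad s (w * x a) ∂π =
      ∫ a, (powRem s (w * x a) - powQuad s (w * x a)) ∂π := fun w =>
    (integral_sub (integrable_powRem hs (hwx w)) (integrable_powQuad s (h2.const_mul w))).symm
  simp_rw [hsub]
  refine (Asymptotics.isLittleO_iff_tendsto' (Eventually.of_forall fun w hw => ?_)).2 ?_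
  · have : w = 0 := by simpa using hw
    subst this
    simp [powRem, powQuad]
  simp_rw [← integral_div]
  have hlim : Tendsto (fun w : ℂ => ∫ a, (powRem s (w * x a) - powQuad s (w * x a)) / ‖w‖ ^ 2 ∂π)
      (𝓝 0) (𝓝 (∫ _a, (0 : ℝ) ∂π)) := by
    refine tendsto_integral_filter_of_dominated_convergence
      (fun a => C * (‖x a‖ ^ 2 + ‖x a‖ ^ max s 2) + A * ‖x a‖ ^ 2) ?_ ?_ ?_ ?_
    · refine Eventually.of_forall fun w => ?_
      exact (((integrable_powRem hs (hwx w)).sub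
        (integrable_powQuad s (h2.const_mul w))).div_const _).1
    · filter_upwards [Metric.ball_mem_nhds (0 : ℂ) one_pos] with w hw
      have hw1 : ‖w‖ ≤ 1 := by
        have : ‖w‖ < 1 := by simpa using hw
        exact this.le
      refine Eventually.of_forall fun a => ?_
      rcases eq_or_ne w 0 with rfl | hw0
      · simp
        positivity
      have hwp : 0 < ‖w‖ := norm_pos_iff.2 hw0
      rw [norm_div, norm_pow, norm_norm, div_le_iff₀ (by positivity), Real.norm_eq_abs]
      have e1 := hb (w * x a)
      have e2 := abs_powQuad_le s (w * x a)
      rw [norm_mul, mul_pow] at e1 e2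
      rw [Real.mul_rpow (norm_nonneg _) (norm_nonneg _)] at e1
      have e3 : ‖w‖ ^ max s 2 ≤ ‖w‖ ^ 2 := by
        rw [← Real.rpow_natCast ‖w‖ 2]
        exact Real.rpow_le_rpow_of_exponent_ge hwp hw1 (by simp)
      have e4 : 0 ≤ ‖x a‖ ^ max s 2 := Real.rpow_nonneg (norm_nonneg _) _
      calc |powRem s (w * x a) - powQuad s (w * x a)|
          ≤ |powRem s (w * x a)| + |powQuad s (w * x a)| := abs_sub _ _
        _ ≤ C * (‖w‖ ^ 2 * ‖x a‖ ^ 2 + ‖w‖ ^ max s 2 * ‖x a‖ ^ max s 2)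
            + A * (‖w‖ ^ 2 * ‖x a‖ ^ 2) := add_le_add e1 e2
        _ ≤ C * (‖w‖ ^ 2 * ‖x a‖ ^ 2 + ‖w‖ ^ 2 * ‖x a‖ ^ max s 2)
            + A * (‖w‖ ^ 2 * ‖x a‖ ^ 2) := by gcongr
        _ = _ := by ring
    · exact (((integrable_norm_sq h2).add (integrable_norm_rpow_max hx)).const_mul C).add
        ((integrable_norm_sq h2).const_mul A)
    · refine Eventually.of_forall fun a => ?_
      have ht : Tendsto (fun w : ℂ => w * x a) (𝓝 0) (𝓝 0) := by
        have : Continuous fun w : ℂ => w * x a := by fun_prop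
        simpa using this.tendsto 0
      have h1 := (powRem_sub_powQuad_isLittleO s).comp_tendsto ht
      have h3 : (fun w : ℂ => ‖w * x a‖ ^ 2) =O[𝓝 0] (fun w : ℂ => ‖w‖ ^ 2) := by
        refine Asymptotics.IsBigO.of_bound (‖x a‖ ^ 2) (Eventually.of_forall fun w => ?_)
        simp only [norm_mul, norm_pow, norm_norm]
        exact le_of_eq (by ring)
      exact (h1.trans_isBigO h3).tendsto_div_nhds_zero
  simpa using hlim

lemma integral_powRem_isBigO [IsFiniteMeasure π] {s : ℝ} (hs : 1 ≤ s) {x : α → ℂ}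
    (hx : MemLp x (ENNReal.ofReal (max s 2)) π) :
    (fun w : ℂ => ∫ a, powRem s (w * x a) ∂π) =O[𝓝 0] (fun w : ℂ => ‖w‖ ^ 2) := by
  have h2 := memLp_two_of_max hx
  have hq : (fun w : ℂ => ∫ a, powQuad s (w * x a) ∂π) =O[𝓝 0] (fun w : ℂ => ‖w‖ ^ 2) := by
    set A := |s / 2| + |s * (s - 2) / 2| with hA
    refine Asymptotics.IsBigO.of_bound (A * ∫ a, ‖x a‖ ^ 2 ∂π) (Eventually.of_forall fun w => ?_)
    rw [norm_pow, norm_norm]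
    calc ‖∫ a, powQuad s (w * x a) ∂π‖ ≤ ∫ a, A * ‖w * x a‖ ^ 2 ∂π :=
          norm_integral_le_of_norm_le ((integrable_norm_sq (h2.const_mul w)).const_mul A)
            (Eventually.of_forall fun a => abs_powQuad_le s (w * x a))
      _ = _ := by
        simp_rw [norm_mul, mul_pow]
        rw [integral_const_mul, integral_const_mul]
        ring
  have := (integral_powRem_isLittleO hs hx).isBigO.add hq
  simpa using this

lemma integral_norm_one_add_rpow [IsProbabilityMeasure π] {s : ℝ} (hs : 1 ≤ s) {x : α → ℂ}
    (hx : MemLp x (ENNReal.ofReal (max s 2)) π) :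
    ∫ a, ‖1 + x a‖ ^ s ∂π = 1 + s * (∫ a, x a ∂π).re + ∫ a, powRem s (x a) ∂π := by
  have hx1 : Integrable x π := (memLp_two_of_max hx).integrable (by norm_num)
  have hre : Integrable (fun a => (x a).re) π := hx1.re
  have h : ∀ a, ‖1 + x a‖ ^ s = (1 + s * (x a).re) + powRem s (x a) := fun a => by
    unfold powRem; ring
  simp_rw [h]
  have hI : Integrable (fun a => 1 + s * (x a).re) π := (integrable_const _).add (hre.const_mul s)
  rw [integral_add hI (integrable_powRem hs hx),
    integral_add (integrable_const _) (hre.const_mul s), integral_const_mul]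
  have := integral_re hx1
  simp only [RCLike.re_to_complex] at this
  rw [this]
  simp

end Integral

/-! ### The probability measure with density `|g|^p / ‖g‖_p^p` -/

section Weighted

variable {n : ℕ} {Ω : Set (Fin n → ℂ)} {p : ℝ} {g F : (Fin n → ℂ) → ℂ}

/-- The measure on `Ω` with density `|g|^p / ‖g‖_p^p`. Dividing by `g` identifies `L^p(Ω)` with the
`L^p` space of this measure and takes `g` to the constant function `1`. -/
def bergmanMeasure (Ω : Set (Fin n → ℂ)) (p : ℝ) (g : (Fin n → ℂ) → ℂ) : Measure (Fin n → ℂ) :=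
  (volume.restrict Ω).withDensity
    (fun ζ => ENNReal.ofReal (‖g ζ‖ ^ p / pBergmanNorm Ω p g ^ p))

lemma aemeasurable_bergman_density (hΩo : IsOpen Ω) (hg : g ∈ pBergmanSpace Ω p) :
    AEMeasurable (fun ζ => ENNReal.ofReal (‖g ζ‖ ^ p / pBergmanNorm Ω p g ^ p))
      (volume.restrict Ω) := by
  have : AEMeasurable g (volume.restrict Ω) :=
    (hg.1.continuousOn.aestronglyMeasurable hΩo.measurableSet).aemeasurable
  exact ((this.norm.pow_const p).div_const _).ennreal_ofReal

lemma integral_bergmanMeasure (hΩo : IsOpen Ω) (hg : g ∈ pBergmanSpace Ω p)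
    (h : (Fin n → ℂ) → ℝ) : ∫ ζ, h ζ ∂(bergmanMeasure Ω p g) =
      (∫ ζ in Ω, ‖g ζ‖ ^ p * h ζ) / pBergmanNorm Ω p g ^ p := by
  unfold bergmanMeasure
  rw [integral_withDensity_eq_integral_toReal_smul₀ (aemeasurable_bergman_density hΩo hg)
    (Eventually.of_forall fun _ => ENNReal.ofReal_lt_top), ← integral_div]
  refine integral_congr_ae (Eventually.of_forall fun ζ => ?_)
  have : 0 ≤ ‖g ζ‖ ^ p / pBergmanNorm Ω p g ^ p :=
    div_nonneg (Real.rpow_nonneg (norm_nonneg _) _) (Real.rpow_nonneg (pBergmanNorm_nonneg _) _)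
  simp only [ENNReal.toReal_ofReal this, smul_eq_mul]
  ring

lemma isProbabilityMeasure_bergmanMeasure (hp : 0 < p) (hg : g ∈ pBergmanSpace Ω p)
    (hN : 0 < pBergmanNorm Ω p g) : IsProbabilityMeasure (bergmanMeasure Ω p g) := by
  constructor
  unfold bergmanMeasure
  have hNp : 0 < pBergmanNorm Ω p g ^ p := Real.rpow_pos_of_pos hN _
  rw [withDensity_apply _ MeasurableSet.univ, Measure.restrict_univ,
    ← ofReal_integral_eq_lintegral_ofReal (hg.2.div_const _)
      (Eventually.of_forall fun ζ => div_nonneg (Real.rpow_nonneg (norm_nonneg _) _) hNp.le),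
    integral_div, ← pBergmanNorm_rpow hp, div_self hNp.ne', ENNReal.ofReal_one]

lemma aestronglyMeasurable_quot (hΩo : IsOpen Ω) (hg : g ∈ pBergmanSpace Ω p)
    (hF : F ∈ pBergmanSpace Ω p) :
    AEStronglyMeasurable (fun ζ => F ζ / g ζ) (volume.restrict Ω) :=
  ((hF.1.continuousOn.aestronglyMeasurable hΩo.measurableSet).aemeasurable.div
    (hg.1.continuousOn.aestronglyMeasurable hΩo.measurableSet).aemeasurable).aestronglyMeasurable

lemma ae_bergmanMeasure_ne_zero (hΩo : IsOpen Ω) (hp : 0 < p) (hg : g ∈ pBergmanSpace Ω p) :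
    ∀ᵐ ζ ∂(bergmanMeasure Ω p g), g ζ ≠ 0 := by
  unfold bergmanMeasure
  rw [ae_withDensity_iff' (aemeasurable_bergman_density hΩo hg)]
  refine Eventually.of_forall fun ζ hζ h0 => hζ ?_
  simp [h0, Real.zero_rpow hp.ne']

lemma norm_rpow_mul_quot {a b : ℂ} (hb : b ≠ 0) :
    ‖b‖ ^ p * ‖a / b‖ ^ p = ‖a‖ ^ p := by
  rw [← Real.mul_rpow (norm_nonneg _) (norm_nonneg _), ← norm_mul, mul_div_cancel₀ _ hb]

lemma memLp_quot (hΩo : IsOpen Ω) (hp : 2 ≤ p) (hg : g ∈ pBergmanSpace Ω p)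
    (hF : F ∈ pBergmanSpace Ω p) :
    MemLp (fun ζ => F ζ / g ζ) (ENNReal.ofReal (max p 2)) (bergmanMeasure Ω p g) := by
  have hp0 : 0 < p := by linarith
  rw [max_eq_left hp]
  have hmeas : AEStronglyMeasurable (fun ζ => F ζ / g ζ) (bergmanMeasure Ω p g) :=
    (aestronglyMeasurable_quot hΩo hg hF).mono_ac (withDensity_absolutelyContinuous _ _)
  rw [← integrable_norm_rpow_iff hmeas (by simpa using hp0) ENNReal.ofReal_ne_top,
    ENNReal.toReal_ofReal hp0.le]
  unfold bergmanMeasure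
  rw [integrable_withDensity_iff_integrable_smul₀' (aemeasurable_bergman_density hΩo hg)
    (Eventually.of_forall fun _ => ENNReal.ofReal_lt_top)]
  refine Integrable.mono' (hF.2.div_const (pBergmanNorm Ω p g ^ p)) ?_
    (Eventually.of_forall fun ζ => ?_)
  · refine ((aemeasurable_bergman_density hΩo hg).ennreal_toReal.aestronglyMeasurable).smul ?_
    exact ((aestronglyMeasurable_quot hΩo hg hF).aemeasurable.norm.pow_const
      p).aestronglyMeasurable
  · have hNp : 0 ≤ pBergmanNorm Ω p g ^ p := Real.rpow_nonneg (pBergmanNorm_nonneg _) _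
    have h0 : 0 ≤ ‖g ζ‖ ^ p / pBergmanNorm Ω p g ^ p :=
      div_nonneg (Real.rpow_nonneg (norm_nonneg _) _) hNp
    have h1 : 0 ≤ ‖F ζ / g ζ‖ ^ p := Real.rpow_nonneg (norm_nonneg _) _
    rw [ENNReal.toReal_ofReal h0, smul_eq_mul, Real.norm_of_nonneg (mul_nonneg h0 h1),
      div_mul_eq_mul_div]
    refine div_le_div_of_nonneg_right ?_ hNp
    rcases eq_or_ne (g ζ) 0 with h | h
    · simp only [h, norm_zero, Real.zero_rpow hp0.ne', zero_mul]
      exact Real.rpow_nonneg (norm_nonneg _) _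
    · rw [norm_rpow_mul_quot h]

lemma pBergmanNorm_rpow_eq_integral_quot (hΩo : IsOpen Ω) (hp : 0 < p)
    (hg : g ∈ pBergmanSpace Ω p) (hN : 0 < pBergmanNorm Ω p g)
    (hnull : ∀ᵐ ζ ∂(volume.restrict Ω), g ζ ≠ 0) (F : (Fin n → ℂ) → ℂ) :
    pBergmanNorm Ω p F ^ p =
      pBergmanNorm Ω p g ^ p * ∫ ζ, ‖F ζ / g ζ‖ ^ p ∂(bergmanMeasure Ω p g) := by
  have hNp : 0 < pBergmanNorm Ω p g ^ p := Real.rpow_pos_of_pos hN _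
  rw [integral_bergmanMeasure hΩo hg, mul_div_cancel₀ _ hNp.ne', pBergmanNorm_rpow hp]
  refine integral_congr_ae ?_
  filter_upwards [hnull] with ζ hζ
  exact (norm_rpow_mul_quot hζ).symm

/-- Expansion of `‖g + c F‖_p^p` in terms of the quotient `F / g`. -/
lemma pBergmanNorm_add_smul_rpow (hΩo : IsOpen Ω) (hp : 2 ≤ p)
    (hg : g ∈ pBergmanSpace Ω p) (hN : 0 < pBergmanNorm Ω p g)
    (hnull : ∀ᵐ ζ ∂(volume.restrict Ω), g ζ ≠ 0) (hF : F ∈ pBergmanSpace Ω p) (c : ℂ) :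
    pBergmanNorm Ω p (g + c • F) ^ p = pBergmanNorm Ω p g ^ p *
      (1 + p * (c * ∫ ζ, F ζ / g ζ ∂(bergmanMeasure Ω p g)).re
        + ∫ ζ, powRem p (c * (F ζ / g ζ)) ∂(bergmanMeasure Ω p g)) := by
  have hp0 : 0 < p := by linarith
  have := isProbabilityMeasure_bergmanMeasure hp0 hg hN
  rw [pBergmanNorm_rpow_eq_integral_quot hΩo hp0 hg hN hnull]
  congr 1
  have h := integral_norm_one_add_rpow (π := bergmanMeasure Ω p g) (s := p) (by linarith)
    ((memLp_quot hΩo hp hg hF).const_mul c)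
  rw [integral_const_mul] at h
  rw [← h]
  refine integral_congr_ae ?_
  filter_upwards [ae_bergmanMeasure_ne_zero hΩo hp0 hg] with ζ hζ
  congr 2
  simp only [Pi.add_apply, Pi.smul_apply, smul_eq_mul]
  field_simp

end Weighted

/-! ### The minimizer for `m_p` and its orthogonality relation -/

section Minimizer

variable {n : ℕ} {Ω : Set (Fin n → ℂ)} {p : ℝ} {z : Fin n → ℂ}

/-- `g` is a function of least norm among those of `A^p(Ω)` that take the value `1` at `z`. -/
structure IsMinimizer (Ω : Set (Fin n → ℂ)) (p : ℝ) (z : Fin n → ℂ) (g : (Fin n → ℂ) → ℂ) :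
    Prop where
  mem : g ∈ pBergmanSpace Ω p
  eq_one : g z = 1
  le : ∀ F ∈ pBergmanSpace Ω p, F z = 1 → pBergmanNorm Ω p g ≤ pBergmanNorm Ω p F

lemma pBergman_one_mem (hΩo : IsOpen Ω) (hΩb : Bornology.IsBounded Ω) (hp : 0 < p) :
    (fun _ => 1 : (Fin n → ℂ) → ℂ) ∈ pBergmanSpace Ω p :=
  pBergman_of_bounded hΩo hΩb hp (differentiableOn_const _) (C := 1) (fun _ _ => by simp)

lemma exists_isMinimizer (hΩo : IsOpen Ω) (hΩb : Bornology.IsBounded Ω) (hp : 2 ≤ p)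
    (hz : z ∈ Ω) : ∃ g, IsMinimizer Ω p z g := by
  have hp0 : 0 < p := by linarith
  have key := exists_pBergmanNorm_min hΩo hΩb hp
    {F | F ∈ pBergmanSpace Ω p ∧ F z = 1} (fun F hF => hF.1)
    ⟨_, pBergman_one_mem hΩo hΩb hp0, rfl⟩ ?_ ?_
  · obtain ⟨g, ⟨hg, hg1⟩, hmin⟩ := key
    exact ⟨g, hg, hg1, fun F hF hF1 => hmin F ⟨hF, hF1⟩⟩
  · rintro f ⟨hf, hf1⟩ g ⟨hg, hg1⟩
    refine ⟨pBergman_smul hΩo hp0 _ (pBergman_add hΩo hp0 hf hg), ?_⟩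
    simp [hf1, hg1]
    norm_num
  · intro F hF f hf hlim
    refine ⟨hf, tendsto_nhds_unique (hlim z hz).1 ?_⟩
    simp_rw [(hF _).2]
    exact tendsto_const_nhds

lemma exists_ball_subset (hΩo : IsOpen Ω) (hz : z ∈ Ω) : ∃ δ > 0, Metric.ball z δ ⊆ Ω :=
  Metric.isOpen_iff.1 hΩo z hz

lemma pBergmanNorm_pos (hΩo : IsOpen Ω) (hΩb : Bornology.IsBounded Ω) (hp : 1 ≤ p)
    {F : (Fin n → ℂ) → ℂ} (hF : F ∈ pBergmanSpace Ω p) {ζ : Fin n → ℂ} (hζ : ζ ∈ Ω)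
    (h : F ζ ≠ 0) : 0 < pBergmanNorm Ω p F := by
  obtain ⟨δ, hδ, hb⟩ := exists_ball_subset hΩo hζ
  obtain ⟨C, hC, hev⟩ := exists_eval_bound hΩo hΩb hp hδ
  have h1 := hev F hF ζ hb
  have h2 := norm_pos_iff.2 h
  by_contra h3
  have : pBergmanNorm Ω p F = 0 := le_antisymm (not_lt.1 h3) (pBergmanNorm_nonneg _)
  rw [this, mul_zero] at h1
  linarith

lemma pBergman_ae_ne_zero (hΩo : IsOpen Ω) (hΩc : IsConnected Ω) {F : (Fin n → ℂ) → ℂ}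
    (hF : F ∈ pBergmanSpace Ω p) {ζ : Fin n → ℂ} (hζ : ζ ∈ Ω) (h : F ζ ≠ 0) :
    ∀ᵐ x ∂(volume.restrict Ω), F x ≠ 0 := by
  rw [ae_restrict_iff' hΩo.measurableSet, ae_iff]
  have := volume_zero_set hΩo hΩc.isPreconnected hF.1 hζ h
  convert this using 2
  ext x
  simp

lemma pBergmanMin_le (F : (Fin n → ℂ) → ℂ) (hF : F ∈ pBergmanSpace Ω p) {ζ : Fin n → ℂ}
    (h : F ζ = 1) : pBergmanMin Ω p ζ ≤ pBergmanNorm Ω p F :=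
  csInf_le ⟨0, by rintro _ ⟨f, -, -, rfl⟩; exact pBergmanNorm_nonneg f⟩ ⟨F, hF, h, rfl⟩

lemma pBergmanMin_mul_le (hΩo : IsOpen Ω) (hp : 0 < p) {F : (Fin n → ℂ) → ℂ}
    (hF : F ∈ pBergmanSpace Ω p) (ζ : Fin n → ℂ) :
    pBergmanMin Ω p ζ * ‖F ζ‖ ≤ pBergmanNorm Ω p F := by
  rcases eq_or_ne (F ζ) 0 with h | h
  · rw [h, norm_zero, mul_zero]
    exact pBergmanNorm_nonneg _
  · have h1 := pBergmanMin_le ((F ζ)⁻¹ • F) (pBergman_smul hΩo hp _ hF) (ζ := ζ)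
      (by simp [h])
    rw [pBergmanNorm_smul hp, norm_inv] at h1
    rwa [← le_div_iff₀ (norm_pos_iff.2 h), div_eq_inv_mul]

lemma le_pBergmanMin (hΩo : IsOpen Ω) (hΩb : Bornology.IsBounded Ω) (hp : 0 < p)
    {ζ : Fin n → ℂ} {c : ℝ}
    (h : ∀ F ∈ pBergmanSpace Ω p, F ζ = 1 → c ≤ pBergmanNorm Ω p F) :
    c ≤ pBergmanMin Ω p ζ := by
  refine le_csInf ⟨_, _, pBergman_one_mem hΩo hΩb hp, rfl, rfl⟩ ?_
  rintro _ ⟨F, hF, h1, rfl⟩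
  exact h F hF h1

lemma IsMinimizer.pBergmanMin_eq (hΩo : IsOpen Ω) (hΩb : Bornology.IsBounded Ω) (hp : 0 < p)
    {g : (Fin n → ℂ) → ℂ} (hg : IsMinimizer Ω p z g) :
    pBergmanMin Ω p z = pBergmanNorm Ω p g :=
  le_antisymm (pBergmanMin_le g hg.mem hg.eq_one) (le_pBergmanMin hΩo hΩb hp hg.le)

/-- The minimizer `g` reproduces values at `z` with respect to its own measure: this is the
Euler-Lagrange equation of the minimum problem. -/
lemma IsMinimizer.integral_quot (hΩo : IsOpen Ω) (hΩc : IsConnected Ω)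
    (hΩb : Bornology.IsBounded Ω) (hp : 2 ≤ p) (hz : z ∈ Ω)
    {g : (Fin n → ℂ) → ℂ} (hg : IsMinimizer Ω p z g) {F : (Fin n → ℂ) → ℂ}
    (hF : F ∈ pBergmanSpace Ω p) : ∫ ζ, F ζ / g ζ ∂(bergmanMeasure Ω p g) = F z := by
  have hp0 : 0 < p := by linarith
  have hgz : g z ≠ 0 := by rw [hg.eq_one]; exact one_ne_zero
  have hN := pBergmanNorm_pos hΩo hΩb (by linarith) hg.mem hz hgz
  have hnull := pBergman_ae_ne_zero hΩo hΩc hg.mem hz hgz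
  have hprob := isProbabilityMeasure_bergmanMeasure hp0 hg.mem hN
  set π := bergmanMeasure Ω p g with hπ
  -- the case of a function vanishing at `z`, by varying `g` in its direction
  have key : ∀ h ∈ pBergmanSpace Ω p, h z = 0 → ∫ ζ, h ζ / g ζ ∂π = 0 := by
    intro h hh hhz
    set I := ∫ ζ, h ζ / g ζ ∂π with hI
    set u : ℝ → ℂ := fun t => (-(t : ℂ)) * (starRingEnd ℂ) I with hu
    set φ : ℝ → ℝ := fun t => p * (u t * I).re + ∫ ζ, powRem p (u t * (h ζ / g ζ)) ∂π with hφ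
    have hφ0 : φ 0 = 0 := by simp [hφ, hu, powRem]
    have hnonneg : ∀ t, 0 ≤ φ t := by
      intro t
      have h1 := hg.le (g + u t • h)
        (pBergman_add hΩo hp0 hg.mem (pBergman_smul hΩo hp0 _ hh)) (by simp [hhz, hg.eq_one])
      have h2 := Real.rpow_le_rpow hN.le h1 hp0.le
      rw [pBergmanNorm_add_smul_rpow hΩo hp hg.mem hN hnull hh] at h2
      have hNp : 0 < pBergmanNorm Ω p g ^ p := Real.rpow_pos_of_pos hN _
      have h3 := (le_mul_iff_one_le_right hNp).1 h2
      simp only [hφ]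
      linarith
    have hderiv : HasDerivAt φ (-(p * ‖I‖ ^ 2)) 0 := by
      have hlin : ∀ t, p * (u t * I).re = -(p * ‖I‖ ^ 2) * t := by
        intro t
        have : u t * I = ((-(t * ‖I‖ ^ 2) : ℝ) : ℂ) := by
          simp only [hu]
          have := Complex.conj_mul' I
          push_cast
          linear_combination (-(t : ℂ)) * this
        rw [this, Complex.ofReal_re]
        ring
      have h1 : HasDerivAt (fun t => p * (u t * I).re) (-(p * ‖I‖ ^ 2)) 0 := by
        simp_rw [hlin]
        simpa using (hasDerivAt_id (0 : ℝ)).const_mul (-(p * ‖I‖ ^ 2))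
      have hut : Tendsto u (𝓝 0) (𝓝 0) := by
        have : Continuous u := by fun_prop
        simpa [hu] using this.tendsto 0
      have h2 : HasDerivAt (fun t => ∫ ζ, powRem p (u t * (h ζ / g ζ)) ∂π) 0 0 := by
        have hO := (integral_powRem_isBigO (π := π) (by linarith : (1 : ℝ) ≤ p)
          (memLp_quot hΩo hp hg.mem hh)).comp_tendsto hut
        have hO2 : ((fun w : ℂ => ‖w‖ ^ 2) ∘ u) =O[𝓝 0] (fun t : ℝ => t ^ 2) := by
          refine Asymptotics.IsBigO.of_bound (‖I‖ ^ 2) (Eventually.of_forall fun t => ?_)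
          simp only [Function.comp, hu, norm_pow, norm_mul, norm_neg, Complex.norm_real,
            norm_norm, RCLike.norm_conj]
          exact le_of_eq (by ring)
        have hO3 : (fun t : ℝ => t ^ 2) =o[𝓝 0] (fun t : ℝ => t) := by
          simpa using Asymptotics.isLittleO_pow_pow (𝕜 := ℝ) (show 1 < 2 by norm_num)
        rw [hasDerivAt_iff_isLittleO]
        have h3 := (hO.trans hO2).trans_isLittleO hO3
        refine (h3.congr_left fun t => ?_).congr_right fun t => by simp
        simp [hu, powRem_zero]
      exact (h1.add h2).congr_deriv (add_zero _)
    have hmin : IsLocalMin φ 0 := Eventually.of_forall fun t => by rw [hφ0]; exact hnonneg t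
    have h0 := hmin.hasDerivAt_eq_zero hderiv
    have : p * ‖I‖ ^ 2 = 0 := by linarith
    simpa [hp0.ne'] using this
  have hh : F - F z • g ∈ pBergmanSpace Ω p :=
    pBergman_sub hΩo hp0 hF (pBergman_smul hΩo hp0 _ hg.mem)
  have h1 := key _ hh (by simp [hg.eq_one])
  have hx : Integrable (fun ζ => F ζ / g ζ) π :=
    (memLp_two_of_max (memLp_quot hΩo hp hg.mem hF)).integrable (by norm_num)
  have h2 : ∫ ζ, (F - F z • g) ζ / g ζ ∂π = ∫ ζ, (F ζ / g ζ - F z) ∂π := by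
    refine integral_congr_ae ?_
    filter_upwards [ae_bergmanMeasure_ne_zero hΩo hp0 hg.mem] with ζ hζ
    simp only [Pi.sub_apply, Pi.smul_apply, smul_eq_mul]
    field_simp
  rw [h2, integral_sub hx (integrable_const _)] at h1
  simpa [sub_eq_zero] using h1

/-- Near `z`, values of functions of `A^p(Ω)` are controlled by the `L²` norm of their quotient by
the minimizer. -/
lemma IsMinimizer.exists_eval_bound (hΩo : IsOpen Ω) (hp : 2 ≤ p)
    (hz : z ∈ Ω) {g : (Fin n → ℂ) → ℂ} (hg : IsMinimizer Ω p z g)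
    (hN : 0 < pBergmanNorm Ω p g) :
    ∃ δ > 0, ∃ C > 0, Metric.ball z δ ⊆ Ω ∧ (∀ ζ ∈ Metric.ball z δ, 1 / 2 ≤ ‖g ζ‖) ∧
      ∀ F ∈ pBergmanSpace Ω p, ∀ ζ ∈ Metric.ball z δ,
        ‖F ζ‖ ≤ C * Real.sqrt (∫ x, ‖F x / g x‖ ^ 2 ∂(bergmanMeasure Ω p g)) := by
  have hp0 : 0 < p := by linarith
  have hprob := isProbabilityMeasure_bergmanMeasure hp0 hg.mem hN
  set π := bergmanMeasure Ω p g with hπ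
  have hcont : ContinuousAt g z := (pBergman_differentiableAt hΩo hg.mem hz).continuousAt
  have hev : ∀ᶠ ζ in 𝓝 z, 1 / 2 < ‖g ζ‖ := by
    refine hcont.norm.eventually_const_lt ?_
    simp only [hg.eq_one, norm_one]
    norm_num
  obtain ⟨δ, hδ, hb⟩ := Metric.eventually_nhds_iff.1 (hev.and (hΩo.mem_nhds hz))
  have hbΩ : Metric.ball z δ ⊆ Ω := fun x hx => (hb hx).2
  set V := (volume (Metric.ball (0 : Fin n → ℂ) (δ / 2))).toReal with hV
  have hVpos : 0 < V := ENNReal.toReal_pos (Metric.measure_ball_pos _ _ (half_pos hδ)).ne'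
    Metric.isBounded_ball.measure_lt_top.ne
  have hNp : 0 < pBergmanNorm Ω p g ^ p := Real.rpow_pos_of_pos hN _
  set A := 2 ^ (p - 1) * pBergmanNorm Ω p g ^ p with hA
  have hApos : 0 < A := by positivity
  refine ⟨δ / 2, half_pos hδ, A / V, by positivity,
    (Metric.ball_subset_ball (by linarith)).trans hbΩ,
    fun ζ hζ => (hb (Metric.ball_subset_ball (by linarith) hζ)).1.le, fun F hF ζ hζ => ?_⟩
  have hsub : Metric.ball ζ (δ / 2) ⊆ Metric.ball z δ :=
    Metric.ball_subset_ball' (by rw [Metric.mem_ball] at hζ; linarith)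
  have h2 := memLp_two_of_max (memLp_quot hΩo hp hg.mem hF)
  have hx1 : Integrable (fun x => ‖F x / g x‖) π := (h2.integrable (by norm_num)).norm
  -- Cauchy-Schwarz for the probability measure
  have hCS : ∫ x, ‖F x / g x‖ ∂π ≤ Real.sqrt (∫ x, ‖F x / g x‖ ^ 2 ∂π) := by
    refine Real.le_sqrt_of_sq_le ?_
    have := (even_two.convexOn_pow (𝕜 := ℝ)).map_integral_le (μ := π)
      (f := fun x => ‖F x / g x‖) (continuous_pow 2).continuousOn isClosed_univ
      (Eventually.of_forall fun _ => Set.mem_univ _) hx1 (integrable_norm_sq h2)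
    exact this
  have hint : IntegrableOn (fun x => ‖g x‖ ^ p * ‖F x / g x‖) Ω := by
    have := (integrable_withDensity_iff_integrable_smul₀' (aemeasurable_bergman_density hΩo hg.mem)
      (Eventually.of_forall fun _ => ENNReal.ofReal_lt_top)).1 hx1
    refine (this.const_mul (pBergmanNorm Ω p g ^ p)).congr (Eventually.of_forall fun x => ?_)
    have h0 : 0 ≤ ‖g x‖ ^ p / pBergmanNorm Ω p g ^ p := by positivity
    simp only [ENNReal.toReal_ofReal h0, smul_eq_mul]
    field_simp
  have hF1 : ∫⁻ x in Metric.ball ζ (δ / 2), ‖F x‖ₑ ≤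
      ENNReal.ofReal (A * ∫ x, ‖F x / g x‖ ∂π) := by
    have e1 : ∫⁻ x in Metric.ball ζ (δ / 2), ‖F x‖ₑ ≤
        ∫⁻ x in Metric.ball ζ (δ / 2), ENNReal.ofReal (2 ^ (p - 1) * (‖g x‖ ^ p * ‖F x / g x‖)) := by
      refine setLIntegral_mono' Metric.isOpen_ball.measurableSet fun x hx => ?_
      have hgx : 1 / 2 < ‖g x‖ := (hb (hsub hx)).1
      have hgx0 : 0 < ‖g x‖ := by linarith
      rw [← ofReal_norm]
      refine ENNReal.ofReal_le_ofReal ?_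
      have e2 : ‖F x‖ = ‖g x‖ * ‖F x / g x‖ := by
        rw [norm_div]; field_simp
      have e3 : ‖g x‖ ^ p = ‖g x‖ ^ (p - 1) * ‖g x‖ := by
        rw [← Real.rpow_add_one hgx0.ne']; ring_nf
      have e4 : 1 ≤ 2 ^ (p - 1) * ‖g x‖ ^ (p - 1) := by
        rw [← Real.mul_rpow (by norm_num) hgx0.le]
        exact Real.one_le_rpow (by linarith) (by linarith)
      calc ‖F x‖ = 1 * (‖g x‖ * ‖F x / g x‖) := by rw [e2, one_mul]
        _ ≤ 2 ^ (p - 1) * ‖g x‖ ^ (p - 1) * (‖g x‖ * ‖F x / g x‖) := by gcongr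
        _ = _ := by rw [e3]; ring
    refine e1.trans ((lintegral_mono_set (hsub.trans hbΩ)).trans (le_of_eq ?_))
    rw [← ofReal_integral_eq_lintegral_ofReal (hint.const_mul _)
      (Eventually.of_forall fun x => by positivity), integral_const_mul,
      integral_bergmanMeasure hΩo hg.mem, hA]
    congr 1
    field_simp
  have h3 := (enorm_mul_volume_le_lintegral (hF.1.mono (hsub.trans hbΩ))).trans hF1
  have h4 := ENNReal.toReal_mono ENNReal.ofReal_ne_top h3
  have h5 : 0 ≤ ∫ x, ‖F x / g x‖ ∂π := integral_nonneg fun _ => norm_nonneg _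
  rw [ENNReal.toReal_mul, toReal_enorm, ENNReal.toReal_ofReal (by positivity)] at h4
  rw [div_mul_eq_mul_div, le_div_iff₀ hVpos]
  exact h4.trans (by gcongr)

end Minimizer

/-! ### Representing functionals on `A^p(Ω)` in a weighted `L²` space -/

/-- Riesz representation for a functional on a real vector space that is bounded by the pull-back
of a Hilbert norm; the representing vector is taken in the closure of the image. -/
lemma exists_riesz_of_bound {V E : Type*} [AddCommGroup V] [Module ℝ V] [NormedAddCommGroup E]
    [InnerProductSpace ℝ E] [CompleteSpace E] (J : V →ₗ[ℝ] E) (l : V →ₗ[ℝ] ℝ) {C : ℝ}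
    (hC : 0 ≤ C) (hb : ∀ v, |l v| ≤ C * ‖J v‖) :
    ∃ ξ ∈ closure (Set.range J), (∀ v, inner ℝ ξ (J v) = l v) ∧ ‖ξ‖ ≤ C := by
  obtain ⟨s, hs⟩ := J.rangeRestrict.exists_rightInverse_of_surjective (LinearMap.range_rangeRestrict J)
  have hs' : ∀ x : LinearMap.range J, J (s x) = x := fun x => by
    have := congrArg (fun f => ((f x : LinearMap.range J) : E)) hs
    simpa using this
  set f₀ : LinearMap.range J →ₗ[ℝ] ℝ := l.comp s with hf₀
  have hf₀b : ∀ x, ‖f₀ x‖ ≤ C * ‖x‖ := fun x => by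
    have := hb (s x)
    rw [hs' x] at this
    simpa [hf₀] using this
  set f := f₀.mkContinuous C hf₀b with hf
  obtain ⟨F, hFe, hFn⟩ := exists_extension_norm_eq (LinearMap.range J) f
  set ξ₀ := (InnerProductSpace.toDual ℝ E).symm F with hξ₀
  set K := (LinearMap.range J).topologicalClosure with hK
  have : CompleteSpace K := (Submodule.isClosed_topologicalClosure _).completeSpace_coe
  refine ⟨K.starProjection ξ₀, ?_, fun v => ?_, ?_⟩
  · have h : K.starProjection ξ₀ ∈ K := Submodule.starProjection_apply_mem _ _
    have h2 : ((K : Submodule ℝ E) : Set E) = closure (Set.range J) := by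
      rw [hK, Submodule.topologicalClosure_coe, LinearMap.coe_range]
    rw [← h2]
    exact h
  · have hJK : J v ∈ K := Submodule.le_topologicalClosure _ ⟨v, rfl⟩
    rw [Submodule.inner_starProjection_left_eq_right, Submodule.starProjection_eq_self_iff.2 hJK, hξ₀,
      InnerProductSpace.toDual_symm_apply]
    have h1 := hFe ⟨J v, v, rfl⟩
    simp only at h1
    rw [h1, hf, LinearMap.mkContinuous_apply, hf₀, LinearMap.comp_apply]
    have h2 : J (s ⟨J v, v, rfl⟩ - v) = 0 := by
      rw [map_sub, hs', sub_self]
    have h3 := hb (s ⟨J v, v, rfl⟩ - v)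
    rw [h2, norm_zero, mul_zero, map_sub] at h3
    exact sub_eq_zero.1 (abs_nonpos_iff.1 h3)
  · calc ‖K.starProjection ξ₀‖ ≤ ‖ξ₀‖ := by
          have := K.norm_starProjection_apply_le ξ₀
          exact this
      _ = ‖F‖ := by rw [hξ₀, LinearIsometryEquiv.norm_map]
      _ = ‖f‖ := hFn
      _ ≤ C := LinearMap.mkContinuous_norm_le _ hC _

section Stretch

/-- The real-linear map `x + iy ↦ √(p-1) x + iy`. It turns the real quadratic form `powQuad p`
into `p / 2` times the square of the norm. -/
def stretch (p : ℝ) : ℂ →L[ℝ] ℂ :=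
  Real.sqrt (p - 1) • (Complex.ofRealCLM.comp Complex.reCLM) +
    (Complex.I • Complex.ofRealCLM).comp Complex.imCLM

lemma stretch_re (p : ℝ) (x : ℂ) : (stretch p x).re = Real.sqrt (p - 1) * x.re := by
  simp [stretch]

lemma stretch_im (p : ℝ) (x : ℂ) : (stretch p x).im = x.im := by
  simp [stretch]

lemma norm_sq_eq (x : ℂ) : ‖x‖ ^ 2 = x.re ^ 2 + x.im ^ 2 := by
  rw [← Complex.normSq_eq_norm_sq, Complex.normSq_apply]
  ring

lemma norm_stretch_sq {p : ℝ} (hp : 2 ≤ p) (x : ℂ) :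
    ‖stretch p x‖ ^ 2 = (p - 1) * x.re ^ 2 + x.im ^ 2 := by
  rw [norm_sq_eq, stretch_re, stretch_im, mul_pow, Real.sq_sqrt (by linarith)]

lemma norm_le_norm_stretch {p : ℝ} (hp : 2 ≤ p) (x : ℂ) : ‖x‖ ≤ ‖stretch p x‖ := by
  refine (sq_le_sq₀ (norm_nonneg _) (norm_nonneg _)).1 ?_
  rw [norm_stretch_sq hp, norm_sq_eq]
  nlinarith [sq_nonneg x.re]

lemma powQuad_eq {p : ℝ} (hp : 2 ≤ p) (x : ℂ) : powQuad p x = p / 2 * ‖stretch p x‖ ^ 2 := by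
  rw [norm_stretch_sq hp, powQuad, norm_sq_eq]
  ring

/-- The dual quadratic form, for the conjugate exponent. -/
lemma powQuad_conj_stretch {p : ℝ} (hp : 2 ≤ p) (x : ℂ) :
    (p - 1) * powQuad (p / (p - 1)) (stretch p x) = p / 2 * ‖x‖ ^ 2 := by
  have h1 : p - 1 ≠ 0 := by linarith
  rw [powQuad, norm_stretch_sq hp, norm_sq_eq, stretch_re, mul_pow, Real.sq_sqrt (by linarith)]
  field_simp
  ring

lemma inner_stretch (p : ℝ) (x y : ℂ) : inner ℝ x (stretch p y) = inner ℝ (stretch p x) y := by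
  simp only [Complex.inner, Complex.mul_re, Complex.conj_re, Complex.conj_im, stretch_re,
    stretch_im]
  ring

end Stretch

section Representers

variable {n : ℕ} {Ω : Set (Fin n → ℂ)} {p : ℝ} {g : (Fin n → ℂ) → ℂ}

/-- `A^p(Ω)` as a real vector space of functions. -/
def pBergmanSubmodule (hΩo : IsOpen Ω) (hΩb : Bornology.IsBounded Ω) (hp : 0 < p) :
    Submodule ℝ ((Fin n → ℂ) → ℂ) where
  carrier := pBergmanSpace Ω p
  add_mem' hf hg := pBergman_add hΩo hp hf hg
  zero_mem' := pBergman_of_bounded hΩo hΩb hp (differentiableOn_const _) (C := 0)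
    (fun _ _ => by simp)
  smul_mem' c f hf := by
    have := pBergman_smul hΩo hp (c : ℂ) hf
    convert this using 1
    ext ζ
    simp

lemma norm_toLp_sq {α : Type*} [MeasurableSpace α] {π : Measure α} {x : α → ℂ} (hx : MemLp x 2 π) :
    ‖hx.toLp x‖ ^ 2 = ∫ a, ‖x a‖ ^ 2 ∂π := by
  rw [← real_inner_self_eq_norm_sq, L2.inner_def]
  refine integral_congr_ae ?_
  filter_upwards [hx.coeFn_toLp] with a ha
  rw [ha, real_inner_self_eq_norm_sq]

/-- A real-linear functional on `A^p(Ω)` that is bounded in terms of the weighted `L²` norm of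
`T (F / g)` is represented by a weighted `L²` function in the closure of these quotients. -/
lemma exists_representer (hΩo : IsOpen Ω) (hΩb : Bornology.IsBounded Ω) (hp : 2 ≤ p)
    (hg : g ∈ pBergmanSpace Ω p) (hN : 0 < pBergmanNorm Ω p g) (T : ℂ →L[ℝ] ℂ)
    (hT : ∀ x, ‖x‖ ≤ ‖T x‖) (l : ((Fin n → ℂ) → ℂ) → ℝ)
    (hadd : ∀ F ∈ pBergmanSpace Ω p, ∀ G ∈ pBergmanSpace Ω p, l (F + G) = l F + l G)
    (hsmul : ∀ (c : ℝ), ∀ F ∈ pBergmanSpace Ω p, l (c • F) = c * l F) {C : ℝ} (hC : 0 ≤ C)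
    (hb : ∀ F ∈ pBergmanSpace Ω p,
      |l F| ≤ C * Real.sqrt (∫ x, ‖F x / g x‖ ^ 2 ∂(bergmanMeasure Ω p g))) :
    ∃ ξ : (Fin n → ℂ) → ℂ, MemLp ξ 2 (bergmanMeasure Ω p g) ∧
      (∀ F ∈ pBergmanSpace Ω p,
        ∫ x, inner ℝ (ξ x) (T (F x / g x)) ∂(bergmanMeasure Ω p g) = l F) ∧
      ∫ x, ‖ξ x‖ ^ 2 ∂(bergmanMeasure Ω p g) ≤ C ^ 2 ∧
      ∀ ε > 0, ∃ F ∈ pBergmanSpace Ω p,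
        ∫ x, ‖ξ x - T (F x / g x)‖ ^ 2 ∂(bergmanMeasure Ω p g) < ε := by
  have hp0 : 0 < p := by linarith
  have hprob := isProbabilityMeasure_bergmanMeasure hp0 hg hN
  set π := bergmanMeasure Ω p g with hπ
  have hq : ∀ F ∈ pBergmanSpace Ω p, MemLp (fun x => F x / g x) 2 π := fun F hF =>
    memLp_two_of_max (memLp_quot hΩo hp hg hF)
  have hTq : ∀ F ∈ pBergmanSpace Ω p, MemLp (fun x => T (F x / g x)) 2 π := fun F hF =>
    T.comp_memLp' (hq F hF)
  set V := pBergmanSubmodule hΩo hΩb hp0 with hV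
  set J : V →ₗ[ℝ] Lp ℂ 2 π :=
    { toFun := fun F => (hTq F.1 F.2).toLp _
      map_add' := fun F G => by
        rw [← MemLp.toLp_add]
        congr 1
        ext x
        simp [add_div]
      map_smul' := fun c F => by
        rw [RingHom.id_apply, ← MemLp.toLp_const_smul]
        congr 1
        ext x
        simp only [Submodule.coe_smul, Pi.smul_apply]
        rw [smul_div_assoc, map_smul] } with hJ
  have hJn : ∀ F : V, ‖J F‖ ^ 2 = ∫ x, ‖T (F.1 x / g x)‖ ^ 2 ∂π := fun F =>
    norm_toLp_sq (hTq F.1 F.2)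
  set L : V →ₗ[ℝ] ℝ :=
    { toFun := fun F => l F.1
      map_add' := fun F G => hadd F.1 F.2 G.1 G.2
      map_smul' := fun c F => hsmul c F.1 F.2 } with hL
  have hLb : ∀ F : V, |L F| ≤ C * ‖J F‖ := fun F => by
    refine (hb F.1 F.2).trans (mul_le_mul_of_nonneg_left ?_ hC)
    refine Real.sqrt_le_iff.2 ⟨norm_nonneg _, ?_⟩
    rw [hJn]
    refine integral_mono (integrable_norm_sq (hq F.1 F.2)) (integrable_norm_sq (hTq F.1 F.2))
      fun x => ?_
    simp only
    gcongr
    exact hT _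
  obtain ⟨ξ, hξcl, hξ, hξn⟩ := exists_riesz_of_bound J L hC hLb
  have hξm : MemLp ξ 2 π := Lp.memLp ξ
  refine ⟨ξ, hξm, fun F hF => ?_, ?_, fun ε hε => ?_⟩
  · have := hξ ⟨F, hF⟩
    rw [L2.inner_def] at this
    rw [show l F = L ⟨F, hF⟩ from rfl, ← this]
    refine integral_congr_ae ?_
    filter_upwards [(hTq F hF).coeFn_toLp] with x hx
    simp only [hJ, LinearMap.coe_mk, AddHom.coe_mk]
    rw [hx]
  · have h1 := norm_toLp_sq hξm
    rw [Lp.toLp_coeFn] at h1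
    rw [← h1]
    gcongr
  · obtain ⟨_, ⟨F, rfl⟩, hd⟩ := Metric.mem_closure_iff.1 hξcl (Real.sqrt ε) (Real.sqrt_pos.2 hε)
    refine ⟨F.1, F.2, ?_⟩
    have h1 := norm_toLp_sq (hξm.sub (hTq F.1 F.2))
    have h2 : (hξm.sub (hTq F.1 F.2)).toLp _ = ξ - J F := by
      rw [MemLp.toLp_sub hξm (hTq F.1 F.2), Lp.toLp_coeFn]
      rfl
    rw [h2] at h1
    rw [dist_eq_norm] at hd
    have h3 : ‖ξ - J F‖ ^ 2 < ε := by
      have := pow_lt_pow_left₀ hd (norm_nonneg _) two_ne_zero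
      rwa [Real.sq_sqrt hε.le] at this
    rw [h1] at h3
    exact h3

end Representers

/-! ### Upper bounds for the kernel by duality -/

section Dual

variable {n : ℕ} {Ω : Set (Fin n → ℂ)} {p : ℝ} {z : Fin n → ℂ} {g : (Fin n → ℂ) → ℂ}

lemma holderConjugate_div_sub_one (hp : 2 ≤ p) : (p / (p - 1)).HolderConjugate p :=
  (Real.HolderConjugate.conjExponent (by linarith : 1 < p)).symm

lemma conjExponent_bounds (hp : 2 ≤ p) : 1 < p / (p - 1) ∧ p / (p - 1) ≤ 2 := by
  constructor
  · rw [lt_div_iff₀ (by linarith)]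
    linarith
  · rw [div_le_iff₀ (by linarith)]
    linarith

/-- If `1 + y` represents evaluation at `w` (divided by `g w`), then the norm of `1 + y` in the
dual `L^{p'}` space bounds `m_p w` from below, by Hölder's inequality. -/
lemma IsMinimizer.log_min_le_of_representer (hΩo : IsOpen Ω) (hΩc : IsConnected Ω)
    (hΩb : Bornology.IsBounded Ω) (hp : 2 ≤ p) (hz : z ∈ Ω) (hg : IsMinimizer Ω p z g)
    {w : Fin n → ℂ} (hgw : g w ≠ 0) {y : (Fin n → ℂ) → ℂ}
    (hy : MemLp y 2 (bergmanMeasure Ω p g))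
    (hrep : ∀ F ∈ pBergmanSpace Ω p,
      ∫ x, inner ℝ (1 + y x) (F x / g x) ∂(bergmanMeasure Ω p g) = (F w / g w).re) :
    p * (Real.log (pBergmanMin Ω p z) - Real.log (pBergmanMin Ω p w) - Real.log ‖g w‖) ≤
      (p - 1) * ∫ x, powRem (p / (p - 1)) (y x) ∂(bergmanMeasure Ω p g) := by
  have hp0 : 0 < p := by linarith
  have hgz : g z ≠ 0 := by rw [hg.eq_one]; exact one_ne_zero
  have hN := pBergmanNorm_pos hΩo hΩb (by linarith) hg.mem hz hgz
  have hnull := pBergman_ae_ne_zero hΩo hΩc hg.mem hz hgz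
  have hprob := isProbabilityMeasure_bergmanMeasure hp0 hg.mem hN
  set π := bergmanMeasure Ω p g with hπ
  set q := p / (p - 1) with hq
  obtain ⟨hq1, hq2⟩ := conjExponent_bounds hp
  have hymax : MemLp y (ENNReal.ofReal (max q 2)) π := by
    rw [max_eq_right hq2]; simpa using hy
  have hy1 : Integrable y π := hy.integrable (by norm_num)
  set T := ∫ x, powRem q (y x) ∂π with hT
  have hmean : (∫ x, y x ∂π).re = 0 := by
    have h1 := hrep g hg.mem
    rw [div_self hgw, Complex.one_re] at h1
    have h2 : ∫ x, inner ℝ (1 + y x) (g x / g x) ∂π = ∫ x, (1 + (y x).re) ∂π := by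
      refine integral_congr_ae ?_
      filter_upwards [ae_bergmanMeasure_ne_zero hΩo hp0 hg.mem] with x hx
      simp [div_self hx, Complex.inner]
    have h3 : ∫ x, (y x).re ∂π = (∫ x, y x ∂π).re := integral_re hy1
    have h4 : Integrable (fun x => (y x).re) π := hy1.re
    rw [h2, integral_add (integrable_const _) h4, h3] at h1
    simpa using h1
  have hnorm : ∫ x, ‖1 + y x‖ ^ q ∂π = 1 + T := by
    rw [integral_norm_one_add_rpow hq1.le hymax, hmean]
    ring
  have hgwp : 0 < ‖g w‖ := norm_pos_iff.2 hgw
  have h1y2 : MemLp (fun x => 1 + y x) 2 π := (memLp_const (1 : ℂ)).add hy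
  have h1y : MemLp (fun x => 1 + y x) (ENNReal.ofReal q) π := by
    refine h1y2.mono_exponent ?_
    rw [show (2 : ENNReal) = ENNReal.ofReal 2 by simp]
    exact ENNReal.ofReal_le_ofReal hq2
  have hlow : ∀ F ∈ pBergmanSpace Ω p, F w = 1 →
      pBergmanNorm Ω p g * Real.exp (-(T / q)) / ‖g w‖ ≤ pBergmanNorm Ω p F := by
    intro F hF hFw
    set F₁ := g w • F with hF₁
    have hF₁m : F₁ ∈ pBergmanSpace Ω p := pBergman_smul hΩo hp0 _ hF
    have h1 := hrep F₁ hF₁m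
    rw [show F₁ w / g w = 1 by simp [hF₁, hFw, hgw], Complex.one_re] at h1
    have hxp : MemLp (fun x => F₁ x / g x) (ENNReal.ofReal p) π := by
      have := memLp_quot hΩo hp hg.mem hF₁m
      rwa [max_eq_left hp] at this
    have hH := integral_mul_norm_le_Lp_mul_Lq (holderConjugate_div_sub_one hp) h1y hxp
    have hmul : Integrable (fun x => ‖1 + y x‖ * ‖F₁ x / g x‖) π :=
      h1y2.norm.integrable_mul (memLp_two_of_max (memLp_quot hΩo hp hg.mem hF₁m)).norm
    have h2 : (1 : ℝ) ≤ ∫ x, ‖1 + y x‖ * ‖F₁ x / g x‖ ∂π := by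
      have := norm_integral_le_of_norm_le hmul (f := fun x => inner ℝ (1 + y x) (F₁ x / g x))
        (Eventually.of_forall fun x => norm_inner_le_norm _ _)
      rw [h1, norm_one] at this
      exact this
    have h3 := pBergmanNorm_rpow_eq_integral_quot hΩo hp0 hg.mem hN hnull F₁
    have hNp : 0 < pBergmanNorm Ω p g ^ p := Real.rpow_pos_of_pos hN _
    have h4 : (∫ x, ‖F₁ x / g x‖ ^ p ∂π) ^ (1 / p) =
        ‖g w‖ * pBergmanNorm Ω p F / pBergmanNorm Ω p g := by
      have h5 : ∫ x, ‖F₁ x / g x‖ ^ p ∂π = (pBergmanNorm Ω p F₁ / pBergmanNorm Ω p g) ^ p := by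
        rw [Real.div_rpow (pBergmanNorm_nonneg _) hN.le, h3, mul_div_cancel_left₀ _ hNp.ne']
      rw [h5, ← Real.rpow_mul (div_nonneg (pBergmanNorm_nonneg _) hN.le),
        mul_one_div_cancel hp0.ne', Real.rpow_one, hF₁, pBergmanNorm_smul hp0]
    rw [hnorm, h4] at hH
    have hT1 : 0 ≤ 1 + T := by
      rw [← hnorm]
      exact integral_nonneg fun _ => Real.rpow_nonneg (norm_nonneg _) _
    have h6 : (1 + T) ^ (1 / q) ≤ Real.exp (T / q) := by
      have hexp : 1 + T ≤ Real.exp T := by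
        rw [add_comm]
        exact Real.add_one_le_exp T
      have := Real.rpow_le_rpow hT1 hexp (by positivity : 0 ≤ 1 / q)
      rwa [← Real.exp_mul, mul_one_div] at this
    have h7 : 1 ≤ Real.exp (T / q) * (‖g w‖ * pBergmanNorm Ω p F / pBergmanNorm Ω p g) :=
      (h2.trans hH).trans (mul_le_mul_of_nonneg_right h6
        (div_nonneg (mul_nonneg (norm_nonneg _) (pBergmanNorm_nonneg _)) hN.le))
    rw [div_le_iff₀ hgwp, Real.exp_neg, ← div_eq_mul_inv, div_le_iff₀ (Real.exp_pos _)]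
    rw [← mul_div_assoc, le_div_iff₀ hN] at h7
    linarith
  have hm := le_pBergmanMin hΩo hΩb hp0 hlow
  have hpos : 0 < pBergmanNorm Ω p g * Real.exp (-(T / q)) / ‖g w‖ := by positivity
  have hlog := Real.log_le_log hpos hm
  rw [Real.log_div (by positivity) hgwp.ne', Real.log_mul hN.ne' (Real.exp_pos _).ne',
    Real.log_exp] at hlog
  rw [hg.pBergmanMin_eq hΩo hΩb hp0]
  have hTq : (p - 1) * T = p * (T / q) := by
    have : p - 1 ≠ 0 := by linarith
    rw [hq]
    field_simp
  rw [hTq]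
  exact mul_le_mul_of_nonneg_left (by linarith) hp0.le

end Dual

/-! ### Evaluation along a holomorphic disc -/

section Disc

/-- First- and second-order Taylor estimates from a bound on a disc, by Schwarz's lemma. -/
lemma norm_sub_taylor_le {G : ℂ → ℂ} {R M : ℝ} (hR : 0 < R)
    (hG : DifferentiableOn ℂ G (Metric.ball 0 R)) (hM : ∀ t ∈ Metric.ball (0 : ℂ) R, ‖G t‖ ≤ M)
    {t : ℂ} (ht : ‖t‖ < R) :
    ‖G t - G 0‖ ≤ 2 * M / R * ‖t‖ ∧ ‖G t - G 0 - t * deriv G 0‖ ≤ 4 * M / R ^ 2 * ‖t‖ ^ 2 := by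
  have h0 : (0 : ℂ) ∈ Metric.ball (0 : ℂ) R := Metric.mem_ball_self hR
  have ht' : t ∈ Metric.ball (0 : ℂ) R := by simpa using ht
  have hM0 : 0 ≤ M := (norm_nonneg _).trans (hM 0 h0)
  have hmaps : Set.MapsTo G (Metric.ball 0 R) (Metric.closedBall (G 0) (2 * M)) := fun x hx => by
    rw [Metric.mem_closedBall, dist_eq_norm]
    linarith [norm_sub_le (G x) (G 0), hM x hx, hM 0 h0]
  have hder := Complex.norm_deriv_le_div_of_mapsTo_ball hG hmaps hR
  have hGd : DifferentiableAt ℂ G 0 := hG.differentiableAt (Metric.ball_mem_nhds 0 hR)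
  constructor
  · have := Complex.dist_le_div_mul_dist_of_mapsTo_ball hG hmaps ht'
    simpa [dist_eq_norm] using this
  · set f : ℂ → ℂ := fun t => G t - t * deriv G 0 with hf
    have hfd : DifferentiableOn ℂ f (Metric.ball 0 R) := hG.sub (by fun_prop)
    have hf0 : f 0 = G 0 := by simp [hf]
    have hfmaps : Set.MapsTo f (Metric.ball 0 R) (Metric.closedBall (f 0) (4 * M)) := fun x hx => by
      have hx' : ‖x‖ < R := by simpa using hx
      have h1 : ‖x * deriv G 0‖ ≤ 2 * M := by
        rw [norm_mul]
        calc ‖x‖ * ‖deriv G 0‖ ≤ R * (2 * M / R) := by gcongr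
          _ = 2 * M := by field_simp
      have h2 : f x - f 0 = (G x - G 0) - x * deriv G 0 := by rw [hf0]; ring
      rw [Metric.mem_closedBall, dist_eq_norm, h2]
      linarith [norm_sub_le (G x - G 0) (x * deriv G 0), norm_sub_le (G x) (G 0), hM x hx, hM 0 h0]
    have ho : (fun x => f x - f 0) =o[𝓝 0] (fun w => ‖w - 0‖ ^ 1) := by
      have := hGd.hasDerivAt.isLittleO
      simp only [pow_one]
      refine (this.congr_left fun x => ?_).norm_right
      rw [hf0, sub_zero, smul_eq_mul]
      ring
    have := Complex.dist_le_mul_div_pow_of_mapsTo_ball_of_isLittleO hfd hfmaps ho ht'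
    rw [dist_eq_norm, dist_zero_right, hf0] at this
    rw [show G t - G 0 - t * deriv G 0 = f t - G 0 by rw [hf]; ring]
    refine this.trans (le_of_eq ?_)
    rw [div_pow]
    field_simp
    ring

variable {n : ℕ} {Ω : Set (Fin n → ℂ)} {p : ℝ} {z X : Fin n → ℂ} {g : (Fin n → ℂ) → ℂ}

/-- The derivative at `z` in direction `X` of the quotient `F / g`, when `g z = 1`. -/
def quotDeriv (g : (Fin n → ℂ) → ℂ) (z X : Fin n → ℂ) (F : (Fin n → ℂ) → ℂ) : ℂ :=
  fderiv ℂ F z X - F z * fderiv ℂ g z X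

/-- Along a holomorphic disc through `z`, the quotients `F / g` satisfy first- and second-order
Taylor estimates with constants controlled by the weighted `L²` norm of `F / g`. -/
lemma IsMinimizer.exists_disc_bound (hΩo : IsOpen Ω) (hp : 2 ≤ p) (hz : z ∈ Ω)
    (hg : IsMinimizer Ω p z g) (hN : 0 < pBergmanNorm Ω p g) {σ : ℂ → (Fin n → ℂ)}
    (hσ : IsHolDisc Ω z X σ) :
    ∃ R > 0, ∃ C > 0, DifferentiableOn ℂ σ (Metric.ball 0 R) ∧
      Set.MapsTo σ (Metric.ball 0 R) Ω ∧ (∀ t ∈ Metric.ball (0 : ℂ) R, g (σ t) ≠ 0) ∧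
      ∀ F ∈ pBergmanSpace Ω p,
        DifferentiableOn ℂ (fun t => F (σ t) / g (σ t)) (Metric.ball 0 R) ∧
        deriv (fun t => F (σ t) / g (σ t)) 0 = quotDeriv g z X F ∧
        ‖quotDeriv g z X F‖ ≤
          C * Real.sqrt (∫ x, ‖F x / g x‖ ^ 2 ∂(bergmanMeasure Ω p g)) ∧
        ∀ t ∈ Metric.ball (0 : ℂ) R,
          ‖F (σ t) / g (σ t) - F z‖ ≤
            C * Real.sqrt (∫ x, ‖F x / g x‖ ^ 2 ∂(bergmanMeasure Ω p g)) * ‖t‖ ∧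
          ‖F (σ t) / g (σ t) - F z - t * quotDeriv g z X F‖ ≤
            C * Real.sqrt (∫ x, ‖F x / g x‖ ^ 2 ∂(bergmanMeasure Ω p g)) * ‖t‖ ^ 2 := by
  obtain ⟨δ, hδ, C, hC, hsub, hlow, hev⟩ := hg.exists_eval_bound hΩo hp hz hN
  obtain ⟨R₀, hR₀, hσd, hσm, hσ0, hσX⟩ := hσ
  have hσc : ContinuousAt σ 0 :=
    (hσd.differentiableAt (Metric.ball_mem_nhds 0 hR₀)).continuousAt
  have hnear : ∀ᶠ t in 𝓝 (0 : ℂ), σ t ∈ Metric.ball z δ :=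
    hσc.eventually_mem (by rw [hσ0]; exact Metric.ball_mem_nhds z hδ)
  obtain ⟨R, hR, hRb⟩ := Metric.eventually_nhds_iff_ball.1
    (hnear.and (Metric.ball_mem_nhds (0 : ℂ) hR₀))
  have hgne : ∀ t ∈ Metric.ball (0 : ℂ) R, g (σ t) ≠ 0 := fun t ht h0 => by
    have := hlow _ (hRb t ht).1
    rw [h0, norm_zero] at this
    norm_num at this
  have hσd' : DifferentiableOn ℂ σ (Metric.ball 0 R) := hσd.mono fun t ht => (hRb t ht).2
  have hmapΩ : Set.MapsTo σ (Metric.ball 0 R) Ω := fun t ht => hsub (hRb t ht).1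
  set C' := max (2 * (2 * C) / R) (4 * (2 * C) / R ^ 2) with hC'
  have hC'pos : 0 < C' := lt_max_of_lt_left (by positivity)
  refine ⟨R, hR, C', hC'pos, hσd', hmapΩ, hgne, fun F hF => ?_⟩
  set N₂ := Real.sqrt (∫ x, ‖F x / g x‖ ^ 2 ∂(bergmanMeasure Ω p g)) with hN₂
  have hN₂0 : 0 ≤ N₂ := Real.sqrt_nonneg _
  set G : ℂ → ℂ := fun t => F (σ t) / g (σ t) with hG
  have hGd : DifferentiableOn ℂ G (Metric.ball 0 R) :=
    (hF.1.comp hσd' hmapΩ).div (hg.mem.1.comp hσd' hmapΩ) hgne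
  have hG0 : G 0 = F z := by simp [hG, hσ0, hg.eq_one]
  have hGder : deriv G 0 = quotDeriv g z X F := by
    have hσ' : HasDerivAt σ X 0 := by
      rw [← hσX]
      exact (hσd.differentiableAt (Metric.ball_mem_nhds 0 hR₀)).hasDerivAt
    have hF' : HasFDerivAt F (fderiv ℂ F z) (σ 0) := by
      rw [hσ0]; exact (pBergman_differentiableAt hΩo hF hz).hasFDerivAt
    have hg' : HasFDerivAt g (fderiv ℂ g z) (σ 0) := by
      rw [hσ0]; exact (pBergman_differentiableAt hΩo hg.mem hz).hasFDerivAt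
    have h := (hF'.comp_hasDerivAt 0 hσ').div (hg'.comp_hasDerivAt 0 hσ')
      (by simp [hσ0, hg.eq_one])
    have h2 := h.deriv
    simp only [Function.comp_apply, hσ0, hg.eq_one] at h2
    rw [quotDeriv]
    refine Eq.trans ?_ (h2.trans (by simp))
    rfl
  have hGM : ∀ t ∈ Metric.ball (0 : ℂ) R, ‖G t‖ ≤ 2 * C * N₂ := fun t ht => by
    have h1 := hev F hF _ (hRb t ht).1
    have h2 := hlow _ (hRb t ht).1
    rw [hG, norm_div, div_le_iff₀ (by linarith)]
    have : 0 ≤ C * N₂ := by positivity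
    nlinarith
  refine ⟨hGd, hGder, ?_, fun t ht => ?_⟩
  · have h1 := Complex.norm_deriv_le_div_of_mapsTo_ball hGd (R₂ := 2 * (2 * C * N₂))
      (fun t ht => ?_) hR
    · rw [← hGder]
      refine h1.trans ?_
      calc 2 * (2 * C * N₂) / R = 2 * (2 * C) / R * N₂ := by ring
        _ ≤ C' * N₂ := by gcongr; exact le_max_left _ _
    · rw [Metric.mem_closedBall, dist_eq_norm]
      linarith [norm_sub_le (G t) (G 0), hGM t ht, hGM 0 (Metric.mem_ball_self hR)]
  obtain ⟨h1, h2⟩ := norm_sub_taylor_le hR hGd hGM (t := t) (by simpa using ht)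
  rw [hG0] at h1 h2
  rw [hGder] at h2
  constructor
  · refine h1.trans ?_
    calc 2 * (2 * C * N₂) / R * ‖t‖ = 2 * (2 * C) / R * N₂ * ‖t‖ := by ring
      _ ≤ C' * N₂ * ‖t‖ := by gcongr; exact le_max_left _ _
  · refine h2.trans ?_
    calc 4 * (2 * C * N₂) / R ^ 2 * ‖t‖ ^ 2 = 4 * (2 * C) / R ^ 2 * N₂ * ‖t‖ ^ 2 := by ring
      _ ≤ C' * N₂ * ‖t‖ ^ 2 := by gcongr; exact le_max_right _ _

lemma quotDeriv_add (hΩo : IsOpen Ω) (hz : z ∈ Ω) {F G : (Fin n → ℂ) → ℂ}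
    (hF : F ∈ pBergmanSpace Ω p) (hG : G ∈ pBergmanSpace Ω p) :
    quotDeriv g z X (F + G) = quotDeriv g z X F + quotDeriv g z X G := by
  unfold quotDeriv
  rw [fderiv_add (pBergman_differentiableAt hΩo hF hz) (pBergman_differentiableAt hΩo hG hz)]
  simp
  ring

lemma quotDeriv_smul (hΩo : IsOpen Ω) (hz : z ∈ Ω) (c : ℂ) {F : (Fin n → ℂ) → ℂ}
    (hF : F ∈ pBergmanSpace Ω p) :
    quotDeriv g z X (c • F) = c * quotDeriv g z X F := by
  unfold quotDeriv
  rw [fderiv_const_smul (pBergman_differentiableAt hΩo hF hz)]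
  simp
  ring

lemma IsMinimizer.quotDeriv_self (hg : IsMinimizer Ω p z g) : quotDeriv g z X g = 0 := by
  simp [quotDeriv, hg.eq_one]

end Disc

/-! ### Second-order behaviour of `log m_p` along rays -/

section Rays

variable {n : ℕ} {Ω : Set (Fin n → ℂ)} {p : ℝ} {z X : Fin n → ℂ} {g : (Fin n → ℂ) → ℂ}

lemma integrable_inner_of_memLp {α : Type*} [MeasurableSpace α] {π : Measure α} {x y : α → ℂ}
    (hx : MemLp x 2 π) (hy : MemLp y 2 π) : Integrable (fun a => inner ℝ (x a) (y a)) π :=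
  Integrable.mono' (hx.norm.integrable_mul hy.norm) (hx.1.inner hy.1)
    (Eventually.of_forall fun _ => norm_inner_le_norm _ _)

lemma pBergmanMin_pos (hΩo : IsOpen Ω) (hΩb : Bornology.IsBounded Ω) (hp : 1 ≤ p)
    {w : Fin n → ℂ} (hw : w ∈ Ω) : 0 < pBergmanMin Ω p w := by
  obtain ⟨δ, hδ, hb⟩ := exists_ball_subset hΩo hw
  obtain ⟨C, hC, hev⟩ := _root_.exists_eval_bound hΩo hΩb hp hδ
  refine lt_of_lt_of_le (inv_pos.2 hC) (le_pBergmanMin hΩo hΩb (by linarith) fun F hF h1 => ?_)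
  have := hev F hF w hb
  rw [h1, norm_one] at this
  rwa [inv_le_iff_one_le_mul₀' hC]

/-- `log m_p(z) - log m_p(w) - log |g(w)|`. For `g` holomorphic and nonvanishing, its second-order
behaviour on circle averages is that of `(log K_p) / p`. -/
def logMinDefect (Ω : Set (Fin n → ℂ)) (p : ℝ) (g : (Fin n → ℂ) → ℂ) (z w : Fin n → ℂ) : ℝ :=
  Real.log (pBergmanMin Ω p z) - Real.log (pBergmanMin Ω p w) - Real.log ‖g w‖

lemma IsMinimizer.logMinDefect_le_of_representer (hΩo : IsOpen Ω) (hΩc : IsConnected Ω)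
    (hΩb : Bornology.IsBounded Ω) (hp : 2 ≤ p) (hz : z ∈ Ω) (hg : IsMinimizer Ω p z g)
    {w : Fin n → ℂ} (hgw : g w ≠ 0) {y : (Fin n → ℂ) → ℂ}
    (hy : MemLp y 2 (bergmanMeasure Ω p g))
    (hrep : ∀ F ∈ pBergmanSpace Ω p,
      ∫ x, inner ℝ (y x) (F x / g x) ∂(bergmanMeasure Ω p g) = (F w / g w - F z).re) :
    p * logMinDefect Ω p g z w ≤
      (p - 1) * ∫ x, powRem (p / (p - 1)) (y x) ∂(bergmanMeasure Ω p g) := by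
  have hp0 : 0 < p := by linarith
  have hgz : g z ≠ 0 := by rw [hg.eq_one]; exact one_ne_zero
  have hN := pBergmanNorm_pos hΩo hΩb (by linarith) hg.mem hz hgz
  have hprob := isProbabilityMeasure_bergmanMeasure hp0 hg.mem hN
  refine hg.log_min_le_of_representer hΩo hΩc hΩb hp hz hgw hy fun F hF => ?_
  have hx := memLp_two_of_max (memLp_quot hΩo hp hg.mem hF)
  have hx1 : Integrable (fun x => F x / g x) (bergmanMeasure Ω p g) := hx.integrable (by norm_num)
  have h1 : ∀ x, inner ℝ (1 + y x) (F x / g x) = (F x / g x).re + inner ℝ (y x) (F x / g x) := by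
    intro x
    rw [inner_add_left]
    congr 1
    simp [Complex.inner]
  have h2 : Integrable (fun x => (F x / g x).re) (bergmanMeasure Ω p g) := hx1.re
  have h3 : ∫ x, (F x / g x).re ∂(bergmanMeasure Ω p g) = (F z).re := by
    have := integral_re hx1
    rw [hg.integral_quot hΩo hΩc hΩb hp hz hF] at this
    exact this
  simp_rw [h1]
  rw [integral_add h2 (integrable_inner_of_memLp hy hx), h3, hrep F hF, Complex.sub_re]
  ring

lemma isHolDisc_line (hΩo : IsOpen Ω) (hz : z ∈ Ω) (X : Fin n → ℂ) :
    IsHolDisc Ω z X (fun t => z + t • X) := by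
  have hc : Continuous fun t : ℂ => z + t • X := by fun_prop
  have hpre : (fun t : ℂ => z + t • X) ⁻¹' Ω ∈ 𝓝 (0 : ℂ) :=
    hc.continuousAt.preimage_mem_nhds (by simpa using hΩo.mem_nhds hz)
  obtain ⟨r, hr, hb⟩ := Metric.mem_nhds_iff.1 hpre
  refine ⟨r, hr, by fun_prop, hb, by simp, ?_⟩
  have : HasDerivAt (fun t : ℂ => z + t • X) X 0 := by
    simpa using ((hasDerivAt_id (0 : ℂ)).smul_const X).const_add z
  exact this.deriv

lemma IsMinimizer.logMinDefect_nonneg (hΩo : IsOpen Ω) (hΩb : Bornology.IsBounded Ω)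
    (hp : 1 ≤ p) (hg : IsMinimizer Ω p z g) {w : Fin n → ℂ} (hw : w ∈ Ω)
    (hgw : g w ≠ 0) : 0 ≤ logMinDefect Ω p g z w := by
  have hp0 : 0 < p := by linarith
  have hm := pBergmanMin_pos hΩo hΩb hp hw
  have h := pBergmanMin_mul_le hΩo hp0 hg.mem w
  rw [← hg.pBergmanMin_eq hΩo hΩb hp0] at h
  have hgp := norm_pos_iff.2 hgw
  have h2 := Real.log_le_log (mul_pos hm hgp) h
  rw [Real.log_mul hm.ne' hgp.ne'] at h2
  unfold logMinDefect
  linarith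

lemma exists_integral_powRem_le {s : ℝ} (hs1 : 1 ≤ s) (hs2 : s ≤ 2) :
    ∃ C > 0, ∀ {α : Type} [MeasurableSpace α] (π : Measure α) [IsFiniteMeasure π] (y : α → ℂ),
      MemLp y 2 π → ∫ a, powRem s (y a) ∂π ≤ C * ∫ a, ‖y a‖ ^ 2 ∂π := by
  obtain ⟨C, hC, hb⟩ := exists_powRem_bound hs1
  refine ⟨2 * C, by positivity, fun π _ y hy => ?_⟩
  rw [← integral_const_mul]
  refine integral_mono (integrable_powRem hs1 (by rw [max_eq_right hs2]; simpa using hy))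
    ((integrable_norm_sq hy).const_mul _) fun a => ?_
  have := (le_abs_self _).trans (hb (y a))
  rw [max_eq_right hs2, Real.rpow_two] at this
  simp only
  linarith

/-- The defect is at most of second order along holomorphic discs. -/
lemma IsMinimizer.exists_logMinDefect_le (hΩo : IsOpen Ω) (hΩc : IsConnected Ω)
    (hΩb : Bornology.IsBounded Ω) (hp : 2 ≤ p) (hz : z ∈ Ω) (hg : IsMinimizer Ω p z g)
    {σ : ℂ → (Fin n → ℂ)} (hσ : IsHolDisc Ω z X σ) :
    ∃ R > 0, ∃ C, ∀ t : ℂ, ‖t‖ < R → p * logMinDefect Ω p g z (σ t) ≤ C * ‖t‖ ^ 2 := by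
  have hp0 : 0 < p := by linarith
  have hgz : g z ≠ 0 := by rw [hg.eq_one]; exact one_ne_zero
  have hN := pBergmanNorm_pos hΩo hΩb (by linarith) hg.mem hz hgz
  have hprob := isProbabilityMeasure_bergmanMeasure hp0 hg.mem hN
  obtain ⟨R, hR, C, hC, -, -, hgne, hF⟩ := hg.exists_disc_bound hΩo hp hz hN hσ
  obtain ⟨hq1, hq2⟩ := conjExponent_bounds hp
  obtain ⟨A, hA, hAb⟩ := exists_integral_powRem_le hq1.le hq2
  refine ⟨R, hR, (p - 1) * (A * C ^ 2), fun t ht => ?_⟩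
  have ht' : t ∈ Metric.ball (0 : ℂ) R := by simpa using ht
  obtain ⟨c, hc, hcrep, hcn, -⟩ := exists_representer hΩo hΩb hp hg.mem hN
    (ContinuousLinearMap.id ℝ ℂ) (fun x => le_rfl)
    (fun F => (F (σ t) / g (σ t) - F z).re)
    (fun F _ G _ => by simp only [Pi.add_apply, ← Complex.add_re]; congr 1; ring)
    (fun a F _ => by
      rw [← Complex.re_ofReal_mul]
      simp only [Pi.smul_apply, Complex.real_smul]
      congr 1; ring)
    (C := C * ‖t‖) (by positivity)
    (fun F hFm => by
      refine (Complex.abs_re_le_norm _).trans (((hF F hFm).2.2.2 t ht').1.trans (le_of_eq ?_))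
      ring)
  refine (hg.logMinDefect_le_of_representer hΩo hΩc hΩb hp hz (hgne t ht') hc hcrep).trans ?_
  have h1 := hAb _ c hc
  have h2 : A * ∫ x, ‖c x‖ ^ 2 ∂(bergmanMeasure Ω p g) ≤ A * (C * ‖t‖) ^ 2 := by gcongr
  have h3 := mul_le_mul_of_nonneg_left (h1.trans h2) (by linarith : (0 : ℝ) ≤ p - 1)
  refine h3.trans (le_of_eq ?_)
  ring

/-- The functional `F ↦ Re (e · (F/g)'(z; X))` is represented in the stretched `L²` space. -/
lemma IsMinimizer.exists_direction_representer (hΩo : IsOpen Ω)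
    (hΩb : Bornology.IsBounded Ω) (hp : 2 ≤ p) (hz : z ∈ Ω) (hg : IsMinimizer Ω p z g)
    (X : Fin n → ℂ) (e : ℂ) :
    ∃ ξ : (Fin n → ℂ) → ℂ, MemLp ξ 2 (bergmanMeasure Ω p g) ∧
      (∀ F ∈ pBergmanSpace Ω p, ∫ x, inner ℝ (ξ x) (stretch p (F x / g x)) ∂(bergmanMeasure Ω p g)
        = (e * quotDeriv g z X F).re) ∧
      ∀ ε > 0, ∃ F ∈ pBergmanSpace Ω p,
        ∫ x, ‖ξ x - stretch p (F x / g x)‖ ^ 2 ∂(bergmanMeasure Ω p g) < ε := by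
  have hp0 : 0 < p := by linarith
  have hgz : g z ≠ 0 := by rw [hg.eq_one]; exact one_ne_zero
  have hN := pBergmanNorm_pos hΩo hΩb (by linarith) hg.mem hz hgz
  obtain ⟨R, hR, C, hC, -, -, hgne, hF⟩ :=
    hg.exists_disc_bound hΩo hp hz hN (isHolDisc_line hΩo hz X)
  obtain ⟨ξ, h1, h2, -, h3⟩ := exists_representer hΩo hΩb hp hg.mem hN
    (stretch p) (norm_le_norm_stretch hp)
    (fun F => (e * quotDeriv g z X F).re)
    (fun F hF G hG => by rw [quotDeriv_add hΩo hz hF hG, mul_add, Complex.add_re])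
    (fun a F hF => by
      have : a • F = (a : ℂ) • F := by ext; simp
      rw [this, quotDeriv_smul hΩo hz _ hF, ← Complex.re_ofReal_mul]
      congr 1; ring)
    (C := ‖e‖ * C) (by positivity)
    (fun F hFm => by
      refine (Complex.abs_re_le_norm _).trans ?_
      rw [norm_mul, mul_assoc]
      exact mul_le_mul_of_nonneg_left (hF F hFm).2.2.1 (norm_nonneg _))
  exact ⟨ξ, h1, h2, h3⟩

/-- Upper bound for the defect along a ray. The representer of evaluation at `σ (r e)` is, up to
second order, `1 + r · stretch ξ`; the second-order error is split off by convexity. -/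
lemma IsMinimizer.logMinDefect_upper (hΩo : IsOpen Ω) (hΩc : IsConnected Ω)
    (hΩb : Bornology.IsBounded Ω) (hp : 2 ≤ p) (hz : z ∈ Ω) (hg : IsMinimizer Ω p z g)
    {σ : ℂ → (Fin n → ℂ)} (hσ : IsHolDisc Ω z X σ) {e : ℂ} (he : ‖e‖ = 1)
    {ξ : (Fin n → ℂ) → ℂ} (hξ : MemLp ξ 2 (bergmanMeasure Ω p g))
    (hξrep : ∀ F ∈ pBergmanSpace Ω p,
      ∫ x, inner ℝ (ξ x) (stretch p (F x / g x)) ∂(bergmanMeasure Ω p g)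
        = (e * quotDeriv g z X F).re) {ε : ℝ} (hε : 0 < ε) :
    ∀ᶠ r : ℝ in 𝓝[>] 0, p * logMinDefect Ω p g z (σ (r * e)) ≤
      (p / 2 * ∫ x, ‖ξ x‖ ^ 2 ∂(bergmanMeasure Ω p g) + ε) * r ^ 2 := by
  have hp0 : 0 < p := by linarith
  have hp1 : 0 < p - 1 := by linarith
  have hgz : g z ≠ 0 := by rw [hg.eq_one]; exact one_ne_zero
  have hN := pBergmanNorm_pos hΩo hΩb (by linarith) hg.mem hz hgz
  have hprob := isProbabilityMeasure_bergmanMeasure hp0 hg.mem hN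
  obtain ⟨R, hR, C, hC, -, -, hgne, hF⟩ := hg.exists_disc_bound hΩo hp hz hN hσ
  obtain ⟨hq1, hq2⟩ := conjExponent_bounds hp
  obtain ⟨A, hA, hAb⟩ := exists_integral_powRem_le hq1.le hq2
  set π := bergmanMeasure Ω p g with hπ
  set q := p / (p - 1) with hq
  set y : (Fin n → ℂ) → ℂ := fun x => stretch p (ξ x) with hy
  have hyL : MemLp y 2 π := (stretch p).comp_memLp' hξ
  have hymax : MemLp y (ENNReal.ofReal (max q 2)) π := by
    rw [max_eq_right hq2]; simpa using hyL
  set Q := ∫ x, powQuad q (y x) ∂π with hQ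
  have hQeq : (p - 1) * Q = p / 2 * ∫ x, ‖ξ x‖ ^ 2 ∂π := by
    rw [hQ, ← integral_const_mul, ← integral_const_mul]
    exact integral_congr_ae (Eventually.of_forall fun x => powQuad_conj_stretch hp (ξ x))
  set ε' := ε / (2 * (p - 1)) with hε'
  have hε'0 : 0 < ε' := by positivity
  have hwt : Tendsto (fun r : ℝ => (((1 - r)⁻¹ * r : ℝ) : ℂ)) (𝓝[>] 0) (𝓝 0) := by
    have : ContinuousAt (fun r : ℝ => (((1 - r)⁻¹ * r : ℝ) : ℂ)) 0 := by
      refine Complex.continuous_ofReal.continuousAt.comp ?_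
      exact ((continuousAt_const.sub continuousAt_id).inv₀ (by simp)).mul continuousAt_id
    have h := this.tendsto
    simp only [sub_zero, inv_one, mul_zero, Complex.ofReal_zero] at h
    exact h.mono_left nhdsWithin_le_nhds
  have hexp := hwt.eventually ((integral_powRem_isLittleO hq1.le hymax).def hε'0)
  have hsmall : ∀ᶠ r : ℝ in 𝓝[>] 0,
      (p - 1) * ((1 - r)⁻¹ * (Q + ε') + r * (A * C ^ 2)) < (p - 1) * Q + ε := by
    have hcont : ContinuousAt (fun r : ℝ => (p - 1) * ((1 - r)⁻¹ * (Q + ε') + r * (A * C ^ 2)))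
        0 := by
      refine continuousAt_const.mul (ContinuousAt.add ?_ (continuousAt_id.mul continuousAt_const))
      exact ((continuousAt_const.sub continuousAt_id).inv₀ (by simp)).mul continuousAt_const
    have h := hcont.tendsto.mono_left (nhdsWithin_le_nhds (s := Set.Ioi (0 : ℝ)))
    refine h.eventually_lt_const ?_
    have : (p - 1) * ε' = ε / 2 := by rw [hε']; field_simp
    simp only [sub_zero, inv_one, one_mul, zero_mul, add_zero]
    rw [mul_add, this]
    linarith
  have hrange : ∀ᶠ r : ℝ in 𝓝[>] 0, r ∈ Set.Ioo 0 (min R 1) :=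
    Ioo_mem_nhdsGT (by positivity)
  filter_upwards [hexp, hsmall, hrange] with r hr1 hr2 ⟨hr0, hrR⟩
  have hrR' : r < R := hrR.trans_le (min_le_left _ _)
  have hrlt1 : r < 1 := hrR.trans_le (min_le_right _ _)
  have hnorm : ‖(r : ℂ) * e‖ = r := by rw [norm_mul, he, mul_one, Complex.norm_of_nonneg hr0.le]
  have ht' : (r : ℂ) * e ∈ Metric.ball (0 : ℂ) R := by
    rw [Metric.mem_ball, dist_zero_right, hnorm]; exact hrR'
  set t : ℂ := (r : ℂ) * e with ht
  obtain ⟨c, hc, hcrep, hcn, -⟩ := exists_representer hΩo hΩb hp hg.mem hN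
    (ContinuousLinearMap.id ℝ ℂ) (fun x => le_rfl)
    (fun F => (r ^ 2)⁻¹ * (F (σ t) / g (σ t) - F z - t * quotDeriv g z X F).re)
    (fun F hF G hG => by
      rw [quotDeriv_add hΩo hz hF hG, ← mul_add, ← Complex.add_re]
      simp only [Pi.add_apply]
      congr 2; ring)
    (fun a F hF => by
      have : a • F = (a : ℂ) • F := by ext; simp
      rw [this, quotDeriv_smul hΩo hz _ hF, mul_left_comm a]
      refine congrArg ((r ^ 2)⁻¹ * ·) ?_
      rw [← Complex.re_ofReal_mul]
      simp only [Pi.smul_apply, smul_eq_mul]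
      congr 1; ring)
    (C := C) hC.le
    (fun F hFm => by
      have h1 := (Complex.abs_re_le_norm _).trans ((hF F hFm).2.2.2 t ht').2
      rw [hnorm] at h1
      rw [abs_mul, abs_of_pos (by positivity : 0 < (r ^ 2)⁻¹), inv_mul_le_iff₀ (by positivity)]
      linarith)
  have hcL : MemLp (fun x => (r : ℂ) * c x) 2 π := hc.const_mul _
  set Y : (Fin n → ℂ) → ℂ := fun x => (r : ℂ) * y x + (r ^ 2 : ℝ) * c x with hY
  have hYL : MemLp Y 2 π := (hyL.const_mul _).add (hc.const_mul _)
  have hrep : ∀ F ∈ pBergmanSpace Ω p,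
      ∫ x, inner ℝ (Y x) (F x / g x) ∂π = (F (σ t) / g (σ t) - F z).re := by
    intro F hFm
    have hx := memLp_two_of_max (memLp_quot hΩo hp hg.mem hFm)
    have h1 : ∀ x, inner ℝ (Y x) (F x / g x) =
        r * inner ℝ (ξ x) (stretch p (F x / g x)) + r ^ 2 * inner ℝ (c x) (F x / g x) := by
      intro x
      rw [inner_stretch, hY]
      simp only
      rw [inner_add_left, ← Complex.real_smul, ← Complex.real_smul, real_inner_smul_left,
        real_inner_smul_left]
    simp_rw [h1]
    have h2 := hcrep F hFm
    simp only [ContinuousLinearMap.id_apply] at h2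
    have hS : MemLp (fun x => stretch p (F x / g x)) 2 π := (stretch p).comp_memLp' hx
    rw [integral_add ((integrable_inner_of_memLp hξ hS).const_mul _)
      ((integrable_inner_of_memLp hc hx).const_mul _), integral_const_mul, integral_const_mul,
      hξrep F hFm, h2, ← mul_assoc, mul_inv_cancel₀ (by positivity), one_mul,
      ← Complex.re_ofReal_mul, ← Complex.add_re]
    congr 1
    rw [ht]
    ring
  have hmain := hg.logMinDefect_le_of_representer hΩo hΩc hΩb hp hz (hgne t ht') hYL hrep
  rw [← hq, ← hπ] at hmain
  have h1r : 0 < 1 - r := by linarith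
  -- the two parts of the convexity estimate
  have hpart1 : ∫ x, powRem q ((((1 - r)⁻¹ * r : ℝ) : ℂ) * y x) ∂π ≤
      ((1 - r)⁻¹ * r) ^ 2 * (Q + ε') := by
    have h1 : ∫ x, powQuad q ((((1 - r)⁻¹ * r : ℝ) : ℂ) * y x) ∂π = ((1 - r)⁻¹ * r) ^ 2 * Q := by
      rw [hQ, ← integral_const_mul]
      refine integral_congr_ae (Eventually.of_forall fun x => ?_)
      simp only [powQuad]
      rw [norm_mul, Complex.re_ofReal_mul, mul_pow, mul_pow, Complex.norm_real, Real.norm_eq_abs,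
        sq_abs]
      ring
    have h2 : ‖‖(((1 - r)⁻¹ * r : ℝ) : ℂ)‖ ^ 2‖ = ((1 - r)⁻¹ * r) ^ 2 := by
      rw [norm_pow, norm_norm, Complex.norm_real, Real.norm_eq_abs, sq_abs]
    rw [h1, h2, Real.norm_eq_abs] at hr1
    have := (le_abs_self _).trans hr1
    linarith
  have hpart2 : ∫ x, powRem q ((r : ℂ) * c x) ∂π ≤ A * (r ^ 2 * C ^ 2) := by
    refine (hAb π _ hcL).trans ?_
    have h1 : ∫ x, ‖(r : ℂ) * c x‖ ^ 2 ∂π = r ^ 2 * ∫ x, ‖c x‖ ^ 2 ∂π := by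
      rw [← integral_const_mul]
      refine integral_congr_ae (Eventually.of_forall fun x => ?_)
      simp only [norm_mul, mul_pow, Complex.norm_of_nonneg hr0.le]
    rw [h1]
    gcongr
  have hint1 : Integrable (fun x => powRem q ((((1 - r)⁻¹ * r : ℝ) : ℂ) * y x)) π :=
    integrable_powRem hq1.le (hymax.const_mul _)
  have hint2 : Integrable (fun x => powRem q ((r : ℂ) * c x)) π :=
    integrable_powRem hq1.le (by rw [max_eq_right hq2]; simpa using hcL)
  have hconv : ∫ x, powRem q (Y x) ∂π ≤
      (1 - r) * ∫ x, powRem q ((((1 - r)⁻¹ * r : ℝ) : ℂ) * y x) ∂π +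
        r * ∫ x, powRem q ((r : ℂ) * c x) ∂π := by
    rw [← integral_const_mul, ← integral_const_mul,
      ← integral_add (hint1.const_mul _) (hint2.const_mul _)]
    refine integral_mono (integrable_powRem hq1.le (by rw [max_eq_right hq2]; simpa using hYL))
      ((hint1.const_mul _).add (hint2.const_mul _)) fun x => ?_
    refine (powRem_add_le hq1.le hr0 hrlt1 _ _).trans (le_of_eq ?_)
    have hrc : (r : ℂ) ≠ 0 := by exact_mod_cast hr0.ne'
    congr 3
    · push_cast; ring_nf
    · push_cast
      field_simp
  have hfin : ∫ x, powRem q (Y x) ∂π ≤ r ^ 2 * ((1 - r)⁻¹ * (Q + ε') + r * (A * C ^ 2)) := by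
    refine hconv.trans ?_
    calc _ ≤ (1 - r) * (((1 - r)⁻¹ * r) ^ 2 * (Q + ε')) + r * (A * (r ^ 2 * C ^ 2)) := by gcongr
      _ = _ := by field_simp
  refine hmain.trans ((mul_le_mul_of_nonneg_left hfin hp1.le).trans ?_)
  rw [← hQeq]
  have := mul_le_mul_of_nonneg_left hr2.le (sq_nonneg r)
  linarith

/-- Removing the mean does not increase the stretched `L²` norm. -/
lemma integral_norm_stretch_sub_le {α : Type*} [MeasurableSpace α] {π : Measure α}
    [IsProbabilityMeasure π] {x : α → ℂ} (hx : MemLp x 2 π) {c : ℂ} (hc : ∫ a, x a ∂π = c) :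
    ∫ a, ‖stretch p (x a - c)‖ ^ 2 ∂π ≤ ∫ a, ‖stretch p (x a)‖ ^ 2 ∂π := by
  have hxc : MemLp (fun a => x a - c) 2 π := hx.sub (memLp_const c)
  have hS : MemLp (fun a => stretch p (x a - c)) 2 π := (stretch p).comp_memLp' hxc
  have hS1 : Integrable (fun a => stretch p (x a - c)) π := hS.integrable (by norm_num)
  have hx1 : Integrable x π := hx.integrable (by norm_num)
  have h0 : ∫ a, stretch p (x a - c) ∂π = 0 := by
    rw [(stretch p).integral_comp_comm (hxc.integrable (by norm_num)),
      integral_sub hx1 (integrable_const _), hc]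
    simp
  have hI : Integrable (fun a => inner ℝ (stretch p c) (stretch p (x a - c))) π :=
    hS1.const_inner _
  have h1 : ∫ a, inner ℝ (stretch p c) (stretch p (x a - c)) ∂π = 0 := by
    rw [integral_inner hS1, h0, inner_zero_right]
  have h2 : ∀ a, ‖stretch p (x a)‖ ^ 2 = ‖stretch p (x a - c)‖ ^ 2 +
      (2 * inner ℝ (stretch p c) (stretch p (x a - c)) + ‖stretch p c‖ ^ 2) := by
    intro a
    have h3 : stretch p (x a) = stretch p c + stretch p (x a - c) := by rw [← map_add]; simp
    rw [h3, norm_add_sq_real]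
    ring
  have h4 : Integrable (fun a => 2 * inner ℝ (stretch p c) (stretch p (x a - c)) +
      ‖stretch p c‖ ^ 2) π := (hI.const_mul 2).add (integrable_const _)
  simp_rw [h2]
  rw [integral_add (integrable_norm_sq hS) h4,
    integral_add (hI.const_mul 2) (integrable_const _), integral_const_mul, h1]
  simp

/-- Lower bound for the defect along a ray, from the test functions `g + r h`. -/
lemma IsMinimizer.logMinDefect_lower (hΩo : IsOpen Ω) (hΩc : IsConnected Ω)
    (hΩb : Bornology.IsBounded Ω) (hp : 2 ≤ p) (hz : z ∈ Ω) (hg : IsMinimizer Ω p z g)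
    {σ : ℂ → (Fin n → ℂ)} (hσ : IsHolDisc Ω z X σ) {e : ℂ} (he : ‖e‖ = 1)
    {ξ : (Fin n → ℂ) → ℂ} (hξ : MemLp ξ 2 (bergmanMeasure Ω p g))
    (hξrep : ∀ F ∈ pBergmanSpace Ω p,
      ∫ x, inner ℝ (ξ x) (stretch p (F x / g x)) ∂(bergmanMeasure Ω p g)
        = (e * quotDeriv g z X F).re)
    (hξcl : ∀ ε > 0, ∃ F ∈ pBergmanSpace Ω p,
        ∫ x, ‖ξ x - stretch p (F x / g x)‖ ^ 2 ∂(bergmanMeasure Ω p g) < ε)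
    {ε : ℝ} (hε : 0 < ε) :
    ∀ᶠ r : ℝ in 𝓝[>] 0, (p / 2 * ∫ x, ‖ξ x‖ ^ 2 ∂(bergmanMeasure Ω p g) - ε) * r ^ 2 ≤
      p * logMinDefect Ω p g z (σ (r * e)) := by
  have hp0 : 0 < p := by linarith
  have hgz : g z ≠ 0 := by rw [hg.eq_one]; exact one_ne_zero
  have hN := pBergmanNorm_pos hΩo hΩb (by linarith) hg.mem hz hgz
  have hNp : 0 < pBergmanNorm Ω p g ^ p := Real.rpow_pos_of_pos hN _
  have hnull := pBergman_ae_ne_zero hΩo hΩc hg.mem hz hgz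
  have hprob := isProbabilityMeasure_bergmanMeasure hp0 hg.mem hN
  obtain ⟨R, hR, C, hC, -, hmapΩ, hgne, hF⟩ := hg.exists_disc_bound hΩo hp hz hN hσ
  set π := bergmanMeasure Ω p g with hπ
  obtain ⟨h₀, hh₀, hh₀d⟩ := hξcl (ε / p) (by positivity)
  have hx₀ := memLp_two_of_max (memLp_quot hΩo hp hg.mem hh₀)
  set h := h₀ - h₀ z • g with hh
  have hhm : h ∈ pBergmanSpace Ω p :=
    pBergman_sub hΩo hp0 hh₀ (pBergman_smul hΩo hp0 _ hg.mem)
  have hhz : h z = 0 := by simp [hh, hg.eq_one]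
  have hxh := memLp_quot hΩo hp hg.mem hhm
  set A := (e * quotDeriv g z X h).re with hA
  have hAeq : A = (e * quotDeriv g z X h₀).re := by
    have h1 : h = h₀ + (-(h₀ z)) • g := by rw [hh]; ext; simp; ring
    rw [hA, h1, quotDeriv_add hΩo hz hh₀ (pBergman_smul hΩo hp0 _ hg.mem),
      quotDeriv_smul hΩo hz _ hg.mem, hg.quotDeriv_self, mul_zero, add_zero]
  set Q := ∫ x, powQuad p (h x / g x) ∂π with hQ
  have hQle : Q ≤ p / 2 * ∫ x, ‖stretch p (h₀ x / g x)‖ ^ 2 ∂π := by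
    have h1 : Q = p / 2 * ∫ x, ‖stretch p (h₀ x / g x - h₀ z)‖ ^ 2 ∂π := by
      rw [hQ, ← integral_const_mul]
      refine integral_congr_ae ?_
      filter_upwards [ae_bergmanMeasure_ne_zero hΩo hp0 hg.mem] with x hx
      rw [powQuad_eq hp]
      congr 4
      simp only [hh, Pi.sub_apply, Pi.smul_apply, smul_eq_mul]
      field_simp
    rw [h1]
    refine mul_le_mul_of_nonneg_left ?_ (by positivity)
    exact integral_norm_stretch_sub_le hx₀ (hg.integral_quot hΩo hΩc hΩb hp hz hh₀)
  -- completing the square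
  have hval : p / 2 * ∫ x, ‖ξ x‖ ^ 2 ∂π - ε / 2 ≤ p * A - Q := by
    have hS : MemLp (fun x => stretch p (h₀ x / g x)) 2 π := (stretch p).comp_memLp' hx₀
    have hin := integrable_inner_of_memLp hξ hS
    have h1 : ∫ x, ‖ξ x - stretch p (h₀ x / g x)‖ ^ 2 ∂π =
        ∫ x, ‖ξ x‖ ^ 2 ∂π - 2 * A + ∫ x, ‖stretch p (h₀ x / g x)‖ ^ 2 ∂π := by
      have h2 : Integrable (fun x => ‖ξ x‖ ^ 2 - 2 * inner ℝ (ξ x) (stretch p (h₀ x / g x))) π :=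
        (integrable_norm_sq hξ).sub (hin.const_mul 2)
      simp_rw [norm_sub_sq_real]
      rw [integral_add h2 (integrable_norm_sq hS),
        integral_sub (integrable_norm_sq hξ) (hin.const_mul 2), integral_const_mul,
        hξrep h₀ hh₀, hAeq]
    rw [h1] at hh₀d
    rw [lt_div_iff₀ hp0] at hh₀d
    linarith
  set N₂ := Real.sqrt (∫ x, ‖h x / g x‖ ^ 2 ∂π) with hN₂
  have hN₂0 : 0 ≤ N₂ := Real.sqrt_nonneg _
  have hrt : Tendsto (fun r : ℝ => (r : ℂ)) (𝓝[>] 0) (𝓝 0) := by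
    have := Complex.continuous_ofReal.tendsto (0 : ℝ)
    rw [Complex.ofReal_zero] at this
    exact this.mono_left nhdsWithin_le_nhds
  have hexp := hrt.eventually ((integral_powRem_isLittleO (by linarith : (1 : ℝ) ≤ p) hxh).def
    (by positivity : 0 < ε / 4))
  have hsmall : ∀ᶠ r : ℝ in 𝓝[>] 0,
      p * (C * N₂ * r + (C * N₂) ^ 2 * r ^ 2) < ε / 4 ∧ C * N₂ * r ^ 2 < 1 / 2 := by
    have hc1 : Continuous fun r : ℝ => p * (C * N₂ * r + (C * N₂) ^ 2 * r ^ 2) := by fun_prop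
    have hc2 : Continuous fun r : ℝ => C * N₂ * r ^ 2 := by fun_prop
    refine ((hc1.tendsto 0).mono_left nhdsWithin_le_nhds).eventually_lt_const ?_ |>.and
      (((hc2.tendsto 0).mono_left nhdsWithin_le_nhds).eventually_lt_const ?_)
    · simpa using hε
    · simp
  have hrange : ∀ᶠ r : ℝ in 𝓝[>] 0, r ∈ Set.Ioo 0 R := Ioo_mem_nhdsGT hR
  filter_upwards [hexp, hsmall, hrange] with r hr1 ⟨hr2, hr3⟩ ⟨hr0, hrR⟩
  have hnorm : ‖(r : ℂ) * e‖ = r := by rw [norm_mul, he, mul_one, Complex.norm_of_nonneg hr0.le]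
  have ht' : (r : ℂ) * e ∈ Metric.ball (0 : ℂ) R := by
    rw [Metric.mem_ball, dist_zero_right, hnorm]; exact hrR
  set t : ℂ := (r : ℂ) * e with ht
  obtain ⟨hT1, hT2⟩ := (hF h hhm).2.2.2 t ht'
  rw [hhz, sub_zero, hnorm] at hT1 hT2
  set u : ℂ := (r : ℂ) * (h (σ t) / g (σ t)) with hu
  have hun : ‖u‖ ≤ C * N₂ * r ^ 2 := by
    rw [hu, norm_mul, Complex.norm_of_nonneg hr0.le]
    calc r * ‖h (σ t) / g (σ t)‖ ≤ r * (C * N₂ * r) := by gcongr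
      _ = _ := by ring
  have hure : r ^ 2 * A - C * N₂ * r ^ 3 ≤ u.re := by
    have h1 : u.re - r ^ 2 * A = r * (h (σ t) / g (σ t) - t * quotDeriv g z X h).re := by
      rw [hu, Complex.re_ofReal_mul, Complex.sub_re, hA, ht, mul_assoc, Complex.re_ofReal_mul]
      ring
    have h2 := (Complex.abs_re_le_norm _).trans hT2
    have h3 := (abs_le.1 h2).1
    have h4 : -(C * N₂ * r ^ 3) ≤ r * (h (σ t) / g (σ t) - t * quotDeriv g z X h).re := by
      have := mul_le_mul_of_nonneg_left h3 hr0.le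
      calc -(C * N₂ * r ^ 3) = r * -(C * N₂ * r ^ 2) := by ring
        _ ≤ _ := this
    linarith
  have hu1 : ‖u‖ < 1 := by linarith
  have hlogu : u.re - ‖u‖ ^ 2 ≤ Real.log ‖1 + u‖ := by
    have h1 := Complex.norm_log_one_add_sub_self_le hu1
    have h2 := (Complex.abs_re_le_norm _).trans h1
    rw [Complex.sub_re, Complex.log_re] at h2
    have h3 := (abs_le.1 h2).1
    have h4 : (1 - ‖u‖)⁻¹ ≤ 2 := by
      rw [inv_le_comm₀ (by linarith) two_pos]
      linarith
    nlinarith [sq_nonneg ‖u‖]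
  have h1u : 1 + u ≠ 0 := by
    intro h0
    have : ‖u‖ = 1 := by rw [eq_neg_of_add_eq_zero_right h0, norm_neg, norm_one]
    linarith
  -- the test function
  set F := g + (r : ℂ) • h with hFdef
  have hFm : F ∈ pBergmanSpace Ω p := pBergman_add hΩo hp0 hg.mem (pBergman_smul hΩo hp0 _ hhm)
  have hgt := hgne t ht'
  have hFσ : F (σ t) = g (σ t) * (1 + u) := by
    simp only [hFdef, hu, Pi.add_apply, Pi.smul_apply, smul_eq_mul]
    field_simp
  set I := ∫ x, powRem p ((r : ℂ) * (h x / g x)) ∂π with hI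
  have hFn : pBergmanNorm Ω p F ^ p = pBergmanNorm Ω p g ^ p * (1 + I) := by
    rw [hFdef, pBergmanNorm_add_smul_rpow hΩo hp hg.mem hN hnull hhm,
      hg.integral_quot hΩo hΩc hΩb hp hz hhm, hhz]
    simp [hI, hπ]
  have hwΩ : σ t ∈ Ω := hmapΩ ht'
  have hm := pBergmanMin_pos hΩo hΩb (by linarith : (1 : ℝ) ≤ p) hwΩ
  have hle := pBergmanMin_mul_le hΩo hp0 hFm (σ t)
  rw [hFσ, norm_mul] at hle
  have hgp := norm_pos_iff.2 hgt
  have hup := norm_pos_iff.2 h1u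
  have hFpos : 0 < pBergmanNorm Ω p F := lt_of_lt_of_le (by positivity) hle
  have hlog := Real.log_le_log (by positivity) hle
  rw [Real.log_mul hm.ne' (by positivity), Real.log_mul hgp.ne' hup.ne'] at hlog
  have h1I : 0 < 1 + I := by
    have := Real.rpow_pos_of_pos hFpos p
    rw [hFn] at this
    exact (mul_pos_iff_of_pos_left hNp).1 this
  have hlogF : p * Real.log (pBergmanNorm Ω p F) ≤ p * Real.log (pBergmanNorm Ω p g) + I := by
    rw [← Real.log_rpow hFpos, hFn, Real.log_mul hNp.ne' h1I.ne', Real.log_rpow hN]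
    have := Real.log_le_sub_one_of_pos h1I
    linarith
  have hIle : I ≤ r ^ 2 * (Q + ε / 4) := by
    have h1 : ∫ x, powQuad p ((r : ℂ) * (h x / g x)) ∂π = r ^ 2 * Q := by
      rw [hQ, ← integral_const_mul]
      refine integral_congr_ae (Eventually.of_forall fun x => ?_)
      simp only [powQuad]
      rw [norm_mul, Complex.re_ofReal_mul, mul_pow, mul_pow, Complex.norm_real, Real.norm_eq_abs,
        sq_abs]
      ring
    rw [h1, norm_pow, norm_norm, Complex.norm_of_nonneg hr0.le] at hr1
    have := (le_abs_self _).trans hr1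
    linarith
  unfold logMinDefect
  rw [hg.pBergmanMin_eq hΩo hΩb hp0]
  have hu2 : ‖u‖ ^ 2 ≤ (C * N₂ * r ^ 2) ^ 2 := by gcongr
  have hr2' : p * (C * N₂ * r + (C * N₂) ^ 2 * r ^ 2) * r ^ 2 ≤ ε / 4 * r ^ 2 := by gcongr
  have hval' := mul_le_mul_of_nonneg_right hval (sq_nonneg r)
  have hlow : p * (r ^ 2 * A - C * N₂ * r ^ 3 - (C * N₂ * r ^ 2) ^ 2) ≤ p * Real.log ‖1 + u‖ :=
    mul_le_mul_of_nonneg_left (by linarith) hp0.le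
  have hlogp := mul_le_mul_of_nonneg_left hlog hp0.le
  linarith

end Rays

/-! ### Circle averages -/

section CircleAverages

lemma circleIntegrable_of_measurable_of_bound {u : ℂ → ℝ} {r : ℝ} {C : ℝ}
    (hm : AEStronglyMeasurable (fun θ => u (circleMap 0 r θ)) volume)
    (hb : ∀ t ∈ Metric.sphere (0 : ℂ) |r|, |u t| ≤ C) : CircleIntegrable u 0 r := by
  unfold CircleIntegrable
  rw [intervalIntegrable_iff]
  refine Measure.integrableOn_of_bounded (M := C) measure_Ioc_lt_top.ne hm ?_
  exact Eventually.of_forall fun θ => hb _ (circleMap_mem_sphere' 0 r θ)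

lemma circleMap_zero_eq (r θ : ℝ) : circleMap 0 r θ = r * circleMap 0 1 θ := by
  simp [circleMap]

/-- If `u` is `O(|t|²)` and has second-order radial limits `q` at `0`, then its circle averages,
divided by `r²`, tend to the mean of `q` over the unit circle. -/
lemma tendsto_circleAverage_div_sq {u q : ℂ → ℝ} {R C : ℝ} (hR : 0 < R)
    (hm : ∀ r ∈ Set.Ioo 0 R, AEStronglyMeasurable (fun θ => u (circleMap 0 r θ)) volume)
    (hb : ∀ t : ℂ, ‖t‖ < R → |u t| ≤ C * ‖t‖ ^ 2)
    (hq : ∀ e : ℂ, ‖e‖ = 1 → Tendsto (fun r : ℝ => u (r * e) / r ^ 2) (𝓝[>] 0) (𝓝 (q e))) :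
    Tendsto (fun r => Real.circleAverage u 0 r / r ^ 2) (𝓝[>] 0)
      (𝓝 (Real.circleAverage q 0 1)) := by
  have h : Tendsto (fun r : ℝ => ∫ θ in 0..2 * Real.pi, u (circleMap 0 r θ) / r ^ 2) (𝓝[>] 0)
      (𝓝 (∫ θ in 0..2 * Real.pi, q (circleMap 0 1 θ))) := by
    have hev : ∀ᶠ r : ℝ in 𝓝[>] 0, r ∈ Set.Ioo 0 R := Ioo_mem_nhdsGT hR
    refine intervalIntegral.tendsto_integral_filter_of_dominated_convergence (fun _ => C) ?_ ?_
      intervalIntegrable_const ?_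
    · filter_upwards [hev] with r hr
      simp_rw [div_eq_mul_inv]
      exact ((hm r hr).mul_const _).restrict
    · filter_upwards [hev] with r hr
      refine Eventually.of_forall fun θ _ => ?_
      have h1 := hb (circleMap 0 r θ) (by simpa [abs_of_pos hr.1] using hr.2)
      rw [norm_circleMap_zero, sq_abs] at h1
      rw [Real.norm_eq_abs, abs_div, abs_of_nonneg (sq_nonneg r), div_le_iff₀ (pow_pos hr.1 2)]
      exact h1
    · refine Eventually.of_forall fun θ _ => ?_
      refine (hq (circleMap 0 1 θ) (by simp)).congr fun r => ?_
      rw [← circleMap_zero_eq]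
  have h2 := h.const_mul (2 * Real.pi)⁻¹
  refine h2.congr fun r => ?_
  rw [Real.circleAverage_def, intervalIntegral.integral_div, smul_eq_mul, mul_div_assoc]

lemma circleAverage_re_of_differentiableOn {φ : ℂ → ℂ} {R : ℝ}
    (hφ : DifferentiableOn ℂ φ (Metric.ball 0 R)) {r : ℝ} (hr : r ∈ Set.Ioo 0 R) :
    CircleIntegrable (fun t => (φ t).re) 0 r ∧
      Real.circleAverage (fun t => (φ t).re) 0 r = (φ 0).re := by
  have hsub : Metric.closedBall (0 : ℂ) |r| ⊆ Metric.ball 0 R :=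
    Metric.closedBall_subset_ball (by rw [abs_of_pos hr.1]; exact hr.2)
  have hint : CircleIntegrable φ 0 r :=
    ContinuousOn.circleIntegrable' (hφ.continuousOn.mono
      (Metric.sphere_subset_closedBall.trans hsub))
  have hd : DiffContOnCl ℂ φ (Metric.ball 0 |r|) := by
    refine DifferentiableOn.diffContOnCl ?_
    exact hφ.mono (Metric.closure_ball_subset_closedBall.trans hsub)
  have h1 : Real.circleAverage (Complex.reCLM ∘ φ) 0 r = (φ 0).re := by
    rw [Complex.reCLM.circleAverage_comp_comm hint, hd.circleAverage]
    rfl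
  refine ⟨?_, h1⟩
  have hc : ContinuousOn (fun t => (φ t).re) (Metric.sphere 0 |r|) :=
    Complex.continuous_re.comp_continuousOn (hφ.continuousOn.mono
      (Metric.sphere_subset_closedBall.trans hsub))
  exact hc.circleIntegrable'

lemma circleAverage_log_norm_of_differentiableOn {φ : ℂ → ℂ} {R : ℝ}
    (hφ : DifferentiableOn ℂ φ (Metric.ball 0 R)) (h0 : ∀ t ∈ Metric.ball (0 : ℂ) R, φ t ≠ 0)
    {r : ℝ} (hr : r ∈ Set.Ioo 0 R) :
    CircleIntegrable (fun t => Real.log ‖φ t‖) 0 r ∧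
      Real.circleAverage (fun t => Real.log ‖φ t‖) 0 r = Real.log ‖φ 0‖ := by
  have hsub : Metric.closedBall (0 : ℂ) |r| ⊆ Metric.ball 0 R :=
    Metric.closedBall_subset_ball (by rw [abs_of_pos hr.1]; exact hr.2)
  have ha : AnalyticOnNhd ℂ φ (Metric.closedBall 0 |r|) := fun t ht =>
    hφ.analyticAt (Metric.isOpen_ball.mem_nhds (hsub ht))
  refine ⟨?_, ha.circleAverage_log_norm_of_ne_zero fun t ht => h0 t (hsub ht)⟩
  have hc : ContinuousOn (fun t => Real.log ‖φ t‖) (Metric.sphere 0 |r|) :=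
    ContinuousOn.log ((hφ.continuousOn.mono (Metric.sphere_subset_closedBall.trans hsub)).norm)
      fun t ht => norm_ne_zero_iff.2 (h0 t (hsub (Metric.sphere_subset_closedBall ht)))
  exact hc.circleIntegrable'

end CircleAverages

/-! ### Semicontinuity of the extremal quantities -/

section Semicontinuity

variable {n : ℕ} {Ω : Set (Fin n → ℂ)} {p : ℝ} {z X : Fin n → ℂ} {g : (Fin n → ℂ) → ℂ}

/-- `m_p` is locally an infimum of the continuous functions `‖F‖_p / |F|`. -/
lemma upperSemicontinuousAt_pBergmanMin (hΩo : IsOpen Ω) (hΩb : Bornology.IsBounded Ω)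
    (hp : 0 < p) {w : Fin n → ℂ} (hw : w ∈ Ω) :
    UpperSemicontinuousAt (pBergmanMin Ω p) w := by
  intro a ha
  have hne : {s | ∃ f ∈ pBergmanSpace Ω p, f w = 1 ∧ s = pBergmanNorm Ω p f}.Nonempty :=
    ⟨_, _, pBergman_one_mem hΩo hΩb hp, rfl, rfl⟩
  obtain ⟨_, ⟨F, hF, h1, rfl⟩, hFa⟩ := exists_lt_of_csInf_lt hne ha
  have hc : ContinuousAt (fun ζ => a * ‖F ζ‖) w :=
    continuousAt_const.mul (pBergman_differentiableAt hΩo hF hw).continuousAt.norm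
  have hlt : pBergmanNorm Ω p F < a * ‖F w‖ := by rw [h1, norm_one, mul_one]; exact hFa
  filter_upwards [hc.eventually_const_lt hlt] with ζ hζ
  have hle := (pBergmanMin_mul_le hΩo hp hF ζ).trans_lt hζ
  exact lt_of_mul_lt_mul_right hle (norm_nonneg _)

/-- `sup {|Yf(w)| : f ∈ A^p, f(w) = 0, ‖f‖_p = 1}`, the second factor of the metric `B_p`. -/
def pBergmanDerivSup (Ω : Set (Fin n → ℂ)) (p : ℝ) (w Y : Fin n → ℂ) : ℝ :=
  sSup {s | ∃ f ∈ pBergmanSpace Ω p, f w = 0 ∧ pBergmanNorm Ω p f = 1 ∧ s = ‖fderiv ℂ f w Y‖}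

lemma pBergmanDerivSup_nonneg (w Y : Fin n → ℂ) : 0 ≤ pBergmanDerivSup Ω p w Y := by
  refine Real.sSup_nonneg ?_
  rintro _ ⟨F, -, -, -, rfl⟩
  exact norm_nonneg _

lemma exists_pBergmanDerivSup_le (hΩo : IsOpen Ω) (hΩb : Bornology.IsBounded Ω) (hp : 1 ≤ p)
    {δ : ℝ} (hδ : 0 < δ) : ∃ C > 0, ∀ w Y, Metric.ball w δ ⊆ Ω →
      (∀ s ∈ {s | ∃ f ∈ pBergmanSpace Ω p, f w = 0 ∧ pBergmanNorm Ω p f = 1 ∧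
        s = ‖fderiv ℂ f w Y‖}, s ≤ C * ‖Y‖) ∧ pBergmanDerivSup Ω p w Y ≤ C * ‖Y‖ := by
  obtain ⟨C, hC, h⟩ := exists_fderiv_bound hΩo hΩb hp hδ
  refine ⟨C, hC, fun w Y hw => ?_⟩
  have hb : ∀ s ∈ {s | ∃ f ∈ pBergmanSpace Ω p, f w = 0 ∧ pBergmanNorm Ω p f = 1 ∧
      s = ‖fderiv ℂ f w Y‖}, s ≤ C * ‖Y‖ := by
    rintro _ ⟨F, hF, -, h1, rfl⟩
    have h2 := h F hF w hw
    rw [h1, mul_one] at h2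
    exact ((fderiv ℂ F w).le_opNorm Y).trans (by gcongr)
  exact ⟨hb, Real.sSup_le hb (by positivity)⟩

lemma norm_fderiv_le_pBergmanDerivSup (hΩo : IsOpen Ω) (hΩb : Bornology.IsBounded Ω)
    (hp : 1 ≤ p) {w : Fin n → ℂ} (hw : w ∈ Ω) (Y : Fin n → ℂ) {F : (Fin n → ℂ) → ℂ}
    (hF : F ∈ pBergmanSpace Ω p) (h0 : F w = 0) (hN : 0 < pBergmanNorm Ω p F) :
    ‖fderiv ℂ F w Y‖ ≤ pBergmanDerivSup Ω p w Y * pBergmanNorm Ω p F := by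
  have hp0 : 0 < p := by linarith
  obtain ⟨δ, hδ, hb⟩ := exists_ball_subset hΩo hw
  obtain ⟨C, -, hC⟩ := exists_pBergmanDerivSup_le hΩo hΩb hp hδ
  set N := pBergmanNorm Ω p F with hNdef
  set G := ((N⁻¹ : ℝ) : ℂ) • F with hG
  have hGN : pBergmanNorm Ω p G = 1 := by
    rw [hG, pBergmanNorm_smul hp0, Complex.norm_of_nonneg (inv_nonneg.2 hN.le),
      inv_mul_cancel₀ hN.ne']
  have hle : ‖fderiv ℂ G w Y‖ ≤ pBergmanDerivSup Ω p w Y :=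
    le_csSup ⟨_, (hC w Y hb).1⟩ ⟨G, pBergman_smul hΩo hp0 _ hF, by simp [hG, h0], hGN, rfl⟩
  rw [hG, fderiv_const_smul (pBergman_differentiableAt hΩo hF hw)] at hle
  simp only [_root_.smul_apply, smul_eq_mul, norm_mul,
    Complex.norm_of_nonneg (inv_nonneg.2 hN.le)] at hle
  rwa [inv_mul_le_iff₀ hN, mul_comm] at hle

lemma pBergmanNorm_add_le (hΩo : IsOpen Ω) (hp : 1 ≤ p) {F G : (Fin n → ℂ) → ℂ}
    (hF : F ∈ pBergmanSpace Ω p) (hG : G ∈ pBergmanSpace Ω p) :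
    pBergmanNorm Ω p (F + G) ≤ pBergmanNorm Ω p F + pBergmanNorm Ω p G := by
  have hp0 : 0 < p := by linarith
  have h := eLpNorm_add_le (p := ENNReal.ofReal p) ((mem_pBergmanSpace_iff hΩo hp0).1 hF).2.1
    ((mem_pBergmanSpace_iff hΩo hp0).1 hG).2.1 (by simpa using hp)
  rw [eLpNorm_eq_ofReal_pBergmanNorm hΩo hp0 hF, eLpNorm_eq_ofReal_pBergmanNorm hΩo hp0 hG,
    eLpNorm_eq_ofReal_pBergmanNorm hΩo hp0 (pBergman_add hΩo hp0 hF hG),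
    ← ENNReal.ofReal_add (pBergmanNorm_nonneg _) (pBergmanNorm_nonneg _)] at h
  exact (ENNReal.ofReal_le_ofReal_iff
    (add_nonneg (pBergmanNorm_nonneg _) (pBergmanNorm_nonneg _))).1 h

lemma pBergmanNorm_pos_of_fderiv (hΩo : IsOpen Ω) (hΩb : Bornology.IsBounded Ω) (hp : 1 ≤ p)
    {H : (Fin n → ℂ) → ℂ} (hH : H ∈ pBergmanSpace Ω p) {w Y : Fin n → ℂ} (hw : w ∈ Ω)
    (hd : 0 < ‖fderiv ℂ H w Y‖) : 0 < pBergmanNorm Ω p H := by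
  by_contra hcon
  have hz : pBergmanNorm Ω p H = 0 := le_antisymm (not_lt.1 hcon) (pBergmanNorm_nonneg _)
  obtain ⟨δ, hδ, hb⟩ := exists_ball_subset hΩo hw
  obtain ⟨C, -, hC⟩ := exists_fderiv_bound hΩo hΩb hp hδ
  have h2 := hC H hH w hb
  rw [hz, mul_zero] at h2
  have h3 := (fderiv ℂ H w).le_opNorm Y
  nlinarith [norm_nonneg Y]

/-- Cauchy's estimate for `x ↦ F(x + v) - F(x)` gives continuity of the derivative. -/
lemma continuousAt_fderiv (hΩo : IsOpen Ω) {F : (Fin n → ℂ) → ℂ} (hF : DifferentiableOn ℂ F Ω)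
    {w : Fin n → ℂ} (hw : w ∈ Ω) : ContinuousAt (fderiv ℂ F) w := by
  obtain ⟨δ, hδ, hb⟩ := Metric.nhds_basis_closedBall.mem_iff.1 (hΩo.mem_nhds hw)
  have huc := (isCompact_closedBall w δ).uniformContinuousOn_of_continuous
    (hF.continuousOn.mono hb)
  rw [Metric.uniformContinuousOn_iff] at huc
  rw [Metric.continuousAt_iff]
  intro ε hε
  obtain ⟨η, hη, hη'⟩ := huc (ε * δ / 8) (by positivity)
  refine ⟨min η (δ / 2), by positivity, fun {x} hx => ?_⟩
  have hxη := hx.trans_le (min_le_left _ _)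
  have hxδ := hx.trans_le (min_le_right _ _)
  rw [dist_eq_norm] at hxη hxδ
  have hmem : ∀ y ∈ Metric.ball w (δ / 2), y ∈ Metric.closedBall w δ ∧
      y + (x - w) ∈ Metric.closedBall w δ := by
    intro y hy
    rw [Metric.mem_ball, dist_eq_norm] at hy
    rw [Metric.mem_closedBall, Metric.mem_closedBall, dist_eq_norm, dist_eq_norm]
    refine ⟨by linarith, ?_⟩
    have : y + (x - w) - w = (y - w) + (x - w) := by abel
    rw [this]
    linarith [norm_add_le (y - w) (x - w)]
  have hdF : ∀ y ∈ Ω, DifferentiableAt ℂ F y := fun y hy => hF.differentiableAt (hΩo.mem_nhds hy)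
  have hd : ∀ y ∈ Metric.ball w (δ / 2),
      DifferentiableAt ℂ (fun y => F (y + (x - w)) - F y) y := fun y hy =>
    (DifferentiableAt.comp (f := fun y => y + (x - w)) y (hdF _ (hb (hmem y hy).2))
      (by fun_prop)).sub (hdF _ (hb (hmem y hy).1))
  have hbound := norm_fderiv_le_of_bound (f := fun y => F (y + (x - w)) - F y) (ζ := w)
    (half_pos hδ) (fun y hy => (hd y hy).differentiableWithinAt) (C := ε * δ / 8) fun y hy => by
      rw [← dist_eq_norm]
      refine (hη' _ (hmem y hy).2 _ (hmem y hy).1 ?_).le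
      rw [dist_eq_norm, add_sub_cancel_left]
      exact hxη
  have h0 := hmem w (Metric.mem_ball_self (half_pos hδ))
  have hshift : fderiv ℂ (fun y => F (y + (x - w))) w = fderiv ℂ F x := by
    rw [fderiv_comp_add_right]
    congr 1
    abel
  have hdS : DifferentiableAt ℂ (fun y => F (y + (x - w))) w :=
    DifferentiableAt.comp (f := fun y => y + (x - w)) w (hdF _ (hb h0.2)) (by fun_prop)
  rw [fderiv_fun_sub hdS (hdF _ hw), hshift] at hbound
  rw [dist_eq_norm]
  refine hbound.trans_lt ?_
  have : 2 * (ε * δ / 8) / (δ / 2) = ε / 2 := by field_simp; ring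
  linarith

/-- Joint lower semicontinuity in the point and the direction: an almost extremal function at one
point gives competitors at nearby points after subtracting a constant. -/
lemma lowerSemicontinuousAt_pBergmanDerivSup (hΩo : IsOpen Ω) (hΩb : Bornology.IsBounded Ω)
    (hp : 1 ≤ p) {w : Fin n → ℂ} (hw : w ∈ Ω) (Y : Fin n → ℂ) :
    LowerSemicontinuousAt (fun x : (Fin n → ℂ) × (Fin n → ℂ) => pBergmanDerivSup Ω p x.1 x.2)
      (w, Y) := by
  have hp0 : 0 < p := by linarith
  intro a ha
  simp only at ha
  rcases lt_or_ge a 0 with ha0 | ha0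
  · exact Eventually.of_forall fun x => ha0.trans_le (pBergmanDerivSup_nonneg _ _)
  have hne : {s | ∃ f ∈ pBergmanSpace Ω p, f w = 0 ∧ pBergmanNorm Ω p f = 1 ∧
      s = ‖fderiv ℂ f w Y‖}.Nonempty := by
    by_contra hne
    rw [Set.not_nonempty_iff_eq_empty] at hne
    rw [pBergmanDerivSup, hne, Real.sSup_empty] at ha
    exact absurd ha0 (not_le.2 ha)
  obtain ⟨_, ⟨F, hF, h0, h1, rfl⟩, hFa⟩ := exists_lt_of_lt_csSup hne ha
  have hone := pBergman_one_mem hΩo hΩb hp0 (p := p)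
  set N₁ := pBergmanNorm Ω p (fun _ => 1) with hN₁
  -- the competitors at nearby points are `F - F(x)`
  have hd1 : ContinuousAt (fun x : (Fin n → ℂ) × (Fin n → ℂ) => fderiv ℂ F x.1) (w, Y) := by
    exact ContinuousAt.comp (f := Prod.fst) (continuousAt_fderiv hΩo hF.1 hw) continuousAt_fst
  have hd2 : ContinuousAt (fun x : (Fin n → ℂ) × (Fin n → ℂ) => ‖fderiv ℂ F x.1 x.2‖) (w, Y) :=
    (hd1.clm_apply continuousAt_snd).norm
  have hF1 : ContinuousAt (fun x : (Fin n → ℂ) × (Fin n → ℂ) => F x.1) (w, Y) :=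
    ContinuousAt.comp (f := Prod.fst) (pBergman_differentiableAt hΩo hF hw).continuousAt
      continuousAt_fst
  have hc : ContinuousAt (fun x : (Fin n → ℂ) × (Fin n → ℂ) =>
      ‖fderiv ℂ F x.1 x.2‖ - a * (1 + ‖F x.1‖ * N₁)) (w, Y) :=
    hd2.sub (continuousAt_const.mul (continuousAt_const.add (hF1.norm.mul continuousAt_const)))
  have hpos : 0 < ‖fderiv ℂ F w Y‖ - a * (1 + ‖F w‖ * N₁) := by
    rw [h0, norm_zero, zero_mul, add_zero, mul_one]; linarith
  have hmem : ∀ᶠ x : (Fin n → ℂ) × (Fin n → ℂ) in 𝓝 (w, Y), x.1 ∈ Ω :=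
    continuousAt_fst.eventually (hΩo.mem_nhds hw)
  filter_upwards [hc.eventually_const_lt hpos, hmem] with x hx hxΩ
  set H : (Fin n → ℂ) → ℂ := F + (-F x.1) • (fun _ => (1 : ℂ)) with hH
  have hHm : H ∈ pBergmanSpace Ω p := pBergman_add hΩo hp0 hF (pBergman_smul hΩo hp0 _ hone)
  have hH0 : H x.1 = 0 := by simp [hH]
  have hHN : pBergmanNorm Ω p H ≤ 1 + ‖F x.1‖ * N₁ := by
    refine (pBergmanNorm_add_le hΩo hp hF (pBergman_smul hΩo hp0 _ hone)).trans (le_of_eq ?_)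
    rw [h1, pBergmanNorm_smul hp0, norm_neg]
  have hHd : fderiv ℂ H x.1 = fderiv ℂ F x.1 := by
    have : H = fun y => F y + (-F x.1) := by ext y; simp [hH]
    rw [this, fderiv_add_const]
  have hdpos : 0 < ‖fderiv ℂ H x.1 x.2‖ := by
    rw [hHd]
    have : 0 ≤ a * (1 + ‖F x.1‖ * N₁) :=
      mul_nonneg ha0 (by have := pBergmanNorm_nonneg (Ω := Ω) (p := p) (fun _ => 1); positivity)
    linarith
  have hNpos := pBergmanNorm_pos_of_fderiv hΩo hΩb hp hHm hxΩ hdpos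
  have hle := norm_fderiv_le_pBergmanDerivSup hΩo hΩb hp hxΩ x.2 hHm hH0 hNpos
  have h4 : a * pBergmanNorm Ω p H ≤ a * (1 + ‖F x.1‖ * N₁) := by gcongr
  rw [hHd] at hle
  refine lt_of_mul_lt_mul_right (lt_of_lt_of_le ?_ hle) hNpos.le
  linarith

lemma measurable_pBergmanMin_comp (hΩo : IsOpen Ω) (hΩb : Bornology.IsBounded Ω) (hp : 0 < p)
    {γ : ℝ → (Fin n → ℂ)} (hγ : Continuous γ) (hγΩ : ∀ θ, γ θ ∈ Ω) :
    Measurable fun θ => pBergmanMin Ω p (γ θ) := by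
  have : UpperSemicontinuous fun θ => pBergmanMin Ω p (γ θ) := fun θ =>
    (upperSemicontinuousAt_pBergmanMin hΩo hΩb hp (hγΩ θ)).comp hγ.continuousAt
  exact this.measurable

lemma measurable_pBergmanDerivSup_comp (hΩo : IsOpen Ω) (hΩb : Bornology.IsBounded Ω)
    (hp : 1 ≤ p) {γ η : ℝ → (Fin n → ℂ)} (hγ : Continuous γ) (hη : Continuous η)
    (hγΩ : ∀ θ, γ θ ∈ Ω) : Measurable fun θ => pBergmanDerivSup Ω p (γ θ) (η θ) := by
  have : LowerSemicontinuous fun θ => pBergmanDerivSup Ω p (γ θ) (η θ) := fun θ =>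
    LowerSemicontinuousAt.comp (g := fun θ => (γ θ, η θ))
      (lowerSemicontinuousAt_pBergmanDerivSup hΩo hΩb hp (hγΩ θ) (η θ))
      (hγ.prodMk hη).continuousAt
  exact this.measurable

end Semicontinuity

/-! ### The generalized Levi form of `log K_p` -/

section LeviForm

variable {n : ℕ} {Ω : Set (Fin n → ℂ)} {p : ℝ} {z X : Fin n → ℂ} {g : (Fin n → ℂ) → ℂ}

/-- The circle averages of the defect along holomorphic discs through `z` in the direction `X` are
integrals proper, and their second-order limit does not depend on the disc. -/
lemma IsMinimizer.exists_tendsto_circleAverage_defect (hΩo : IsOpen Ω) (hΩc : IsConnected Ω)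
    (hΩb : Bornology.IsBounded Ω) (hp : 2 ≤ p) (hz : z ∈ Ω) (hg : IsMinimizer Ω p z g)
    (X : Fin n → ℂ) :
    ∃ L : ℝ, ∀ σ : ℂ → (Fin n → ℂ), IsHolDisc Ω z X σ →
      (∃ R > 0, ∀ r ∈ Set.Ioo 0 R, CircleIntegrable (fun t => p * logMinDefect Ω p g z (σ t)) 0 r) ∧
      Tendsto (fun r => Real.circleAverage (fun t => p * logMinDefect Ω p g z (σ t)) 0 r / r ^ 2)
        (𝓝[>] 0) (𝓝 L) := by
  have hp0 : 0 < p := by linarith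
  have hgz : g z ≠ 0 := by rw [hg.eq_one]; exact one_ne_zero
  have hN := pBergmanNorm_pos hΩo hΩb (by linarith) hg.mem hz hgz
  choose ξ hξ hξrep hξcl using fun e => hg.exists_direction_representer hΩo hΩb hp hz X e
  refine ⟨Real.circleAverage (fun e => p / 2 * ∫ x, ‖ξ e x‖ ^ 2 ∂(bergmanMeasure Ω p g)) 0 1,
    fun σ hσ => ?_⟩
  obtain ⟨R₁, hR₁, C₁, -, hσd, hσΩ, hgne, -⟩ := hg.exists_disc_bound hΩo hp hz hN hσ
  obtain ⟨R₂, hR₂, C, hC⟩ := hg.exists_logMinDefect_le hΩo hΩc hΩb hp hz hσ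
  set u : ℂ → ℝ := fun t => p * logMinDefect Ω p g z (σ t) with hu
  set R := min R₁ R₂ with hR
  have hR0 : 0 < R := lt_min hR₁ hR₂
  have hball : ∀ t : ℂ, ‖t‖ < R → t ∈ Metric.ball (0 : ℂ) R₁ := fun t ht => by
    simpa using ht.trans_le (min_le_left _ _)
  have hb : ∀ t : ℂ, ‖t‖ < R → |u t| ≤ C * ‖t‖ ^ 2 := fun t ht => by
    rw [hu, abs_of_nonneg]
    · exact hC t (ht.trans_le (min_le_right _ _))
    · exact mul_nonneg hp0.le (hg.logMinDefect_nonneg hΩo hΩb (by linarith) (hσΩ (hball t ht))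
        (hgne t (hball t ht)))
  have hcirc : ∀ r ∈ Set.Ioo 0 R, ∀ θ, circleMap 0 r θ ∈ Metric.ball (0 : ℂ) R₁ :=
    fun r hr θ => hball _ (by simpa [abs_of_pos hr.1] using hr.2)
  have hm : ∀ r ∈ Set.Ioo 0 R, AEStronglyMeasurable (fun θ => u (circleMap 0 r θ)) volume := by
    intro r hr
    have hγ : Continuous fun θ => σ (circleMap 0 r θ) :=
      hσd.continuousOn.comp_continuous (continuous_circleMap 0 r) (hcirc r hr)
    have hγΩ : ∀ θ, σ (circleMap 0 r θ) ∈ Ω := fun θ => hσΩ (hcirc r hr θ)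
    have hm1 := (measurable_pBergmanMin_comp hΩo hΩb hp0 hγ hγΩ).log
    have hm2 : Measurable fun θ => Real.log ‖g (σ (circleMap 0 r θ))‖ :=
      (hg.mem.1.continuousOn.comp_continuous hγ hγΩ).norm.measurable.log
    exact (((measurable_const.sub hm1).sub hm2).const_mul p).aestronglyMeasurable
  have hC0 : 0 ≤ C * R ^ 2 := by
    have h1 := (abs_nonneg _).trans (hb ((R / 2 : ℝ) : ℂ) (by
      rw [Complex.norm_of_nonneg (by positivity)]; linarith))
    rw [Complex.norm_of_nonneg (by positivity)] at h1
    nlinarith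
  refine ⟨⟨R, hR0, fun r hr => ?_⟩, ?_⟩
  · refine circleIntegrable_of_measurable_of_bound (C := C * r ^ 2) (hm r hr) fun t ht => ?_
    have ht' : ‖t‖ = r := by simpa [abs_of_pos hr.1] using ht
    have := hb t (by rw [ht']; exact hr.2)
    rwa [ht'] at this
  · refine tendsto_circleAverage_div_sq hR0 hm hb fun e he => ?_
    rw [Metric.tendsto_nhds]
    intro ε hε
    have hpos : ∀ᶠ r : ℝ in 𝓝[>] 0, r ∈ Set.Ioi (0 : ℝ) := self_mem_nhdsWithin
    filter_upwards [hpos,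
      hg.logMinDefect_upper hΩo hΩc hΩb hp hz hσ he (hξ e) (hξrep e) (half_pos hε),
      hg.logMinDefect_lower hΩo hΩc hΩb hp hz hσ he (hξ e) (hξrep e) (hξcl e) (half_pos hε)]
      with r hr h1 h2
    have hr2 : 0 < r ^ 2 := pow_pos hr 2
    rw [← div_le_iff₀ hr2] at h1
    rw [← le_div_iff₀ hr2] at h2
    rw [Real.dist_eq, abs_lt]
    constructor <;> linarith

lemma log_pBergmanKernel (hΩo : IsOpen Ω) (hΩb : Bornology.IsBounded Ω) (hp : 1 ≤ p)
    {w : Fin n → ℂ} (hw : w ∈ Ω) :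
    Real.log (pBergmanKernel Ω p w) = -p * Real.log (pBergmanMin Ω p w) := by
  rw [pBergmanKernel, Real.log_rpow (pBergmanMin_pos hΩo hΩb hp hw)]

/-- The Levi form of `log K_p` is the common second-order limit of the averaged defects: along a
disc, `log K_p - p · defect` is the harmonic function `p log |g ∘ σ|` up to a constant. -/
lemma IsMinimizer.genLeviForm_eq (hΩo : IsOpen Ω)
    (hΩb : Bornology.IsBounded Ω) (hp : 2 ≤ p) (hz : z ∈ Ω) (hg : IsMinimizer Ω p z g) {L R : ℝ}
    (hR : 0 < R) (hint : ∀ r ∈ Set.Ioo 0 R,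
      CircleIntegrable (fun t : ℂ => p * logMinDefect Ω p g z (z + t • X)) 0 r)
    (hlim : Tendsto (fun r =>
      Real.circleAverage (fun t : ℂ => p * logMinDefect Ω p g z (z + t • X)) 0 r / r ^ 2)
        (𝓝[>] 0) (𝓝 L)) :
    genLeviForm (fun ζ => Real.log (pBergmanKernel Ω p ζ)) z X = (L : EReal) := by
  have hp0 : 0 < p := by linarith
  have hgz : g z ≠ 0 := by rw [hg.eq_one]; exact one_ne_zero
  have hN := pBergmanNorm_pos hΩo hΩb (by linarith) hg.mem hz hgz
  obtain ⟨R₁, hR₁, -, -, hσd, hσΩ, hgne, -⟩ :=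
    hg.exists_disc_bound hΩo hp hz hN (isHolDisc_line hΩo hz X)
  have hφd : DifferentiableOn ℂ (fun t : ℂ => g (z + t • X)) (Metric.ball 0 R₁) :=
    hg.mem.1.comp hσd hσΩ
  unfold genLeviForm genLaplacian
  refine Tendsto.liminf_eq ((continuous_coe_real_ereal.tendsto L).comp (hlim.congr' ?_))
  have hev : ∀ᶠ r : ℝ in 𝓝[>] 0, r ∈ Set.Ioo 0 (min R R₁) :=
    Ioo_mem_nhdsGT (lt_min hR hR₁)
  filter_upwards [hev] with r hr
  have hrR : r ∈ Set.Ioo 0 R := ⟨hr.1, hr.2.trans_le (min_le_left _ _)⟩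
  have hrR₁ : r ∈ Set.Ioo 0 R₁ := ⟨hr.1, hr.2.trans_le (min_le_right _ _)⟩
  obtain ⟨hgi, hga⟩ := circleAverage_log_norm_of_differentiableOn hφd hgne hrR₁
  have h0 : Real.log ‖g (z + (0 : ℂ) • X)‖ = 0 := by simp [hg.eq_one]
  rw [h0] at hga
  have hcongr : Set.EqOn (fun t : ℂ => Real.log (pBergmanKernel Ω p (z + t • X)))
      (fun t : ℂ => Real.log (pBergmanKernel Ω p z) +
        (p * logMinDefect Ω p g z (z + t • X) + p • Real.log ‖g (z + t • X)‖))
      (Metric.sphere 0 |r|) := by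
    intro t ht
    have ht' : t ∈ Metric.ball (0 : ℂ) R₁ := by
      have : ‖t‖ = r := by simpa [abs_of_pos hr.1] using ht
      rw [Metric.mem_ball, dist_zero_right, this]
      exact hrR₁.2
    simp only [logMinDefect, smul_eq_mul]
    rw [log_pBergmanKernel hΩo hΩb (by linarith) (hσΩ ht'),
      log_pBergmanKernel hΩo hΩb (by linarith) hz]
    ring
  have hgi' : CircleIntegrable (fun t : ℂ => p • Real.log ‖g (z + t • X)‖) 0 r :=
    hgi.const_smul
  have hsum : CircleIntegrable (fun t : ℂ => p * logMinDefect Ω p g z (z + t • X) +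
      p • Real.log ‖g (z + t • X)‖) 0 r := (hint r hrR).add hgi'
  rw [Real.circleAverage_congr_sphere hcongr,
    Real.circleAverage_fun_add (circleIntegrable_const _ _ _) hsum,
    Real.circleAverage_fun_add (hint r hrR) hgi', Real.circleAverage_const,
    Real.circleAverage_fun_smul, hga]
  simp

end LeviForm

/-! ### The extremal function for the derivative -/

section DerivExtremal

variable {n : ℕ} {Ω : Set (Fin n → ℂ)} {p : ℝ} {z X : Fin n → ℂ} {g : (Fin n → ℂ) → ℂ}

/-- The supremum defining `pBergmanDerivSup` is attained and positive: normalize a function of least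
norm among those with `F(z) = 0` and `XF(z) = 1`. -/
lemma exists_derivExtremal (hΩo : IsOpen Ω) (hΩb : Bornology.IsBounded Ω) (hp : 2 ≤ p)
    (hz : z ∈ Ω) (hX : X ≠ 0) :
    ∃ f ∈ pBergmanSpace Ω p, f z = 0 ∧ pBergmanNorm Ω p f = 1 ∧
      ‖fderiv ℂ f z X‖ = pBergmanDerivSup Ω p z X ∧ 0 < pBergmanDerivSup Ω p z X := by
  have hp0 : 0 < p := by linarith
  obtain ⟨j, hj⟩ : ∃ j, X j ≠ 0 := by
    by_contra! h
    exact hX (funext h)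
  have hdf : ∀ {F : (Fin n → ℂ) → ℂ}, F ∈ pBergmanSpace Ω p → DifferentiableAt ℂ F z :=
    fun hF => pBergman_differentiableAt hΩo hF hz
  obtain ⟨f, ⟨hf, hf0, hf1⟩, hmin⟩ := exists_pBergmanNorm_min hΩo hΩb hp
    {F | F ∈ pBergmanSpace Ω p ∧ F z = 0 ∧ fderiv ℂ F z X = 1} (fun F hF => hF.1) (by
      -- a multiple of a coordinate function is a competitor
      set ℓ : (Fin n → ℂ) →L[ℂ] ℂ := (X j)⁻¹ • ContinuousLinearMap.proj j with hℓ
      have hd : Differentiable ℂ (fun ζ => ℓ ζ - ℓ z) := ℓ.differentiable.sub_const _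
      obtain ⟨C, hC⟩ := hΩb.exists_norm_le
      refine ⟨fun ζ => ℓ ζ - ℓ z, pBergman_of_bounded hΩo hΩb hp0 hd.differentiableOn
        (C := ‖ℓ‖ * C + ‖ℓ z‖) (fun ζ hζ => ?_), by simp, ?_⟩
      · refine (norm_sub_le _ _).trans (add_le_add_left ((ℓ.le_opNorm ζ).trans ?_) _)
        gcongr
        exact hC ζ hζ
      · rw [fderiv_sub_const, ContinuousLinearMap.fderiv]
        simp [hℓ, hj]) (by
      rintro F ⟨hF, hF0, hF1⟩ G ⟨hG, hG0, hG1⟩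
      refine ⟨pBergman_smul hΩo hp0 _ (pBergman_add hΩo hp0 hF hG), by simp [hF0, hG0], ?_⟩
      rw [fderiv_const_smul ((hdf hF).add (hdf hG)), fderiv_add (hdf hF) (hdf hG)]
      simp [hF1, hG1]
      norm_num) (by
      intro F hF f hf hlim
      refine ⟨hf, tendsto_nhds_unique (hlim z hz).1 ?_, ?_⟩
      · simp_rw [(hF _).2.1]
        exact tendsto_const_nhds
      · have h1 := ((ContinuousLinearMap.apply ℂ ℂ X).continuous.tendsto _).comp (hlim z hz).2
        refine tendsto_nhds_unique h1 ?_
        have : ∀ k, ((ContinuousLinearMap.apply ℂ ℂ X) ∘ fun j => fderiv ℂ (F j) z) k = 1 :=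
          fun k => (hF k).2.2
        rw [funext this]
        exact tendsto_const_nhds)
  set N := pBergmanNorm Ω p f with hN
  have hNpos : 0 < N := pBergmanNorm_pos_of_fderiv hΩo hΩb (by linarith) hf hz
    (Y := X) (by rw [hf1]; simp)
  set F := ((N⁻¹ : ℝ) : ℂ) • f with hF
  have hFm : F ∈ pBergmanSpace Ω p := pBergman_smul hΩo hp0 _ hf
  have hF0 : F z = 0 := by simp [hF, hf0]
  have hFN : pBergmanNorm Ω p F = 1 := by
    rw [hF, pBergmanNorm_smul hp0, Complex.norm_of_nonneg (inv_nonneg.2 hNpos.le), ← hN,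
      inv_mul_cancel₀ hNpos.ne']
  have hFd : ‖fderiv ℂ F z X‖ = N⁻¹ := by
    rw [hF, fderiv_const_smul (hdf hf), _root_.smul_apply, hf1, smul_eq_mul, mul_one,
      Complex.norm_of_nonneg (inv_nonneg.2 hNpos.le)]
  have hsup : pBergmanDerivSup Ω p z X = N⁻¹ := by
    refine le_antisymm (Real.sSup_le ?_ (inv_nonneg.2 hNpos.le)) ?_
    · rintro _ ⟨G, hG, hG0, hG1, rfl⟩
      rcases eq_or_ne (fderiv ℂ G z X) 0 with h0 | h0
      · rw [h0, norm_zero]; exact inv_nonneg.2 hNpos.le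
      · have h2 := hmin ((fderiv ℂ G z X)⁻¹ • G) ⟨pBergman_smul hΩo hp0 _ hG, by simp [hG0], by
          rw [fderiv_const_smul (hdf hG), _root_.smul_apply, smul_eq_mul, inv_mul_cancel₀ h0]⟩
        rw [pBergmanNorm_smul hp0, hG1, mul_one, norm_inv] at h2
        exact (le_inv_comm₀ hNpos (norm_pos_iff.2 h0)).1 h2
    · have h2 := norm_fderiv_le_pBergmanDerivSup hΩo hΩb (by linarith : (1 : ℝ) ≤ p) hz X hFm hF0
        (by rw [hFN]; exact one_pos)
      rwa [hFN, mul_one, hFd] at h2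
  exact ⟨F, hFm, hF0, hFN, by rw [hFd, hsup], by rw [hsup]; exact inv_pos.2 hNpos⟩

end DerivExtremal

/-! ### Circle averages of the norm of a perturbed extremal function -/

section PowRemAverage

variable {α : Type*} [MeasurableSpace α] {π : Measure α}

/-- The second-order term, split into a multiple of `|w|²` and a part that is harmonic in `w`. -/
lemma integral_powQuad_eq {s : ℝ} {x : α → ℂ} (hx : MemLp x 2 π) (w : ℂ) :
    ∫ a, powQuad s (w * x a) ∂π = s ^ 2 / 4 * (∫ a, ‖x a‖ ^ 2 ∂π) * ‖w‖ ^ 2 +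
      s * (s - 2) / 4 * (w ^ 2 * ∫ a, x a ^ 2 ∂π).re := by
  have hsq : Integrable (fun a => x a ^ 2) π := by
    refine (integrable_norm_sq hx).mono' (hx.1.pow 2) (Eventually.of_forall fun a => ?_)
    rw [norm_pow]
  have h1 : ∀ a, powQuad s (w * x a) =
      s ^ 2 / 4 * ‖w‖ ^ 2 * ‖x a‖ ^ 2 + s * (s - 2) / 4 * (w ^ 2 * x a ^ 2).re := by
    intro a
    have h2 : ‖w * x a‖ ^ 2 = (w * x a).re ^ 2 + (w * x a).im ^ 2 := by
      rw [← Complex.normSq_eq_norm_sq, Complex.normSq_apply]; ring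
    have h3 : (w ^ 2 * x a ^ 2).re = 2 * (w * x a).re ^ 2 - ‖w * x a‖ ^ 2 := by
      rw [h2, ← mul_pow, pow_two, Complex.mul_re]; ring
    rw [powQuad, h3, mul_assoc (s ^ 2 / 4), ← mul_pow, ← norm_mul]
    ring
  simp_rw [h1]
  have h4 : ∫ a, (w ^ 2 * x a ^ 2).re ∂π = (w ^ 2 * ∫ a, x a ^ 2 ∂π).re := by
    rw [← integral_const_mul]
    exact integral_re (hsq.const_mul _)
  have h5 : Integrable (fun a => (w ^ 2 * x a ^ 2).re) π := (hsq.const_mul _).re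
  rw [integral_add ((integrable_norm_sq hx).const_mul _) (h5.const_mul _), integral_const_mul,
    integral_const_mul, h4]
  ring

/-- Along a holomorphic function `φ` vanishing at `0`, the second-order term of the averaged
integral only sees `∫ |x|²`: the harmonic part `Re (φ² ∫ x²)` averages to zero. -/
lemma tendsto_circleAverage_integral_powRem [IsFiniteMeasure π] {s : ℝ} (hs : 1 ≤ s) {x : α → ℂ}
    (hx : MemLp x (ENNReal.ofReal (max s 2)) π)
    (hcont : Continuous fun w : ℂ => ∫ a, powRem s (w * x a) ∂π) {φ : ℂ → ℂ} {R : ℝ} (hR : 0 < R)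
    (hφ : DifferentiableOn ℂ φ (Metric.ball 0 R)) (hφ0 : φ 0 = 0) :
    Tendsto (fun r => Real.circleAverage (fun t => ∫ a, powRem s (φ t * x a) ∂π) 0 r / r ^ 2)
      (𝓝[>] 0) (𝓝 (s ^ 2 / 4 * (∫ a, ‖x a‖ ^ 2 ∂π) * ‖deriv φ 0‖ ^ 2)) := by
  have hx2 := memLp_two_of_max hx
  set I : ℂ → ℝ := fun w => ∫ a, powRem s (w * x a) ∂π with hI
  set Q : ℂ → ℝ := fun w => ∫ a, powQuad s (w * x a) ∂π with hQ
  set d := deriv φ 0 with hd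
  have hφd : HasDerivAt φ d 0 :=
    (hφ.differentiableAt (Metric.ball_mem_nhds 0 hR)).hasDerivAt
  have hφt : Tendsto φ (𝓝 0) (𝓝 0) := by
    have := hφd.continuousAt.tendsto
    rwa [hφ0] at this
  have hφO : φ =O[𝓝 0] (fun t => t) := by simpa [hφ0] using hφd.isBigO_sub
  have hφ2 : (fun t => ‖φ t‖ ^ 2) =O[𝓝 0] (fun t => ‖t‖ ^ 2) := (hφO.norm_norm).pow 2
  have hbig := ((integral_powRem_isBigO hs hx).comp_tendsto hφt).trans hφ2
  obtain ⟨C, hC⟩ := hbig.bound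
  obtain ⟨R₁, hR₁, hb⟩ := Metric.eventually_nhds_iff_ball.1 hC
  have hlittle := ((integral_powRem_isLittleO hs hx).comp_tendsto hφt).trans_isBigO hφ2
  have hQeq : ∀ w, Q w = s ^ 2 / 4 * (∫ a, ‖x a‖ ^ 2 ∂π) * ‖w‖ ^ 2 +
      s * (s - 2) / 4 * (w ^ 2 * ∫ a, x a ^ 2 ∂π).re := fun w => integral_powQuad_eq hx2 w
  have hQc : Continuous Q := by
    rw [funext hQeq]
    fun_prop
  have hQs : ∀ (r : ℝ) (w : ℂ), Q (r * w) = r ^ 2 * Q w := fun r w => by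
    rw [hQeq, hQeq, mul_pow, norm_mul, mul_pow, Complex.norm_real, Real.norm_eq_abs, sq_abs,
      mul_assoc ((r : ℂ) ^ 2), ← Complex.ofReal_pow, Complex.re_ofReal_mul]
    ring
  have hrad : ∀ e : ℂ, ‖e‖ = 1 →
      Tendsto (fun r : ℝ => I (φ (r * e)) / r ^ 2) (𝓝[>] 0) (𝓝 (Q (d * e))) := by
    intro e he
    have hre : Tendsto (fun r : ℝ => (r : ℂ) * e) (𝓝[>] 0) (𝓝 0) := by
      have : Continuous fun r : ℝ => (r : ℂ) * e := by fun_prop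
      simpa using (this.tendsto 0).mono_left nhdsWithin_le_nhds
    have hpos : ∀ᶠ r : ℝ in 𝓝[>] 0, r ∈ Set.Ioi (0 : ℝ) := self_mem_nhdsWithin
    have h1 : Tendsto (fun r : ℝ => (I (φ (r * e)) - Q (φ (r * e))) / r ^ 2) (𝓝[>] 0) (𝓝 0) := by
      have h2 := (hlittle.comp_tendsto hre).tendsto_div_nhds_zero
      refine h2.congr' ?_
      filter_upwards [hpos] with r hr
      simp [he, hI, hQ]
    have hφe : HasDerivAt (fun r : ℝ => φ (r * e)) (d * e) 0 := by
      have h3 : HasDerivAt (fun r : ℝ => (r : ℂ) * e) e 0 := by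
        simpa using (Complex.ofRealCLM.hasDerivAt (x := (0 : ℝ))).mul_const e
      have h4 : HasDerivAt φ d (((0 : ℝ) : ℂ) * e) := by simpa using hφd
      exact h4.comp_of_eq (0 : ℝ) h3 rfl
    have h5 : Tendsto (fun r : ℝ => ((r⁻¹ : ℝ) : ℂ) * φ (r * e)) (𝓝[>] 0) (𝓝 (d * e)) := by
      have h6 := (hasDerivAt_iff_tendsto_slope_zero.1 hφe).mono_left
        (nhdsWithin_mono 0 (fun r (hr : r ∈ Set.Ioi (0 : ℝ)) => ne_of_gt hr))
      refine h6.congr fun r => ?_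
      simp [hφ0]
    have h7 : Tendsto (fun r : ℝ => Q (φ (r * e)) / r ^ 2) (𝓝[>] 0) (𝓝 (Q (d * e))) := by
      refine ((hQc.tendsto _).comp h5).congr fun r => ?_
      rw [Function.comp_apply, hQs, inv_pow, div_eq_inv_mul]
    have h8 := h1.add h7
    rw [zero_add] at h8
    exact h8.congr fun r => by ring
  have hmain := tendsto_circleAverage_div_sq (u := fun t => I (φ t)) (q := fun e => Q (d * e))
    (R := min R R₁) (C := C) (lt_min hR hR₁) (fun r hr => ?_) (fun t ht => ?_) hrad
  · have hav : Real.circleAverage (fun e => Q (d * e)) 0 1 =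
        s ^ 2 / 4 * (∫ a, ‖x a‖ ^ 2 ∂π) * ‖d‖ ^ 2 := by
      set ψ : ℂ → ℂ := fun e => (s * (s - 2) / 4 : ℝ) * ((d * e) ^ 2 * ∫ a, x a ^ 2 ∂π) with hψ
      have hψd : Differentiable ℂ ψ := by fun_prop
      obtain ⟨h1, h2⟩ := circleAverage_re_of_differentiableOn (R := 2) hψd.differentiableOn
        (r := 1) (by norm_num)
      have hcongr : Set.EqOn (fun e => Q (d * e))
          (fun e => s ^ 2 / 4 * (∫ a, ‖x a‖ ^ 2 ∂π) * ‖d‖ ^ 2 + (ψ e).re)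
          (Metric.sphere 0 |1|) := by
        intro e he
        have he' : ‖e‖ = 1 := by simpa using he
        simp only [hψ, hQeq, norm_mul, he', mul_one, Complex.re_ofReal_mul]
      rw [Real.circleAverage_congr_sphere hcongr,
        Real.circleAverage_fun_add (circleIntegrable_const _ _ _) h1, Real.circleAverage_const, h2]
      simp [hψ]
    rw [hav] at hmain
    exact hmain
  · have hc : Continuous fun θ => φ (circleMap 0 r θ) := by
      refine hφ.continuousOn.comp_continuous (continuous_circleMap 0 r) fun θ => ?_
      rw [Metric.mem_ball, dist_zero_right, norm_circleMap_zero, abs_of_pos hr.1]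
      exact hr.2.trans_le (min_le_left _ _)
    exact (hcont.comp hc).aestronglyMeasurable
  · have h1 := hb t (by simpa using ht.trans_le (min_le_right _ _))
    simpa using h1

end PowRemAverage

/-! ### Curvature -/

section Curvature

variable {n : ℕ} {Ω : Set (Fin n → ℂ)} {p : ℝ} {z X : Fin n → ℂ} {f g : (Fin n → ℂ) → ℂ}

lemma pBergmanMetric_eq (hΩo : IsOpen Ω) (hΩb : Bornology.IsBounded Ω) (hp : 1 ≤ p)
    {w : Fin n → ℂ} (hw : w ∈ Ω) (Y : Fin n → ℂ) :
    pBergmanMetric Ω p w Y = pBergmanMin Ω p w * pBergmanDerivSup Ω p w Y := by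
  unfold pBergmanMetric pBergmanKernel pBergmanDerivSup
  rw [← Real.rpow_mul (pBergmanMin_pos hΩo hΩb hp hw).le]
  have : -p * (-1 / p) = 1 := by field_simp
  rw [this, Real.rpow_one]

lemma continuous_integral_powRem_quot (hΩo : IsOpen Ω) (hp : 2 ≤ p)
    (hf : f ∈ pBergmanSpace Ω p) (hf1 : pBergmanNorm Ω p f = 1)
    (hnull : ∀ᵐ ζ ∂(volume.restrict Ω), f ζ ≠ 0) (hg : g ∈ pBergmanSpace Ω p) :
    Continuous fun w : ℂ => ∫ ζ, powRem p (w * (g ζ / f ζ)) ∂(bergmanMeasure Ω p f) := by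
  have hp0 : 0 < p := by linarith
  have hN : Continuous fun w : ℂ => pBergmanNorm Ω p (f + w • g) := by
    refine (LipschitzWith.of_le_add_mul ⟨pBergmanNorm Ω p g, pBergmanNorm_nonneg g⟩
      fun w w' => ?_).continuous
    have h1 : f + w • g = (f + w' • g) + (w - w') • g := by rw [sub_smul]; abel
    rw [h1]
    refine (pBergmanNorm_add_le hΩo (by linarith) (pBergman_add hΩo hp0 hf
      (pBergman_smul hΩo hp0 _ hg)) (pBergman_smul hΩo hp0 _ hg)).trans (le_of_eq ?_)
    rw [pBergmanNorm_smul hp0, dist_eq_norm, mul_comm]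
    rfl
  have h2 : ∀ w : ℂ, ∫ ζ, powRem p (w * (g ζ / f ζ)) ∂(bergmanMeasure Ω p f) =
      pBergmanNorm Ω p (f + w • g) ^ p - 1 -
        p * (w * ∫ ζ, g ζ / f ζ ∂(bergmanMeasure Ω p f)).re := fun w => by
    rw [pBergmanNorm_add_smul_rpow hΩo hp hf (by rw [hf1]; exact one_pos) hnull hg, hf1,
      Real.one_rpow]
    ring
  rw [funext h2]
  exact ((hN.rpow_const fun _ => Or.inr hp0.le).sub continuous_const).sub (by fun_prop)

/-- Jensen's inequality: the weighted `L²` norm is at most the weighted `L^p` norm. -/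
lemma integral_norm_quot_sq_le (hΩo : IsOpen Ω) (hp : 2 ≤ p)
    (hf : f ∈ pBergmanSpace Ω p) (hf1 : pBergmanNorm Ω p f = 1)
    (hnull : ∀ᵐ ζ ∂(volume.restrict Ω), f ζ ≠ 0) (hg : g ∈ pBergmanSpace Ω p) :
    ∫ ζ, ‖g ζ / f ζ‖ ^ 2 ∂(bergmanMeasure Ω p f) ≤ pBergmanNorm Ω p g ^ 2 := by
  have hp0 : 0 < p := by linarith
  have hN : 0 < pBergmanNorm Ω p f := by rw [hf1]; exact one_pos
  have := isProbabilityMeasure_bergmanMeasure hp0 hf hN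
  have hx := memLp_quot hΩo hp hf hg
  have hpow : ∀ x : ℝ, 0 ≤ x → (x ^ 2) ^ (p / 2) = x ^ p := fun x hx => by
    rw [← Real.rpow_two, ← Real.rpow_mul hx, mul_div_cancel₀ p two_ne_zero]
  have hxp : Integrable (fun ζ => ‖g ζ / f ζ‖ ^ p) (bergmanMeasure Ω p f) := by
    have := integrable_norm_rpow_max hx
    rwa [max_eq_left hp] at this
  have hJ := (convexOn_rpow (by linarith : 1 ≤ p / 2)).map_integral_le
    (μ := bergmanMeasure Ω p f) (f := fun ζ => ‖g ζ / f ζ‖ ^ 2)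
    (continuousOn_id.rpow_const fun _ _ => Or.inr (by positivity)) isClosed_Ici
    (Eventually.of_forall fun ζ => sq_nonneg ‖g ζ / f ζ‖)
    (integrable_norm_sq (memLp_two_of_max hx))
    (hxp.congr (Eventually.of_forall fun ζ => (hpow _ (norm_nonneg _)).symm))
  simp only [hpow _ (norm_nonneg _)] at hJ
  have hgp := pBergmanNorm_rpow_eq_integral_quot hΩo hp0 hf hN hnull g
  rw [hf1, Real.one_rpow, one_mul] at hgp
  rw [← hgp, ← hpow _ (pBergmanNorm_nonneg g)] at hJ
  exact (Real.rpow_le_rpow_iff (integral_nonneg fun _ => sq_nonneg _) (sq_nonneg _)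
    (by positivity)).1 hJ

/-- Lower bound for the derivative supremum from the competitor `f - (f(w)/g(w)) g`. -/
lemma log_norm_le_log_pBergmanDerivSup (hΩo : IsOpen Ω) (hΩb : Bornology.IsBounded Ω)
    (hp : 2 ≤ p) (hf : f ∈ pBergmanSpace Ω p) (hf1 : pBergmanNorm Ω p f = 1)
    (hnull : ∀ᵐ ζ ∂(volume.restrict Ω), f ζ ≠ 0) (hg : g ∈ pBergmanSpace Ω p)
    {w : Fin n → ℂ} (hw : w ∈ Ω) {Y : Fin n → ℂ} {c : ℂ} (hc : f w = c * g w)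
    (hD : fderiv ℂ f w Y - c * fderiv ℂ g w Y ≠ 0) :
    0 < pBergmanDerivSup Ω p w Y ∧
      Real.log ‖fderiv ℂ f w Y - c * fderiv ℂ g w Y‖ ≤ Real.log (pBergmanDerivSup Ω p w Y) +
        (-(c * ∫ ζ, g ζ / f ζ ∂(bergmanMeasure Ω p f)).re +
          p⁻¹ * ∫ ζ, powRem p (-c * (g ζ / f ζ)) ∂(bergmanMeasure Ω p f)) := by
  have hp0 : 0 < p := by linarith
  set h := f + (-c) • g with hh
  have hhm : h ∈ pBergmanSpace Ω p := pBergman_add hΩo hp0 hf (pBergman_smul hΩo hp0 _ hg)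
  have hh0 : h w = 0 := by simp [hh, hc]
  have hgd := pBergman_differentiableAt hΩo hg hw
  have hhd : fderiv ℂ h w Y = fderiv ℂ f w Y - c * fderiv ℂ g w Y := by
    rw [hh, fderiv_add (pBergman_differentiableAt hΩo hf hw) (hgd.const_smul _),
      fderiv_const_smul hgd]
    simp
    ring
  rw [← hhd] at hD ⊢
  have hDp := norm_pos_iff.2 hD
  have hN := pBergmanNorm_pos_of_fderiv hΩo hΩb (by linarith) hhm hw hDp
  have hle := norm_fderiv_le_pBergmanDerivSup hΩo hΩb (by linarith) hw Y hhm hh0 hN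
  have hMpos : 0 < pBergmanDerivSup Ω p w Y :=
    pos_of_mul_pos_left (hDp.trans_le hle) hN.le
  refine ⟨hMpos, ?_⟩
  have h1 := Real.log_le_log hDp hle
  rw [Real.log_mul hMpos.ne' hN.ne'] at h1
  have h2 := Real.log_le_sub_one_of_pos (Real.rpow_pos_of_pos hN p)
  rw [Real.log_rpow hN, hh, pBergmanNorm_add_smul_rpow hΩo hp hf (by rw [hf1]; exact one_pos)
    hnull hg, hf1, Real.one_rpow, ← hh, one_mul, neg_mul, Complex.neg_re] at h2
  have h3 := mul_le_mul_of_nonneg_left h2 (inv_nonneg.2 hp0.le)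
  rw [← mul_assoc, inv_mul_cancel₀ hp0.ne', one_mul] at h3
  refine h1.trans (add_le_add_right (h3.trans (le_of_eq ?_)) _)
  field_simp
  ring

end Curvature

section CurvatureBound

variable {n : ℕ} {Ω : Set (Fin n → ℂ)} {p : ℝ} {z X : Fin n → ℂ} {f g : (Fin n → ℂ) → ℂ}

/-- The generalized Laplacian of `log B_p²` along a disc is bounded below by the Levi form of
`log K_p` and the value of the metric. -/
lemma IsMinimizer.le_genLaplacian_log_metric (hΩo : IsOpen Ω) (hΩc : IsConnected Ω)
    (hΩb : Bornology.IsBounded Ω) (hp : 2 ≤ p) (hz : z ∈ Ω) (hX : X ≠ 0)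
    (hg : IsMinimizer Ω p z g) {σ : ℂ → (Fin n → ℂ)} (hσ : IsHolDisc Ω z X σ) {L R₀ : ℝ}
    (hR₀ : 0 < R₀) (hint : ∀ r ∈ Set.Ioo 0 R₀,
      CircleIntegrable (fun t => p * logMinDefect Ω p g z (σ t)) 0 r)
    (hlim : Tendsto (fun r =>
      Real.circleAverage (fun t => p * logMinDefect Ω p g z (σ t)) 0 r / r ^ 2) (𝓝[>] 0) (𝓝 L)) :
    ((-(2 / p * L + p / 2 * pBergmanMetric Ω p z X ^ 2) : ℝ) : EReal) ≤
      genLaplacian (fun t => Real.log (pBergmanMetric Ω p (σ t) (deriv σ t) ^ 2)) 0 := by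
  have hp0 : 0 < p := by linarith
  have hp1 : 1 ≤ p := by linarith
  have hgz : g z ≠ 0 := by rw [hg.eq_one]; exact one_ne_zero
  have hN := pBergmanNorm_pos hΩo hΩb hp1 hg.mem hz hgz
  obtain ⟨f, hf, hf0, hf1, hfM, hM0⟩ := exists_derivExtremal hΩo hΩb hp hz hX
  set a := fderiv ℂ f z X with ha
  have ha0 : a ≠ 0 := norm_pos_iff.1 (by rw [hfM]; exact hM0)
  have hnull : ∀ᵐ ζ ∂(volume.restrict Ω), f ζ ≠ 0 := by
    have hex : ∃ ζ ∈ Ω, f ζ ≠ 0 := by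
      by_contra! hcon
      have : f =ᶠ[𝓝 z] fun _ => 0 := eventually_of_mem (hΩo.mem_nhds hz) hcon
      apply ha0
      rw [ha, this.fderiv_eq]
      simp
    obtain ⟨ζ, hζ, hζ0⟩ := hex
    exact pBergman_ae_ne_zero hΩo hΩc hf hζ hζ0
  have hprob := isProbabilityMeasure_bergmanMeasure hp0 hf (by rw [hf1]; exact one_pos)
  have hIc := continuous_integral_powRem_quot hΩo hp hf hf1 hnull hg.mem
  have hA := integral_norm_quot_sq_le hΩo hp hf hf1 hnull hg.mem
  rw [← hg.pBergmanMin_eq hΩo hΩb hp0] at hA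
  have hxg := memLp_quot hΩo hp hf hg.mem
  set π := bergmanMeasure Ω p f with hπ
  set I : ℂ → ℝ := fun w => ∫ ζ, powRem p (w * (g ζ / f ζ)) ∂π with hI
  set A := ∫ ζ, ‖g ζ / f ζ‖ ^ 2 ∂π with hAdef
  set c := ∫ ζ, g ζ / f ζ ∂π with hc
  obtain ⟨R₁, hR₁, C₁, -, hσd, hσΩ, hgne, hF⟩ := hg.exists_disc_bound hΩo hp hz hN hσ
  obtain ⟨-, -, -, -, hσ0, hσX⟩ := hσ
  obtain ⟨hφd, hφ0, -, -⟩ := hF f hf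
  set φ : ℂ → ℂ := fun t => f (σ t) / g (σ t) with hφ
  have hφz : φ 0 = 0 := by simp [hφ, hσ0, hf0]
  have hφa : deriv φ 0 = a := by rw [hφ0, quotDeriv, hf0]; simp [ha]
  have hφ' : DifferentiableOn ℂ (deriv φ) (Metric.ball 0 R₁) := hφd.deriv Metric.isOpen_ball
  have hσ' : DifferentiableOn ℂ (deriv σ) (Metric.ball 0 R₁) := hσd.deriv Metric.isOpen_ball
  obtain ⟨δ, hδ, hδb⟩ := exists_ball_subset hΩo hz
  -- a radius on which the disc stays well inside `Ω` and `φ'` has no zeros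
  have hev : ∀ᶠ t in 𝓝 (0 : ℂ), t ∈ Metric.ball (0 : ℂ) (min R₀ R₁) ∧ deriv φ t ≠ 0 ∧
      σ t ∈ Metric.ball z (δ / 2) := by
    refine (Filter.Eventually.and (p := (· ∈ Metric.ball (0 : ℂ) (min R₀ R₁)))
      (Metric.ball_mem_nhds 0 (lt_min hR₀ hR₁)) (Filter.Eventually.and ?_ ?_))
    · have h1 := (hφ'.differentiableAt (Metric.ball_mem_nhds 0 hR₁)).continuousAt
      exact h1.eventually_ne (by rw [hφa]; exact ha0)
    · have h1 := (hσd.differentiableAt (Metric.ball_mem_nhds 0 hR₁)).continuousAt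
      exact h1.eventually_mem (by rw [hσ0]; exact Metric.ball_mem_nhds z (half_pos hδ))
  obtain ⟨R, hR, hRb⟩ := Metric.eventually_nhds_iff_ball.1 hev
  have hsub : Metric.ball (0 : ℂ) R ⊆ Metric.ball 0 R₁ := fun t ht =>
    Metric.ball_subset_ball (min_le_right _ _) (hRb t ht).1
  have hRR₀ : R ≤ R₀ := by
    by_contra hcon
    have h1 := (hRb (R₀ : ℂ) (by simpa [abs_of_pos hR₀] using hcon)).1
    have h2 := Metric.ball_subset_ball (min_le_left R₀ R₁) h1
    simp [abs_of_pos hR₀] at h2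
  set m₀ := pBergmanMin Ω p z with hm₀
  have hm₀pos : 0 < m₀ := pBergmanMin_pos hΩo hΩb hp1 hz
  set u : ℂ → ℝ := fun t => Real.log (pBergmanMetric Ω p (σ t) (deriv σ t) ^ 2) with hu
  set v : ℂ → ℝ := fun t => (2 * Real.log m₀ + (2 : ℝ) • Real.log ‖deriv φ t‖) +
    ((-(2 / p)) • (p * logMinDefect Ω p g z (σ t)) +
      ((φ t * (2 * c)).re + (-(2 / p)) • I (-φ t))) with hv
  have hu0 : u 0 = 2 * Real.log m₀ + 2 * Real.log ‖a‖ := by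
    simp only [hu, hσ0, hσX]
    rw [pBergmanMetric_eq hΩo hΩb hp1 hz, Real.log_pow, Real.log_mul hm₀pos.ne' hM0.ne', hfM]
    push_cast
    ring
  have hvu : ∀ t ∈ Metric.ball (0 : ℂ) R, v t ≤ u t := by
    intro t ht
    have ht₁ := hsub ht
    have hw := hσΩ ht₁
    have hgt := hgne t ht₁
    have hσt : HasDerivAt σ (deriv σ t) t :=
      (hσd.differentiableAt (Metric.isOpen_ball.mem_nhds ht₁)).hasDerivAt
    have hft := (pBergman_differentiableAt hΩo hf hw).hasFDerivAt.comp_hasDerivAt t hσt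
    have hgt' := (pBergman_differentiableAt hΩo hg.mem hw).hasFDerivAt.comp_hasDerivAt t hσt
    have hquot : deriv φ t = _ := (hft.div hgt' hgt).deriv
    have hcφ : f (σ t) = φ t * g (σ t) := by simp only [hφ]; field_simp
    have hD : fderiv ℂ f (σ t) (deriv σ t) - φ t * fderiv ℂ g (σ t) (deriv σ t) =
        deriv φ t * g (σ t) := by
      rw [hquot]
      simp only [hφ, Function.comp_apply]
      field_simp
    have hφt : deriv φ t ≠ 0 := (hRb t ht).2.1
    obtain ⟨hMt, hlog⟩ := log_norm_le_log_pBergmanDerivSup hΩo hΩb hp hf hf1 hnull hg.mem hw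
      (Y := deriv σ t) hcφ (by rw [hD]; exact mul_ne_zero hφt hgt)
    rw [hD, norm_mul, Real.log_mul (norm_ne_zero_iff.2 hφt) (norm_ne_zero_iff.2 hgt)] at hlog
    have hmt := pBergmanMin_pos hΩo hΩb hp1 hw
    have hut : u t = 2 * Real.log (pBergmanMin Ω p (σ t)) +
        2 * Real.log (pBergmanDerivSup Ω p (σ t) (deriv σ t)) := by
      simp only [hu]
      rw [pBergmanMetric_eq hΩo hΩb hp1 hw, Real.log_pow, Real.log_mul hmt.ne' hMt.ne']
      push_cast
      ring
    have hvt : v t = 2 * Real.log m₀ + 2 * Real.log ‖deriv φ t‖ -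
        2 * logMinDefect Ω p g z (σ t) + 2 * (φ t * c).re - 2 * (p⁻¹ * I (-φ t)) := by
      have h1 : (φ t * (2 * c)).re = 2 * (φ t * c).re := by
        rw [mul_left_comm]; simp
      simp only [hv, smul_eq_mul, h1]
      field_simp
      ring
    rw [hut, hvt, logMinDefect]
    change _ + _ ≤ _ + (_ + p⁻¹ * I (-φ t)) at hlog
    linarith
  have hvi : ∀ r ∈ Set.Ioo 0 R, CircleIntegrable v 0 r ∧ Real.circleAverage v 0 r =
      u 0 - 2 / p * Real.circleAverage (fun t => p * logMinDefect Ω p g z (σ t)) 0 r -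
        2 / p * Real.circleAverage (fun t => I (-φ t)) 0 r := by
    intro r hr
    obtain ⟨h1, h1'⟩ := circleAverage_log_norm_of_differentiableOn (hφ'.mono hsub)
      (fun t ht => (hRb t ht).2.1) hr
    have h2 := hint r ⟨hr.1, hr.2.trans_le hRR₀⟩
    obtain ⟨h3, h3'⟩ := circleAverage_re_of_differentiableOn
      ((hφd.mono hsub).mul_const (2 * c)) hr
    have hsph : Metric.sphere (0 : ℂ) |r| ⊆ Metric.ball 0 R := by
      rw [abs_of_pos hr.1]
      exact Metric.sphere_subset_closedBall.trans (Metric.closedBall_subset_ball hr.2)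
    have h4 : CircleIntegrable (fun t => I (-φ t)) 0 r :=
      ContinuousOn.circleIntegrable'
        (hIc.comp_continuousOn (hφd.continuousOn.mono (hsph.trans hsub)).neg)
    have k1 : CircleIntegrable (fun t => (2 : ℝ) • Real.log ‖deriv φ t‖) 0 r := h1.const_smul
    have k2 : CircleIntegrable (fun t => (-(2 / p)) • (p * logMinDefect Ω p g z (σ t))) 0 r :=
      h2.const_smul
    have k4 : CircleIntegrable (fun t => (-(2 / p)) • I (-φ t)) 0 r := h4.const_smul
    have k01 : CircleIntegrable
        (fun t => 2 * Real.log m₀ + (2 : ℝ) • Real.log ‖deriv φ t‖) 0 r :=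
      (circleIntegrable_const _ _ _).add k1
    have k34 : CircleIntegrable (fun t => (φ t * (2 * c)).re + (-(2 / p)) • I (-φ t)) 0 r :=
      h3.add k4
    have k234 : CircleIntegrable (fun t => (-(2 / p)) • (p * logMinDefect Ω p g z (σ t)) +
      ((φ t * (2 * c)).re + (-(2 / p)) • I (-φ t))) 0 r := k2.add k34
    refine ⟨k01.add k234, ?_⟩
    simp only [hv]
    rw [Real.circleAverage_fun_add k01 k234,
      Real.circleAverage_fun_add (circleIntegrable_const _ _ _) k1,
      Real.circleAverage_fun_add k2 k34, Real.circleAverage_fun_add h3 k4,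
      Real.circleAverage_const, Real.circleAverage_fun_smul, Real.circleAverage_fun_smul,
      Real.circleAverage_fun_smul, h1', h3', hφz, hφa, hu0]
    simp only [smul_eq_mul, zero_mul, Complex.zero_re]
    ring
  obtain ⟨C, hC, hCb⟩ := exists_pBergmanDerivSup_le hΩo hΩb hp1 (half_pos hδ)
  have hui : ∀ r ∈ Set.Ioo 0 R, CircleIntegrable u 0 r := by
    intro r hr
    have hsph : Metric.sphere (0 : ℂ) |r| ⊆ Metric.ball 0 R := by
      rw [abs_of_pos hr.1]
      exact Metric.sphere_subset_closedBall.trans (Metric.closedBall_subset_ball hr.2)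
    have hcirc : ∀ θ, circleMap 0 r θ ∈ Metric.sphere (0 : ℂ) |r| := circleMap_mem_sphere' 0 r
    have hγ : Continuous fun θ => σ (circleMap 0 r θ) :=
      hσd.continuousOn.comp_continuous (continuous_circleMap 0 r)
        fun θ => hsub (hsph (hcirc θ))
    have hη : Continuous fun θ => deriv σ (circleMap 0 r θ) :=
      hσ'.continuousOn.comp_continuous (continuous_circleMap 0 r)
        fun θ => hsub (hsph (hcirc θ))
    have hγΩ : ∀ θ, σ (circleMap 0 r θ) ∈ Ω := fun θ => hσΩ (hsub (hsph (hcirc θ)))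
    have hm : Measurable fun θ => u (circleMap 0 r θ) := by
      have h1 := ((measurable_pBergmanMin_comp hΩo hΩb hp0 hγ hγΩ).mul
        (measurable_pBergmanDerivSup_comp hΩo hΩb hp1 hγ hη hγΩ)).pow_const 2 |>.log
      have h2 : (fun θ => u (circleMap 0 r θ)) = fun θ =>
          Real.log ((pBergmanMin Ω p (σ (circleMap 0 r θ)) * pBergmanDerivSup Ω p
            (σ (circleMap 0 r θ)) (deriv σ (circleMap 0 r θ))) ^ 2) := by
        ext θ
        simp only [hu]
        rw [pBergmanMetric_eq hΩo hΩb hp1 (hγΩ θ)]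
      rw [h2]
      exact h1
    obtain ⟨S, hS⟩ := (isCompact_sphere (0 : ℂ) |r|).exists_bound_of_continuousOn
      (hσ'.continuousOn.mono (hsph.trans hsub))
    set N₁ := pBergmanNorm Ω p (fun _ => 1) with hN₁
    have hub : ∀ t ∈ Metric.sphere (0 : ℂ) |r|, u t ≤ (N₁ * (C * S)) ^ 2 := by
      intro t ht
      have hw := hσΩ (hsub (hsph ht))
      have hwb : Metric.ball (σ t) (δ / 2) ⊆ Ω := by
        refine (Metric.ball_subset_ball' ?_).trans hδb
        have := (hRb t (hsph ht)).2.2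
        rw [Metric.mem_ball] at this
        linarith
      have hm1 : pBergmanMin Ω p (σ t) ≤ N₁ :=
        pBergmanMin_le _ (pBergman_one_mem hΩo hΩb hp0) rfl
      have hM1 := ((hCb (σ t) (deriv σ t) hwb).2).trans
        (mul_le_mul_of_nonneg_left (hS t ht) hC.le)
      have hM2 := pBergmanDerivSup_nonneg (Ω := Ω) (p := p) (σ t) (deriv σ t)
      have hm2 := (pBergmanMin_pos hΩo hΩb hp1 hw).le
      refine (Real.log_le_self (sq_nonneg _)).trans ?_
      rw [pBergmanMetric_eq hΩo hΩb hp1 hw]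
      gcongr
      exact hm2.trans hm1
    have hv1 := (hvi r hr).1
    have hc1 : CircleIntegrable (fun _ : ℂ => (N₁ * (C * S)) ^ 2) 0 r :=
      circleIntegrable_const _ _ _
    unfold CircleIntegrable at hv1 hc1 ⊢
    rw [intervalIntegrable_iff] at hv1 hc1 ⊢
    exact integrable_of_le_of_le hm.aestronglyMeasurable
      (Eventually.of_forall fun θ => hvu _ (hsph (hcirc θ)))
      (Eventually.of_forall fun θ => hub _ (hcirc θ)) hv1 hc1
  have hIlim := tendsto_circleAverage_integral_powRem (s := p) hp1 hxg hIc (φ := fun t => -φ t) hR₁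
    hφd.neg (by rw [hφz, neg_zero])
  have hderiv : deriv (fun t => -φ t) 0 = -a := by rw [deriv.fun_neg, hφa]
  rw [hderiv, norm_neg, hfM] at hIlim
  have htend := (hlim.const_mul (-(2 / p))).sub (hIlim.const_mul (2 / p))
  have hbound : -(2 / p * L + p / 2 * pBergmanMetric Ω p z X ^ 2) ≤
      -(2 / p) * L - 2 / p * (p ^ 2 / 4 * A * pBergmanDerivSup Ω p z X ^ 2) := by
    rw [pBergmanMetric_eq hΩo hΩb hp1 hz, ← hm₀]
    have h1 : 2 / p * (p ^ 2 / 4 * A * pBergmanDerivSup Ω p z X ^ 2) =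
        p / 2 * (A * pBergmanDerivSup Ω p z X ^ 2) := by field_simp; ring
    have h2 : A * pBergmanDerivSup Ω p z X ^ 2 ≤ m₀ ^ 2 * pBergmanDerivSup Ω p z X ^ 2 := by gcongr
    have h3 := mul_le_mul_of_nonneg_left h2 (by positivity : 0 ≤ p / 2)
    rw [h1, mul_pow]
    linarith
  refine (EReal.coe_le_coe_iff.2 hbound).trans ?_
  rw [← ((continuous_coe_real_ereal.tendsto _).comp htend).liminf_eq]
  unfold genLaplacian
  refine liminf_le_liminf ?_
  have hevr : ∀ᶠ r : ℝ in 𝓝[>] 0, r ∈ Set.Ioo 0 R := Ioo_mem_nhdsGT hR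
  filter_upwards [hevr] with r hr
  refine EReal.coe_le_coe_iff.2 ?_
  have hmono := Real.circleAverage_mono (hvi r hr).1 (hui r hr) fun t ht => hvu t (by
    rw [abs_of_pos hr.1] at ht
    exact Metric.closedBall_subset_ball hr.2 (Metric.sphere_subset_closedBall ht))
  rw [(hvi r hr).2] at hmono
  have hr2 : 0 < r ^ 2 := pow_pos hr.1 2
  calc _ = (-(2 / p * Real.circleAverage (fun t => p * logMinDefect Ω p g z (σ t)) 0 r) -
        2 / p * Real.circleAverage (fun t => I (-φ t)) 0 r) / r ^ 2 := by
        simp only [hI]; ring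
    _ ≤ _ := by
        refine div_le_div_of_nonneg_right ?_ hr2.le
        change _ ≤ Real.circleAverage u 0 r - u 0
        linarith

end CurvatureBound

end

theorem theorem1p6 {n : ℕ} (Ω : Set (Fin n → ℂ)) (hΩo : IsOpen Ω) (hΩc : IsConnected Ω)
    (hΩb : Bornology.IsBounded Ω) (p : ℝ) (hp : 2 ≤ p)
    (z : Fin n → ℂ) (hz : z ∈ Ω) (X : Fin n → ℂ) (hX : X ≠ 0) :
    pBergmanHSC Ω p z X ≤
      ((2 / p : ℝ) : EReal) *
          (genLeviForm (fun ζ => Real.log (pBergmanKernel Ω p ζ)) z X /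
            ((pBergmanMetric Ω p z X ^ 2 : ℝ) : EReal)) +
        ((p / 2 : ℝ) : EReal) := by
  have hp0 : 0 < p := by linarith
  have hp1 : 1 ≤ p := by linarith
  obtain ⟨g, hg⟩ := exists_isMinimizer hΩo hΩb hp hz
  obtain ⟨L, hL⟩ := hg.exists_tendsto_circleAverage_defect hΩo hΩc hΩb hp hz X
  have hline := isHolDisc_line hΩo hz X
  obtain ⟨⟨R, hR, hint⟩, hlim⟩ := hL _ hline
  rw [hg.genLeviForm_eq hΩo hΩb hp hz hR hint hlim]
  obtain ⟨-, -, -, -, -, hM0⟩ := exists_derivExtremal hΩo hΩb hp hz hX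
  have hB : 0 < pBergmanMetric Ω p z X := by
    rw [pBergmanMetric_eq hΩo hΩb hp1 hz]
    exact mul_pos (pBergmanMin_pos hΩo hΩb hp1 hz) hM0
  set B := pBergmanMetric Ω p z X with hBdef
  have hB2 : 0 < B ^ 2 := pow_pos hB 2
  refine iSup₂_le fun σ hσ => ?_
  obtain ⟨⟨R', hR', hint'⟩, hlim'⟩ := hL σ hσ
  have hlow := hg.le_genLaplacian_log_metric hΩo hΩc hΩb hp hz hX hσ hR' hint' hlim'
  have hneg : ((-(B ^ 2) : ℝ) : EReal) ≤ 0 := by exact_mod_cast neg_nonpos.2 hB2.le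
  refine (EReal.div_le_div_right_of_nonpos hneg hlow).trans (le_of_eq ?_)
  rw [← EReal.coe_div, ← EReal.coe_div, ← EReal.coe_mul, ← EReal.coe_add, ← hBdef]
  congr 1
  field_simp
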